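/- **Set-up.** Let $N$ be a positive definite even lattice of rank $l\ge 0$ with basis $b_1,\dots,b_l$ and pairing $(\cdot,\cdot)_N$, let $U$ be the hyperbolic plane and $r\ge 1$ an integer. Put $L=U_1\oplus N(-1)$ and $M=U\oplus L(r)$, where $U_1$ is a hyperbolic plane with isotropic basis $e_1,f_1$, $(e_1,f_1)=1$, and $U$ has isotropic basis $e,f$, $(e,f)=1$. On $L(r)$ we use $r(\cdot,\cdot)_L$; let $g$ be its Gram matrix in the basis $e_1,b_1,\dots,b_l,f_1$. Write $z=(\omega,\mathfrak z,\tau)=\omega e_1+\mathfrak z+\tau f_1\in L_{\mathbb C}$, $\mathfrak z\in N_{\mathbb C}$. The tube domain is $$\mathcal H=\{z:\ \mathrm{Im}\,\omega>0,\ \mathrm{Im}\,\tau>0,\ 2\,\mathrm{Im}\,\omega\,\mathrm{Im}\,\tau-(\mathrm{Im}\,\mathfrak z,\mathrm{Im}\,\mathfrak z)_N>0\}.$$ Put $\mathrm{Im}(z)^2=r(\mathrm{Im}\,z,\mathrm{Im}\,z)_L$, $z^2=r(z,z)_L$, $\tilde\varphi(z)=-\tfrac12z^2e+z+f\in M_{\mathbb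 C}$. Let $O^+(M)$ be the group of isometries of $M$ preserving the cone $\mathbb C^*\tilde\varphi(\mathcal H)$. For $\gamma\in O^+(M)$ define $\gamma z$ and $J(\gamma,z)$ by $\gamma\tilde\varphi(z)=J(\gamma,z)\tilde\varphi(\gamma z)$, and let $\lambda(\gamma,z)_{ij}=J(\gamma,z)\,\partial(\gamma z)_i/\partial z_j$. For $v,w$ in a quadratic space put $(v\wedge w)(x)=(w,x)v-(v,x)w$; $\wedge_L$ means that the pairing of $L$ is used. **Orthogonal forms.** For $F:\mathcal H\to(L_{\mathbb C}^\vee)^{\otimes s}$ and $k\in\mathbb Z$ let $(F|_k\gamma)(z)_{j_1\dots j_s}=J(\gamma,z)^{-k}\sum_{i_1,\dots,i_s}F_{i_1\dots i_s}(\gamma z)\prod_t\lambda(\gamma,z)_{i_tj_t}$. The lowering operator $\mathsf L$ raises $s$ by one: $$\mathsf L(F)_{I,a}=\mathrm{Im}(z)^2\frac{\partial F_I}{\partial\bar z_a}-2\Big(\sum_b\mathrm{Im}(z_b)\frac{\partial F_I}{\partial\bar z_b}\Big)\sum_c g_{ac}\,\mathrm{Im}(z_c).$$ For $\Gamma\subset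 O^+(M)$, $\mathrm{AHMod}_{k,s}(\Gamma)$ is the space of smooth $F$ with $F|_k\gamma=F$ for all $\gamma\in\Gamma$ and $\mathsf L^dF=0$ for some $d$. Let $\nu_b=(i\,\mathrm{Im}(z)^2)^{-1}\sum_a\mathrm{Im}(z_a)g_{ab}$. The constant term $\mathrm{ct}(F)$ of a polynomial $F$ in the $\nu_b$ with holomorphic coefficients is its coefficient of $\nu^0$. The quasimodular forms are $\mathrm{QMod}_{k,s}(\Gamma)=\mathrm{ct}(\mathrm{AHMod}_{k,s}(\Gamma))$, and $\mathsf L:=\mathrm{ct}\circ\mathsf L\circ\mathrm{ct}^{-1}$ on them. With $e(x)=e^{2\pi ix}$ and $\tilde q=e(\omega)$, the Fourier–Jacobi expansion $F=\sum_mF_m\tilde q^m$, $F_m=F_m(\mathfrak z,\tau,\nu_\omega,\nu_{\mathfrak z},\nu_\tau)$, of such an $F$ is obtained by writing $F$ as a polynomial in $\nu$ with holomorphic coefficients and expanding these coefficients in $\tilde q$. For a holomorphic $f$ it reads $f=\sum_mf_m(\mathfrak z,\tau)\tilde q^m$. Let $F_m^{\lim}$ be the specialization of $F_m$ at $\nu_\omega=0$,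 $\nu_{\mathfrak z}=0$, $\nu_\tau=\frac1{2i\,\mathrm{Im}\,\tau}$. For $v=v_1\otimes\dots\otimes v_s$ with all $v_j\in\{e_1,f_1\}\cup N_{\mathbb R}$ put $$v[\mathfrak z,\tau]=\exp\!\Big(\tfrac{\mathrm{Im}\,\mathfrak z}{\mathrm{Im}\,\tau}\wedge_Le_1\Big)v,\qquad \mathrm{wt}(v)=|\{j:v_j=f_1\}|-|\{j:v_j=e_1\}|,$$ where the exponential acts on each factor $v_j$. Endomorphisms such as $\mu\wedge_Le_1$ act on tensors $v$ as derivations. **Jacobi forms.** $\Gamma^J(N,\mathbb R)=\mathrm{SL}_2(\mathbb R)\ltimes H(N_{\mathbb R})$ is the group of pairs $(A,[x,y;\kappa])$, $x,y\in N_{\mathbb R}$, $\kappa\in\mathbb R$, with $[x,y;\kappa][x',y';\kappa']=[x+x',y+y';\kappa+\kappa'+\frac12((x,y')_N-(y,x')_N)]$ and $[x,y;\kappa]A=A[(x,y)A;\kappa]$. It acts on $M_{\mathbb R}$ as follows. The matrix $A=\left(\begin{smallmatrix}a&b\\c&d\end{smallmatrix}\right)$ fixes $N$ and sends $e\mapsto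 ae-\frac cre_1$, $e_1\mapsto-rbe+de_1$, $f_1\mapsto af_1+cf$, $f\mapsto bf_1+df$. The element $[x,y;\kappa]$ fixes $e,e_1$ and sends $n\mapsto n+r(y,n)_Ne+(x,n)_Ne_1$ for $n\in N$, $f_1\mapsto f_1+x+\frac12(x,x)_Ne_1+(\frac r2(x,y)_N-r\kappa)e$, $f\mapsto f+y+(\frac12(x,y)_N+\kappa)e_1+\frac r2(y,y)_Ne$. Let $H(N)=\{[x,y;\kappa]:x,y\in N,\ \kappa+\frac12(x,y)_N\in\mathbb Z\}$. For $\Phi:N_{\mathbb C}\times\mathbb H\to\mathbb C$ and $w=\mathfrak z+x\tau+y$ let $$(\Phi|_{k,m}(A,[x,y;\kappa]))(\mathfrak z,\tau)=(c\tau+d)^{-k}\,e\Big(m\Big(-\frac{c(w,w)_N}{2(c\tau+d)}+\frac{(x,x)_N}2\tau+(x,\mathfrak z)_N+\frac{(x,y)_N}2+\kappa\Big)\Big)\,\Phi\Big(\frac w{c\tau+d},\frac{a\tau+b}{c\tau+d}\Big).$$ A weakly almost-holomorphic Jacobi form of weight $k$ and index $m$ for a subgroup $G\subset\Gamma^J(N,\mathbb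 R)$ is a function $\Phi$ that is invariant under $|_{k,m}\gamma$ for all $\gamma\in G$ and is a polynomial in $\alpha_i=\mathrm{Im}\,\mathfrak z_i/\mathrm{Im}\,\tau$ and $1/\mathrm{Im}\,\tau$ with holomorphic coefficients on $N_{\mathbb C}\times\mathbb H$. Its constant term $\mathrm{ct}(\Phi)$, the coefficient of $\alpha^0(1/\mathrm{Im}\,\tau)^0$, is called a weakly quasi-Jacobi form. With $y=\mathrm{Im}\,\tau$ and $\mu\in N_{\mathbb R}$ put $$L^{\mathrm{Jac}}=-2iy\Big(y\frac{\partial}{\partial\bar\tau}+\sum_i\mathrm{Im}(\mathfrak z_i)\frac{\partial}{\partial\bar{\mathfrak z}_i}\Big),\qquad \xi_\mu=-2iy\sum_i\mu_i\frac{\partial}{\partial\bar{\mathfrak z}_i};$$ on weakly quasi-Jacobi forms these act as $\mathrm{ct}\circ T\circ\mathrm{ct}^{-1}$. **Theorem.** Let $\Gamma\subset O^+(M)$ be a subgroup of finite index with $\exp(e_1\wedge e)\in\Gamma$, let $k\in\mathbb Z$, $s\ge0$, and let $\Gamma^J=\Gamma\cap\Gamma^J(N,\mathbb R)$. 1. $\Gamma^J$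 is a subgroup of finite index in $\mathrm{SL}_2(\mathbb Z)\ltimes H(N)$. If $\Gamma=O^+(M)$, then $\Gamma^J=\Gamma_0(r)\ltimes H(N)$. 2. Let $F\in\mathrm{AHMod}_{k,s}(\Gamma)$. Then $F$ and $\mathsf L(F)$ have Fourier–Jacobi expansions $\sum_{m\in\mathbb Z}F_m\tilde q^m$ and $\sum_{m\in\mathbb Z}\mathsf L(F)_m\tilde q^m$, and $F_m=0$ for $m<0$ if $l\ge1$. For all $m\in\mathbb Z$ and all $v=v_1\otimes\dots\otimes v_s$ with $v_j\in\{e_1,f_1\}\cup N_{\mathbb R}$, the function $F_m^{\lim}(v[\mathfrak z,\tau])$ is a weakly almost-holomorphic Jacobi form of weight $k+\mathrm{wt}(v)$ and index $m$ for $\Gamma^J$ (so for $\Gamma_0(r)\ltimes H(N)$ if $\Gamma=O^+(M)$), and for all $\mu\in N_{\mathbb R}$ $$L^{\mathrm{Jac}}\big(F_m^{\lim}(v[\mathfrak z,\tau])\big)=\frac ir\,\mathsf L(F)_m^{\lim}\big((v\otimes e_1)[\mathfrak z,\tau]\big),\qquad \xi_\mu\big(F_m^{\lim}(v[\mathfrak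 z,\tau])\big)=F_m^{\lim}\big(((\mu\wedge_Le_1)v)[\mathfrak z,\tau]\big).$$ 3. Let $f\in\mathrm{QMod}_{k,s}(\Gamma)$. Then $f$ and $\mathsf L(f)$ have Fourier–Jacobi expansions $\sum_{m\in\mathbb Z}f_m\tilde q^m$ and $\sum_{m\in\mathbb Z}\mathsf L(f)_m\tilde q^m$, and $f_m=0$ for $m<0$ if $l\ge1$. For $m$, $v$, $\mu$ as in 2, $f_m(v)$ is a weakly quasi-Jacobi form of weight $k+\mathrm{wt}(v)$ and index $m$ for $\Gamma^J$, and $$L^{\mathrm{Jac}}\big(f_m(v)\big)=\frac ir\,\mathsf L(f)_m(v\otimes e_1),\qquad \xi_\mu\big(f_m(v)\big)=f_m\big((\mu\wedge_Le_1)v\big).$$ -/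

import Mathlib

open scoped ContDiff MatrixGroups

namespace OrthogonalFJ

noncomputable section

/-! ### Lattices and coordinates -/

/-- Coordinates on `L = U₁ ⊕ N(-1)` in the basis `e₁, b₁, …, b_l, f₁`. -/
abbrev LIdx (l : ℕ) : Type := Unit ⊕ (Fin l ⊕ Unit)

/-- Coordinates on `M = U ⊕ L(r)` in the basis `e, e₁, b₁, …, b_l, f₁, f`. -/
abbrev MIdx (l : ℕ) : Type := Unit ⊕ (LIdx l ⊕ Unit)

/-- The index of `e₁`, i.e. of the coordinate `ω`. -/
abbrev iE1 {l : ℕ} : LIdx l := Sum.inl ()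

/-- The index of `b_i`, i.e. of the coordinate `𝔷_i`. -/
abbrev iN {l : ℕ} (i : Fin l) : LIdx l := Sum.inr (Sum.inl i)

/-- The index of `f₁`, i.e. of the coordinate `τ`. -/
abbrev iF1 {l : ℕ} : LIdx l := Sum.inr (Sum.inr ())

/-- The index of a basis vector of `L` inside `M`. -/
abbrev iL {l : ℕ} (a : LIdx l) : MIdx l := Sum.inr (Sum.inl a)

/-- The index of `f` inside `M`. -/
abbrev iF {l : ℕ} : MIdx l := Sum.inr (Sum.inr ())

/-- The family with entries `a` at `e₁`, `n i` at `b_i`, `c` at `f₁`. -/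
def lvec {α : Type*} {l : ℕ} (a : α) (n : Fin l → α) (c : α) : LIdx l → α :=
  Sum.elim (fun _ => a) (Sum.elim n (fun _ => c))

/-- The family with entry `a` at `e`, entries `v` on the basis of `L`, and `d` at `f`. -/
def mvec {α : Type*} {l : ℕ} (a : α) (v : LIdx l → α) (d : α) : MIdx l → α :=
  Sum.elim (fun _ => a) (Sum.elim v (fun _ => d))

/-- The value at `(x, y)` of the bilinear form with integral Gram matrix `G`,
extended to coefficients in `K`. -/
def pair {ι K : Type*} [Fintype ι] [CommRing K] (G : Matrix ι ι ℤ) (x y : ι → K) : K :=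
  x ⬝ᵥ (G.map (Int.cast : ℤ → K)).mulVec y

/-- A positive definite even integral lattice with a chosen basis `b₁, …, b_l`, given by
its Gram matrix. -/
structure EvenLattice (l : ℕ) where
  gram : Matrix (Fin l) (Fin l) ℤ
  symm : gram.IsSymm
  even : ∀ x : Fin l → ℤ, Even (pair gram x x)
  posDef : (gram.map (Int.cast : ℤ → ℝ)).PosDef

/-- The Gram matrix of `L = U₁ ⊕ N(-1)`. -/
def gramL {l : ℕ} (N : EvenLattice l) : Matrix (LIdx l) (LIdx l) ℤ :=
  Matrix.of (lvec (lvec 0 0 1) (fun i => lvec 0 (fun j => -N.gram i j) 0) (lvec 1 0 0))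

/-- The Gram matrix of `M = U ⊕ L(r)`. -/
def gramM {l : ℕ} (N : EvenLattice l) (r : ℕ) : Matrix (MIdx l) (MIdx l) ℤ :=
  Matrix.of (mvec (mvec 0 0 1) (fun a => mvec 0 (fun b => (r : ℤ) * gramL N a b) 0)
    (mvec 1 0 0))

/-- The Eichler transvection `v ∧ w : x ↦ (w, x) v - (v, x) w`, as a matrix. -/
def eichler {ι K : Type*} [Fintype ι] [DecidableEq ι] [CommRing K] (G : Matrix ι ι ℤ)
    (v w : ι → K) : Matrix ι ι K :=
  Matrix.of fun i j => pair G w (Pi.single j 1) * v i - pair G v (Pi.single j 1) * w i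

/-- `e(x) = exp(2 π i x)`. -/
def qexp (x : ℂ) : ℂ := Complex.exp (2 * Real.pi * Complex.I * x)

/-! ### The affine cone, the group `O⁺(M)`, the tube domain -/

/-- The affine cone over the period domain. The component (one out of two) is the one on which
`Im (Z_{f₁} / Z_f) > 0`; it is the cone over the image of the tube domain below. -/
def affCone {l : ℕ} (N : EvenLattice l) (r : ℕ) : Set (MIdx l → ℂ) :=
  {Z | pair (gramM N r) Z Z = 0 ∧ 0 < (pair (gramM N r) Z (star Z)).re ∧
    0 < (Z (iL iF1) * star (Z iF)).im}

/-- The matrix of an automorphism of the `ℤ`-module underlying `M`, acting on `M_ℂ`. -/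
def toC {l : ℕ} (γ : GL (MIdx l) ℤ) : Matrix (MIdx l) (MIdx l) ℂ :=
  (Matrix.GeneralLinearGroup.map (Int.castRingHom ℂ) γ : GL (MIdx l) ℂ)

lemma toC_one {l : ℕ} : toC (1 : GL (MIdx l) ℤ) = 1 := by
  simp [toC]

lemma toC_mul {l : ℕ} (γ δ : GL (MIdx l) ℤ) : toC (γ * δ) = toC γ * toC δ := by
  simp [toC]

/-- The group `O⁺(M)` of isometries of `M` which preserve the chosen component. -/
def OPlus {l : ℕ} (N : EvenLattice l) (r : ℕ) : Subgroup (GL (MIdx l) ℤ) where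
  carrier := {γ | (∀ x y : MIdx l → ℤ,
      pair (gramM N r) ((γ : Matrix (MIdx l) (MIdx l) ℤ).mulVec x)
        ((γ : Matrix (MIdx l) (MIdx l) ℤ).mulVec y) = pair (gramM N r) x y) ∧
    ∀ Z : MIdx l → ℂ, (toC γ).mulVec Z ∈ affCone N r ↔ Z ∈ affCone N r}
  one_mem' := by
    refine ⟨fun x y => by simp, fun Z => by simp [toC_one]⟩
  mul_mem' := by
    rintro γ δ ⟨h1, h2⟩ ⟨h3, h4⟩
    refine ⟨fun x y => ?_, fun Z => ?_⟩
    · rw [Units.val_mul, ← Matrix.mulVec_mulVec, ← Matrix.mulVec_mulVec, h1, h3]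
    · rw [toC_mul, ← Matrix.mulVec_mulVec, h2, h4]
  inv_mem' := by
    rintro γ ⟨h1, h2⟩
    refine ⟨fun x y => ?_, fun Z => ?_⟩
    · rw [← h1, Matrix.mulVec_mulVec, Matrix.mulVec_mulVec, ← Units.val_mul]
      simp
    · rw [← h2, Matrix.mulVec_mulVec, ← toC_mul]
      simp [toC_one]

/-- The imaginary part of a vector of `L_ℂ`. -/
def imVec {l : ℕ} (z : LIdx l → ℂ) : LIdx l → ℝ := fun a => (z a).im

/-- `Im(z)²`, formed with the pairing of `M`, i.e. of `L(r)`. -/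
def imSq {l : ℕ} (N : EvenLattice l) (r : ℕ) (z : LIdx l → ℂ) : ℝ :=
  r * pair (gramL N) (imVec z) (imVec z)

/-- The tube domain of all `z = (ω, 𝔷, τ)` with `Im ω, Im τ > 0` and
`2 Im ω Im τ - (Im 𝔷, Im 𝔷)_N > 0`. -/
def tube {l : ℕ} (N : EvenLattice l) : Set (LIdx l → ℂ) :=
  {z | 0 < (z iE1).im ∧ 0 < (z iF1).im ∧ 0 < pair (gramL N) (imVec z) (imVec z)}

/-- The lift `z ↦ (-z²/2, z, 1)` of the tube domain into the affine cone. -/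
def phiTilde {l : ℕ} (N : EvenLattice l) (r : ℕ) (z : LIdx l → ℂ) : MIdx l → ℂ :=
  mvec (-(1 / 2) * (r * pair (gramL N) z z)) z 1

/-- The factor of automorphy `J(γ, z)`, determined by `γ φ̃(z) = J(γ, z) φ̃(γ z)`. -/
def autJ {l : ℕ} (N : EvenLattice l) (r : ℕ) (γ : GL (MIdx l) ℤ) (z : LIdx l → ℂ) : ℂ :=
  (toC γ).mulVec (phiTilde N r z) iF

/-- The action of `γ` on the tube domain, determined by `γ φ̃(z) = J(γ, z) φ̃(γ z)`. -/
def act {l : ℕ} (N : EvenLattice l) (r : ℕ) (γ : GL (MIdx l) ℤ) (z : LIdx l → ℂ) :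
    LIdx l → ℂ :=
  fun a => (toC γ).mulVec (phiTilde N r z) (iL a) / autJ N r γ z

/-- `λ(γ, z)_{ij} = J(γ, z) ∂(γ z)_i / ∂z_j`. -/
def autLambda {l : ℕ} (N : EvenLattice l) (r : ℕ) (γ : GL (MIdx l) ℤ) (z : LIdx l → ℂ)
    (i j : LIdx l) : ℂ :=
  autJ N r γ z * fderiv ℂ (act N r γ) z (Pi.single j 1) i

/-! ### Tensors, the lowering operator, almost-holomorphic modular forms -/

/-- Elements of `(L_ℂ^∨)^{⊗ s}`, given by their coefficients. -/
abbrev Tensor (l s : ℕ) : Type := (Fin s → LIdx l) → ℂ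

/-- The value of a tensor on `v₁ ⊗ ⋯ ⊗ v_s`. -/
def tensorEval {l s : ℕ} (T : Tensor l s) (v : Fin s → LIdx l → ℂ) : ℂ :=
  ∑ I : Fin s → LIdx l, T I * ∏ j, v j (I j)

/-- The slash operator of weight `k` on tensor valued functions. -/
def slash {l s : ℕ} (N : EvenLattice l) (r : ℕ) (k : ℤ) (γ : GL (MIdx l) ℤ)
    (F : (LIdx l → ℂ) → Tensor l s) : (LIdx l → ℂ) → Tensor l s :=
  fun z J => autJ N r γ z ^ (-k) *
    ∑ I : Fin s → LIdx l, F (act N r γ z) I * ∏ j, autLambda N r γ z (I j) (J j)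

/-- The derivative `½ (∂_v + i ∂_{iv})`. For a coordinate vector `v` it is the derivative with
respect to the complex conjugate of that coordinate. -/
def dbar {E : Type*} [NormedAddCommGroup E] [NormedSpace ℂ E] [NormedSpace ℝ E]
    (f : E → ℂ) (p v : E) : ℂ :=
  (1 / 2) * (fderiv ℝ f p v + Complex.I * fderiv ℝ f p (Complex.I • v))

/-- The orthogonal lowering operator on the tube domain: the last index `a` of `𝖫(F)_{I,a}` is
the new one, and `𝖫(F)_{I,a} = Im(z)² ∂F_I/∂z̄_a - 2 (∑_b Im(z_b) ∂F_I/∂z̄_b) ∑_c g_{ac} Im(z_c)`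
with `g` the Gram matrix of `L(r)`. -/
def lowering {l s : ℕ} (N : EvenLattice l) (r : ℕ) (F : (LIdx l → ℂ) → Tensor l s) :
    (LIdx l → ℂ) → Tensor l (s + 1) :=
  fun z J =>
    imSq N r z * dbar (fun w => F w (fun i => J i.castSucc)) z (Pi.single (J (Fin.last s)) 1)
    - 2 * (∑ b, dbar (fun w => F w (fun i => J i.castSucc)) z (Pi.single b 1) * (imVec z b : ℂ))
      * ∑ c, ((r : ℂ) * (gramL N (J (Fin.last s)) c : ℂ)) * (imVec z c : ℂ)

/-- The iterates `𝖫^d`. -/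
def lowerIter {l s : ℕ} (N : EvenLattice l) (r : ℕ) (F : (LIdx l → ℂ) → Tensor l s) :
    (d : ℕ) → (LIdx l → ℂ) → Tensor l (s + d)
  | 0 => F
  | d + 1 => lowering N r (lowerIter N r F d)

/-- Almost-holomorphic modular forms of weight `k` and rank `s` for `Γ`, as tensor valued
functions on the tube domain. (No condition at the cusps is imposed.) -/
structure IsAHMod {l s : ℕ} (N : EvenLattice l) (r : ℕ) (Γ : Subgroup (GL (MIdx l) ℤ)) (k : ℤ)
    (F : (LIdx l → ℂ) → Tensor l s) : Prop where
  smooth : ContDiffOn ℝ ∞ F (tube N)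
  slash_eq : ∀ γ ∈ Γ, ∀ z ∈ tube N, slash N r k γ F z = F z
  almostHol : ∃ d : ℕ, ∀ z ∈ tube N, lowerIter N r F d z = 0

/-! ### Polynomials in non-holomorphic variables -/

/-- On `D`, the function `Φ` is the polynomial `Q` in the functions `X i`, with holomorphic
functions on `D` as coefficients. -/
structure IsPolyExpansion {E σ : Type*} [NormedAddCommGroup E] [NormedSpace ℂ E]
    (D : Set E) (X : E → σ → ℂ) (Φ : E → ℂ) (Q : E → MvPolynomial σ ℂ) : Prop where
  degree_le : ∃ d : ℕ, ∀ p ∈ D, (Q p).totalDegree ≤ d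
  hol : ∀ t : σ →₀ ℕ, DifferentiableOn ℂ (fun p => (Q p).coeff t) D
  eq : ∀ p ∈ D, Φ p = MvPolynomial.eval (X p) (Q p)

/-- The coefficients `ν_b` of `ν = ∂ log (Im(z)²) = (i Im(z)²)⁻¹ ∑_{a,b} Im(z_a) g_{ab} dz_b`. -/
def nu {l : ℕ} (N : EvenLattice l) (r : ℕ) (z : LIdx l → ℂ) (b : LIdx l) : ℂ :=
  (∑ a, (imVec z a : ℂ) * ((r : ℂ) * (gramL N a b : ℂ))) / (Complex.I * imSq N r z)

/-- The components of `F` are the polynomials `p` in the `ν_b`, with holomorphic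
coefficients. -/
def IsNuExpansion {l s : ℕ} (N : EvenLattice l) (r : ℕ) (F : (LIdx l → ℂ) → Tensor l s)
    (p : (LIdx l → ℂ) → (Fin s → LIdx l) → MvPolynomial (LIdx l) ℂ) : Prop :=
  ∀ I, IsPolyExpansion (tube N) (nu N r) (fun z => F z I) (fun z => p z I)

/-- `f` is the constant term `F|_{ν = 0}`. -/
def IsCt {l s : ℕ} (N : EvenLattice l) (r : ℕ) (F f : (LIdx l → ℂ) → Tensor l s) : Prop :=
  ∃ p, IsNuExpansion N r F p ∧ ∀ z ∈ tube N, ∀ I, f z I = (p z I).coeff 0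

/-- `f` is a quasimodular form of weight `k` and rank `s` for `Γ`. -/
def IsQMod {l s : ℕ} (N : EvenLattice l) (r : ℕ) (Γ : Subgroup (GL (MIdx l) ℤ)) (k : ℤ)
    (f : (LIdx l → ℂ) → Tensor l s) : Prop :=
  ∃ F, IsAHMod N r Γ k F ∧ IsCt N r F f

/-- `g = 𝖫(f)` for a quasimodular form `f` of weight `k`, where `𝖫 := ct ∘ 𝖫 ∘ ct⁻¹`. -/
def IsQLowering {l s : ℕ} (N : EvenLattice l) (r : ℕ) (Γ : Subgroup (GL (MIdx l) ℤ)) (k : ℤ)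
    (f : (LIdx l → ℂ) → Tensor l s) (g : (LIdx l → ℂ) → Tensor l (s + 1)) : Prop :=
  ∃ F, IsAHMod N r Γ k F ∧ IsCt N r F f ∧ IsCt N r (lowering N r F) g

/-! ### Fourier–Jacobi expansions -/

/-- The pair `(𝔷, τ)` of the point `z = (ω, 𝔷, τ)`. -/
def zTau {l : ℕ} (z : LIdx l → ℂ) : (Fin l → ℂ) × ℂ := (fun i => z (iN i), z iF1)

/-- `h = ∑_m h_m(𝔷, τ) q̃^m` on the tube domain, with `q̃ = e(ω)`. -/
def IsFourierExpansion {l : ℕ} (N : EvenLattice l) (h : (LIdx l → ℂ) → ℂ)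
    (hm : ℤ → (Fin l → ℂ) × ℂ → ℂ) : Prop :=
  ∀ z ∈ tube N, HasSum (fun m : ℤ => hm m (zTau z) * qexp (m * z iE1)) (h z)

/-- `f = ∑_m f_m q̃^m` for a tensor valued function `f`. -/
def IsTensorExpansion {l s : ℕ} (N : EvenLattice l) (f : (LIdx l → ℂ) → Tensor l s)
    (fm : ℤ → (Fin l → ℂ) × ℂ → Tensor l s) : Prop :=
  ∀ I, IsFourierExpansion N (fun z => f z I) (fun m q => fm m q I)

/-- `F = ∑_m F_m q̃^m`, where `F_m = F_m(𝔷, τ, ν_ω, ν_𝔷, ν_τ)` is obtained by writing `F` as a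
polynomial in `ν` and expanding its holomorphic coefficients in `q̃`. -/
def IsFJExpansion {l s : ℕ} (N : EvenLattice l) (r : ℕ) (F : (LIdx l → ℂ) → Tensor l s)
    (P : ℤ → (Fin l → ℂ) × ℂ → (Fin s → LIdx l) → MvPolynomial (LIdx l) ℂ) : Prop :=
  ∃ p, IsNuExpansion N r F p ∧
    ∀ I t, IsFourierExpansion N (fun z => (p z I).coeff t) (fun m q => (P m q I).coeff t)

/-- The vector `e₁` of `L`. -/
def vE1 {l : ℕ} {K : Type*} [Zero K] [One K] : LIdx l → K := lvec 1 0 0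

/-- The vector `f₁` of `L`. -/
def vF1 {l : ℕ} {K : Type*} [Zero K] [One K] : LIdx l → K := lvec 0 0 1

/-- `v_j ∈ {e₁, f₁} ∪ N_ℝ` for all `j`. -/
def IsHomogeneous {l s : ℕ} (v : Fin s → LIdx l → ℝ) : Prop :=
  ∀ j, v j = vE1 ∨ v j = vF1 ∨ ∃ x : Fin l → ℝ, v j = lvec 0 x 0

open Classical in
/-- `wt(v) = |{j : v_j = f₁}| - |{j : v_j = e₁}|`. -/
def wt {l s : ℕ} (v : Fin s → LIdx l → ℝ) : ℤ :=
  ((Finset.univ.filter fun j => v j = vF1).card : ℤ) -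
    ((Finset.univ.filter fun j => v j = vE1).card : ℤ)

/-- The vector `v` viewed in `L_ℂ`. -/
def complexify {ι : Type*} (v : ι → ℝ) : ι → ℂ := fun a => (v a : ℂ)

/-- The value of a tensor on `v₁ ⊗ ⋯ ⊗ v_s` for real vectors `v_j ∈ L_ℝ`. -/
def realEval {l s : ℕ} (T : Tensor l s) (v : Fin s → LIdx l → ℝ) : ℂ :=
  tensorEval T (fun j => complexify (v j))

/-- The matrix `exp((Im 𝔷 / Im τ) ∧_L e₁)`, by which `v[𝔷, τ]` is obtained from `v`. -/
def twist {l : ℕ} (N : EvenLattice l) (q : (Fin l → ℂ) × ℂ) : Matrix (LIdx l) (LIdx l) ℂ :=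
  NormedSpace.exp (eichler (gramL N) (lvec 0 (fun i => (((q.1 i).im / q.2.im : ℝ) : ℂ)) 0) vE1)

/-- `F_m^{lim}(v[𝔷, τ])`, where `lim` is the specialization `ν_ω = ν_𝔷 = 0`,
`ν_τ = 1 / (2 i Im τ)`. -/
def fjLim {l s : ℕ} (N : EvenLattice l)
    (P : ℤ → (Fin l → ℂ) × ℂ → (Fin s → LIdx l) → MvPolynomial (LIdx l) ℂ)
    (m : ℤ) (v : Fin s → LIdx l → ℝ) : (Fin l → ℂ) × ℂ → ℂ :=
  fun q => tensorEval
    (fun I => MvPolynomial.eval (lvec 0 0 (1 / (2 * Complex.I * (q.2.im : ℂ)))) (P m q I))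
    (fun j => (twist N q).mulVec (complexify (v j)))

/-- The `j`-th summand `v₁ ⊗ ⋯ ⊗ (μ ∧_L e₁) v_j ⊗ ⋯ ⊗ v_s` of `(μ ∧_L e₁) v`. -/
def transvectAt {l s : ℕ} (N : EvenLattice l) (μ : Fin l → ℝ) (v : Fin s → LIdx l → ℝ)
    (j : Fin s) : Fin s → LIdx l → ℝ :=
  Function.update v j ((eichler (gramL N) (lvec 0 μ 0) vE1).mulVec (v j))

/-- `v ⊗ e₁`. -/
def tensorE1 {l s : ℕ} (v : Fin s → LIdx l → ℝ) : Fin (s + 1) → LIdx l → ℝ :=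
  Fin.snoc (α := fun _ => LIdx l → ℝ) v vE1

/-! ### The Jacobi group -/

lemma pair_add_left {ι K : Type*} [Fintype ι] [CommRing K] (G : Matrix ι ι ℤ) (x y z : ι → K) :
    pair G (x + y) z = pair G x z + pair G y z := by
  simp [pair, add_dotProduct]

lemma pair_add_right {ι K : Type*} [Fintype ι] [CommRing K] (G : Matrix ι ι ℤ) (x y z : ι → K) :
    pair G x (y + z) = pair G x y + pair G x z := by
  simp [pair, Matrix.mulVec_add]

lemma pair_smul_left {ι K : Type*} [Fintype ι] [CommRing K] (G : Matrix ι ι ℤ) (a : K)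
    (x y : ι → K) : pair G (a • x) y = a * pair G x y := by
  simp [pair]

lemma pair_smul_right {ι K : Type*} [Fintype ι] [CommRing K] (G : Matrix ι ι ℤ) (a : K)
    (x y : ι → K) : pair G x (a • y) = a * pair G x y := by
  simp [pair, Matrix.mulVec_smul]

lemma pair_comm {l : ℕ} {K : Type*} [CommRing K] (N : EvenLattice l) (x y : Fin l → K) :
    pair N.gram x y = pair N.gram y x := by
  have h : (N.gram.map (Int.cast : ℤ → K)).transpose = N.gram.map (Int.cast : ℤ → K) := by
    rw [← Matrix.transpose_map, N.symm.eq]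
  rw [pair, pair, ← h, Matrix.mulVec_transpose, h, dotProduct_comm, Matrix.dotProduct_mulVec]

/-- The real Jacobi group `SL₂(ℝ) ⋉ H(N_ℝ)`, with elements `(A, [x, y; κ])`. -/
@[ext] structure JacobiGroup {l : ℕ} (N : EvenLattice l) where
  A : SL(2, ℝ)
  x : Fin l → ℝ
  y : Fin l → ℝ
  κ : ℝ

namespace JacobiGroup

variable {l : ℕ} {N : EvenLattice l}

instance : Mul (JacobiGroup N) where
  mul γ δ :=
    { A := γ.A * δ.A
      x := (δ.A 0 0 • γ.x + δ.A 1 0 • γ.y) + δ.x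
      y := (δ.A 0 1 • γ.x + δ.A 1 1 • γ.y) + δ.y
      κ := γ.κ + δ.κ + 1 / 2 * (pair N.gram (δ.A 0 0 • γ.x + δ.A 1 0 • γ.y) δ.y
        - pair N.gram (δ.A 0 1 • γ.x + δ.A 1 1 • γ.y) δ.x) }

instance : One (JacobiGroup N) where
  one := ⟨1, 0, 0, 0⟩

instance : Inv (JacobiGroup N) where
  inv γ :=
    { A := γ.A⁻¹
      x := -(γ.A 1 1 • γ.x - γ.A 1 0 • γ.y)
      y := -(-γ.A 0 1 • γ.x + γ.A 0 0 • γ.y)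
      κ := -γ.κ }

@[simp] lemma mul_A (γ δ : JacobiGroup N) : (γ * δ).A = γ.A * δ.A := rfl
@[simp] lemma mul_x (γ δ : JacobiGroup N) :
    (γ * δ).x = (δ.A 0 0 • γ.x + δ.A 1 0 • γ.y) + δ.x := rfl
@[simp] lemma mul_y (γ δ : JacobiGroup N) :
    (γ * δ).y = (δ.A 0 1 • γ.x + δ.A 1 1 • γ.y) + δ.y := rfl
@[simp] lemma mul_κ (γ δ : JacobiGroup N) :
    (γ * δ).κ = γ.κ + δ.κ + 1 / 2 * (pair N.gram (δ.A 0 0 • γ.x + δ.A 1 0 • γ.y) δ.y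
        - pair N.gram (δ.A 0 1 • γ.x + δ.A 1 1 • γ.y) δ.x) := rfl
@[simp] lemma one_A : (1 : JacobiGroup N).A = 1 := rfl
@[simp] lemma one_x : (1 : JacobiGroup N).x = 0 := rfl
@[simp] lemma one_y : (1 : JacobiGroup N).y = 0 := rfl
@[simp] lemma one_κ : (1 : JacobiGroup N).κ = 0 := rfl
@[simp] lemma inv_A (γ : JacobiGroup N) : γ⁻¹.A = γ.A⁻¹ := rfl
@[simp] lemma inv_x (γ : JacobiGroup N) :
    γ⁻¹.x = -(γ.A 1 1 • γ.x - γ.A 1 0 • γ.y) := rfl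
@[simp] lemma inv_y (γ : JacobiGroup N) :
    γ⁻¹.y = -(-γ.A 0 1 • γ.x + γ.A 0 0 • γ.y) := rfl
@[simp] lemma inv_κ (γ : JacobiGroup N) : γ⁻¹.κ = -γ.κ := rfl

lemma det_eq (A : SL(2, ℝ)) : A 0 0 * A 1 1 - A 0 1 * A 1 0 = 1 := by
  have h := A.det_coe
  rwa [Matrix.det_fin_two] at h

lemma sl_mul_apply (A B : SL(2, ℝ)) (i j : Fin 2) :
    (A * B) i j = A i 0 * B 0 j + A i 1 * B 1 j := by
  simp [Matrix.mul_apply, Fin.sum_univ_two]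

instance : Group (JacobiGroup N) :=
  Group.ofLeftAxioms
    (by
      intro a b c
      have hc := det_eq c.A
      ext
      · simp [mul_assoc]
      · simp [sl_mul_apply]; ring
      · simp [sl_mul_apply]; ring
      · simp only [mul_κ, mul_x, mul_y, mul_A, sl_mul_apply, pair_add_left, pair_add_right,
          pair_smul_left, pair_smul_right]
        linear_combination (-(1 / 2) * (b.A 0 0 * pair N.gram a.x b.y
          + b.A 1 0 * pair N.gram a.y b.y - b.A 0 1 * pair N.gram a.x b.x
          - b.A 1 1 * pair N.gram a.y b.x)) * hc)
    (by
      intro a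
      ext <;> simp [pair])
    (by
      intro a
      have hc := det_eq a.A
      ext
      · simp
      · rename_i i; simp; linear_combination (-a.x i) * hc
      · rename_i i; simp; linear_combination (-a.y i) * hc
      · have hx : a.A 0 0 • a⁻¹.x + a.A 1 0 • a⁻¹.y = (-1 : ℝ) • a.x := by
          ext i; simp; linear_combination (-a.x i) * hc
        have hy : a.A 0 1 • a⁻¹.x + a.A 1 1 • a⁻¹.y = (-1 : ℝ) • a.y := by
          ext i; simp; linear_combination (-a.y i) * hc
        rw [mul_κ, hx, hy, pair_smul_left, pair_smul_left, pair_comm N a.x a.y]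
        simp)

/-- The matrix of `A ∈ SL₂(ℝ)` acting on `M_ℝ`, in the basis `e, e₁, b₁, …, b_l, f₁, f`. -/
def slMatrix (r : ℕ) (A : SL(2, ℝ)) : Matrix (MIdx l) (MIdx l) ℝ :=
  Matrix.of (mvec
    (mvec (A 0 0) (lvec (-(r * A 0 1)) 0 0) 0)
    (lvec
      (mvec (-(A 1 0 / r)) (lvec (A 1 1) 0 0) 0)
      (fun i => mvec 0 (lvec 0 (Pi.single i 1) 0) 0)
      (mvec 0 (lvec 0 0 (A 0 0)) (A 0 1)))
    (mvec 0 (lvec 0 0 (A 1 0)) (A 1 1)))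

variable (N) in
/-- The matrix of `[x, y; κ]` acting on `M_ℝ`, in the basis `e, e₁, b₁, …, b_l, f₁, f`. -/
def heisMatrix (r : ℕ) (x y : Fin l → ℝ) (κ : ℝ) : Matrix (MIdx l) (MIdx l) ℝ :=
  Matrix.of (mvec
    (mvec 1 (lvec 0 (fun j => r * pair N.gram y (Pi.single j 1))
      (r / 2 * pair N.gram x y - r * κ)) (r / 2 * pair N.gram y y))
    (lvec
      (mvec 0 (lvec 1 (fun j => pair N.gram x (Pi.single j 1)) (1 / 2 * pair N.gram x x))
        (1 / 2 * pair N.gram x y + κ))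
      (fun i => mvec 0 (lvec 0 (Pi.single i 1) (x i)) (y i))
      (mvec 0 (lvec 0 0 1) 0))
    (mvec 0 (lvec 0 0 0) 1))

/-- The matrix of `(A, [x, y; κ])` acting on `M_ℝ`. -/
def toMatrix (r : ℕ) (γ : JacobiGroup N) : Matrix (MIdx l) (MIdx l) ℝ :=
  slMatrix r γ.A * heisMatrix N r γ.x γ.y γ.κ

lemma sum_MIdx {K : Type*} [AddCommMonoid K] (f : MIdx l → K) :
    ∑ i, f i = f (Sum.inl ()) + (f (iL iE1) + ((∑ i, f (iL (iN i))) + f (iL iF1)) + f iF) := by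
  simp [Fintype.sum_sum_type]

lemma slMatrix_mul (r : ℕ) [NeZero r] (A B : SL(2, ℝ)) :
    slMatrix (l := l) r (A * B) = slMatrix r A * slMatrix r B := by
  have hr : (r : ℝ) ≠ 0 := Nat.cast_ne_zero.mpr (NeZero.ne r)
  ext i j
  rw [Matrix.mul_apply, sum_MIdx]
  rcases i with _ | (_ | i | _) | _ <;> rcases j with _ | (_ | j | _) | _ <;>
    simp [slMatrix, mvec, lvec, sl_mul_apply, Pi.single_apply] <;> field_simp <;> ring

lemma slMatrix_one (r : ℕ) : slMatrix (l := l) r 1 = 1 := by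
  ext i j
  rcases i with _ | (_ | i | _) | _ <;> rcases j with _ | (_ | j | _) | _ <;>
    simp [slMatrix, mvec, lvec, Matrix.one_apply, Pi.single_apply, eq_comm]

lemma pair_eq_sum (x y : Fin l → ℝ) :
    pair N.gram x y = ∑ j, pair N.gram x (Pi.single j 1) * y j := by
  simp only [pair, Matrix.mulVec_single_one, Matrix.dotProduct_mulVec]
  rfl

lemma heisMatrix_zero (r : ℕ) : heisMatrix N r 0 0 0 = 1 := by
  ext i j
  rcases i with _ | (_ | i | _) | _ <;> rcases j with _ | (_ | j | _) | _ <;>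
    simp [heisMatrix, mvec, lvec, Matrix.one_apply, Pi.single_apply, eq_comm, pair]

lemma heisMatrix_mul (r : ℕ) (x y x' y' : Fin l → ℝ) (κ κ' : ℝ) :
    heisMatrix N r x y κ * heisMatrix N r x' y' κ' =
      heisMatrix N r (x + x') (y + y')
        (κ + κ' + 1 / 2 * (pair N.gram x y' - pair N.gram y x')) := by
  ext i j
  rw [Matrix.mul_apply, sum_MIdx]
  rcases i with _ | (_ | i | _) | _ <;> rcases j with _ | (_ | j | _) | _ <;>
    simp [heisMatrix, mvec, lvec, Pi.single_apply, mul_assoc, ← Finset.mul_sum,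
      ← pair_eq_sum, pair_add_left, pair_add_right] <;>
    first
      | ring1
      | (rw [pair_comm N x' y]; ring1)
      | (rw [pair_comm N x' x]; ring1)
      | (rw [pair_comm N y' y]; ring1)

lemma heisMatrix_mul_slMatrix (r : ℕ) [NeZero r] (A : SL(2, ℝ)) (x y : Fin l → ℝ) (κ : ℝ) :
    heisMatrix N r x y κ * slMatrix r A =
      slMatrix r A * heisMatrix N r (A 0 0 • x + A 1 0 • y) (A 0 1 • x + A 1 1 • y) κ := by
  have hr : (r : ℝ) ≠ 0 := Nat.cast_ne_zero.mpr (NeZero.ne r)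
  have hd := det_eq A
  have hxy := pair_comm N x y
  ext i j
  rw [Matrix.mul_apply, Matrix.mul_apply, sum_MIdx, sum_MIdx]
  simp only [heisMatrix, slMatrix, pair_add_left, pair_add_right, pair_smul_left, pair_smul_right]
  generalize A 0 0 = a at *
  generalize A 0 1 = b at *
  generalize A 1 0 = c at *
  generalize A 1 1 = d at *
  rcases i with _ | (_ | i | _) | _ <;> rcases j with _ | (_ | j | _) | _ <;>
    simp [mvec, lvec, Pi.single_apply] <;> (try field_simp)
  · linear_combination (-pair N.gram y (Pi.single j 1)) * hd
  · linear_combination (-(pair N.gram x y * a + pair N.gram y y * c)) * hd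
  · linear_combination (-(b * pair N.gram y x + d * pair N.gram y y)) * hd + b * hxy
  · linear_combination (-pair N.gram x (Pi.single j 1)) * hd
  · linear_combination (-(a * pair N.gram x x + c * pair N.gram y x)) * hd + c * hxy
  · linear_combination (-(b * pair N.gram x x + d * pair N.gram x y)) * hd

/-- The embedding `Γ^J(N, ℝ) → GL(M_ℝ)`. -/
def toGL (N : EvenLattice l) (r : ℕ) [NeZero r] : JacobiGroup N →* GL (MIdx l) ℝ :=
  MonoidHom.toHomUnits
    { toFun := toMatrix r
      map_one' := by
        simp [toMatrix, slMatrix_one, heisMatrix_zero]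
      map_mul' := fun γ δ => by
        have h := heisMatrix_mul (N := N) r (δ.A 0 0 • γ.x + δ.A 1 0 • γ.y)
          (δ.A 0 1 • γ.x + δ.A 1 1 • γ.y) δ.x δ.y γ.κ δ.κ
        simp only [toMatrix, mul_A, mul_x, mul_y, mul_κ]
        rw [slMatrix_mul, ← h, Matrix.mul_assoc, Matrix.mul_assoc,
          ← Matrix.mul_assoc (heisMatrix N r γ.x γ.y γ.κ), heisMatrix_mul_slMatrix,
          Matrix.mul_assoc] }

lemma coe_toGL (r : ℕ) [NeZero r] (γ : JacobiGroup N) :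
    (toGL N r γ : Matrix (MIdx l) (MIdx l) ℝ) = toMatrix r γ := rfl

end JacobiGroup

/-- `Γ ∩ Γ^J(N, ℝ)`. -/
def jacobiPart {l : ℕ} (N : EvenLattice l) (r : ℕ) [NeZero r] (Γ : Subgroup (GL (MIdx l) ℤ)) :
    Subgroup (JacobiGroup N) :=
  (Γ.map (Matrix.GeneralLinearGroup.map (Int.castRingHom ℝ))).comap (JacobiGroup.toGL N r)

lemma pair_intCast {l : ℕ} (N : EvenLattice l) (x y : Fin l → ℤ) :
    pair N.gram (fun i => (x i : ℝ)) (fun i => (y i : ℝ)) = (pair N.gram x y : ℤ) := by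
  simp [pair, dotProduct, Matrix.mulVec]

/-- `Γ₀(r) ⋉ H(N)`, where `H(N)` consists of all `[x, y; κ]` with `x, y ∈ N`, `κ ∈ ½ℤ` and
`κ + ½ (x, y)_N ∈ ℤ`. For `r = 1` this is `Γ^J(N, ℤ) = SL₂(ℤ) ⋉ H(N)`. -/
def gammaZeroHeis {l : ℕ} (N : EvenLattice l) (r : ℕ) : Subgroup (JacobiGroup N) where
  carrier := {γ | (∃ A ∈ CongruenceSubgroup.Gamma0 r,
      γ.A = Matrix.SpecialLinearGroup.map (Int.castRingHom ℝ) A) ∧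
    ∃ (x y : Fin l → ℤ) (n : ℤ), γ.x = (fun i => (x i : ℝ)) ∧ γ.y = (fun i => (y i : ℝ)) ∧
      γ.κ + 1 / 2 * pair N.gram γ.x γ.y = n}
  one_mem' := by
    refine ⟨⟨1, one_mem _, by simp⟩, 0, 0, 0, ?_, ?_, ?_⟩
    · ext i; simp
    · ext i; simp
    · simp [pair]
  mul_mem' := by
    rintro γ δ ⟨⟨A, hA, hγ⟩, x, y, n, hx, hy, hn⟩ ⟨⟨B, hB, hδ⟩, x', y', n', hx', hy', hn'⟩
    have hd := JacobiGroup.det_eq δ.A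
    obtain ⟨X, hX⟩ := N.even x
    obtain ⟨Y, hY⟩ := N.even y
    have h1 := pair_intCast N x x
    have h2 := pair_intCast N y y
    have h3 := pair_intCast N x y
    have h4 := pair_intCast N x y'
    have h5 := pair_intCast N y y'
    rw [← hx] at h1 h3 h4
    rw [← hy] at h2 h3 h5
    rw [← hy'] at h4 h5
    rw [hX] at h1
    rw [hY] at h2
    push_cast at h1 h2
    have e00 : δ.A 0 0 = (B 0 0 : ℤ) := by simp [hδ]
    have e01 : δ.A 0 1 = (B 0 1 : ℤ) := by simp [hδ]
    have e10 : δ.A 1 0 = (B 1 0 : ℤ) := by simp [hδ]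
    have e11 : δ.A 1 1 = (B 1 1 : ℤ) := by simp [hδ]
    refine ⟨⟨A * B, mul_mem hA hB, by simp [hγ, hδ]⟩,
      (B 0 0 • x + B 1 0 • y) + x', (B 0 1 • x + B 1 1 • y) + y',
      n + n' + B 0 0 * B 0 1 * X + B 1 0 * B 1 1 * Y + B 0 1 * B 1 0 * pair N.gram x y
        + B 0 0 * pair N.gram x y' + B 1 0 * pair N.gram y y', ?_, ?_, ?_⟩
    · ext i; simp [hδ, hx, hy, hx']
    · ext i; simp [hδ, hx, hy, hy']
    · have c1 := pair_comm N γ.x γ.y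
      have c2 := pair_comm N δ.x γ.x
      have c3 := pair_comm N δ.x γ.y
      simp only [JacobiGroup.mul_x, JacobiGroup.mul_y, JacobiGroup.mul_κ, pair_add_left,
        pair_add_right, pair_smul_left, pair_smul_right]
      push_cast
      rw [e00, e01, e10, e11] at hd ⊢
      rw [← h3, ← h4, ← h5, c2, c3, ← c1]
      linear_combination hn + hn' + (1 / 2 * (B 0 0 : ℝ) * B 0 1) * h1
        + (1 / 2 * (B 1 0 : ℝ) * B 1 1) * h2 + (1 / 2 * pair N.gram γ.x γ.y) * hd
  inv_mem' := by
    rintro γ ⟨⟨A, hA, hγ⟩, x, y, n, hx, hy, hn⟩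
    have hd := JacobiGroup.det_eq γ.A
    obtain ⟨X, hX⟩ := N.even x
    obtain ⟨Y, hY⟩ := N.even y
    have h1 := pair_intCast N x x
    have h2 := pair_intCast N y y
    have h3 := pair_intCast N x y
    rw [← hx] at h1 h3
    rw [← hy] at h2 h3
    rw [hX] at h1
    rw [hY] at h2
    push_cast at h1 h2
    have e00 : γ.A 0 0 = (A 0 0 : ℤ) := by simp [hγ]
    have e01 : γ.A 0 1 = (A 0 1 : ℤ) := by simp [hγ]
    have e10 : γ.A 1 0 = (A 1 0 : ℤ) := by simp [hγ]
    have e11 : γ.A 1 1 = (A 1 1 : ℤ) := by simp [hγ]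
    have hX' : γ⁻¹.x = (-γ.A 1 1) • γ.x + γ.A 1 0 • γ.y := by
      ext i; simp; ring
    have hY' : γ⁻¹.y = γ.A 0 1 • γ.x + (-γ.A 0 0) • γ.y := by
      ext i; simp; ring
    refine ⟨⟨A⁻¹, inv_mem hA, by simp [hγ]⟩,
      (-A 1 1) • x + A 1 0 • y, A 0 1 • x + (-A 0 0) • y,
      -n + pair N.gram x y + A 0 1 * A 1 0 * pair N.gram x y - A 0 1 * A 1 1 * X
        - A 0 0 * A 1 0 * Y, ?_, ?_, ?_⟩
    · rw [hX']; ext i; simp [e11, e10, hx, hy]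
    · rw [hY']; ext i; simp [e01, e00, hx, hy]
    · have c1 := pair_comm N γ.x γ.y
      rw [hX', hY', JacobiGroup.inv_κ]
      simp only [pair_add_left, pair_add_right, pair_smul_left, pair_smul_right]
      push_cast
      rw [e00, e01, e10, e11] at hd ⊢
      rw [← h3, ← c1]
      linear_combination -hn - (1 / 2 * (A 0 1 : ℝ) * A 1 1) * h1
        - (1 / 2 * (A 0 0 : ℝ) * A 1 0) * h2 + (1 / 2 * pair N.gram γ.x γ.y) * hd

/-! ### Jacobi forms -/

/-- The domain `N_ℂ × ℍ` of the variables `(𝔷, τ)`. -/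
def jacobiDomain (l : ℕ) : Set ((Fin l → ℂ) × ℂ) := {q | 0 < q.2.im}

/-- The Jacobi slash operator of weight `k` and index `m`. -/
def jacobiSlash {l : ℕ} {N : EvenLattice l} (k m : ℤ) (γ : JacobiGroup N)
    (Φ : (Fin l → ℂ) × ℂ → ℂ) : (Fin l → ℂ) × ℂ → ℂ :=
  fun q =>
    let a : ℂ := γ.A 0 0
    let b : ℂ := γ.A 0 1
    let c : ℂ := γ.A 1 0
    let d : ℂ := γ.A 1 1
    let x : Fin l → ℂ := complexify γ.x
    let y : Fin l → ℂ := complexify γ.y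
    let w : Fin l → ℂ := q.1 + q.2 • x + y
    Φ ((c * q.2 + d)⁻¹ • w, (a * q.2 + b) / (c * q.2 + d)) * (c * q.2 + d) ^ (-k) *
      qexp (m * (-(1 / 2) * (c * pair N.gram w w) / (c * q.2 + d)
        + 1 / 2 * pair N.gram x x * q.2 + pair N.gram x q.1 + 1 / 2 * pair N.gram x y + γ.κ))

/-- The non-holomorphic functions `α_i = Im 𝔷_i / Im τ` (at `some i`) and `1 / Im τ`
(at `none`). -/
def jacobiVars {l : ℕ} (q : (Fin l → ℂ) × ℂ) : Option (Fin l) → ℂ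
  | some i => (((q.1 i).im / q.2.im : ℝ) : ℂ)
  | none => ((1 / q.2.im : ℝ) : ℂ)

/-- Weakly almost-holomorphic Jacobi forms of weight `k` and index `m` for `G`. -/
structure IsAHJac {l : ℕ} {N : EvenLattice l} (G : Subgroup (JacobiGroup N)) (k m : ℤ)
    (Φ : (Fin l → ℂ) × ℂ → ℂ) : Prop where
  almostHol : ∃ Q, IsPolyExpansion (jacobiDomain l) jacobiVars Φ Q
  slash_eq : ∀ γ ∈ G, ∀ q ∈ jacobiDomain l, jacobiSlash k m γ Φ q = Φ q

/-- `φ` is the constant term of the almost-holomorphic function `Φ`, i.e. the coefficient of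
`α⁰ (1 / Im τ)⁰`. -/
def IsJacCt {l : ℕ} (Φ φ : (Fin l → ℂ) × ℂ → ℂ) : Prop :=
  ∃ Q, IsPolyExpansion (jacobiDomain l) jacobiVars Φ Q ∧
    ∀ q ∈ jacobiDomain l, φ q = (Q q).coeff 0

/-- Weakly quasi-Jacobi forms of weight `k` and index `m` for `G`. -/
def IsQJac {l : ℕ} {N : EvenLattice l} (G : Subgroup (JacobiGroup N)) (k m : ℤ)
    (φ : (Fin l → ℂ) × ℂ → ℂ) : Prop :=
  ∃ Φ, IsAHJac G k m Φ ∧ IsJacCt Φ φ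

/-- `L^Jac = -2 i y (y ∂/∂τ̄ + ∑ Im(𝔷_i) ∂/∂𝔷̄_i)` with `y = Im τ`. -/
def lowerJac {l : ℕ} (Φ : (Fin l → ℂ) × ℂ → ℂ) : (Fin l → ℂ) × ℂ → ℂ :=
  fun q => -2 * Complex.I * (q.2.im : ℂ) *
    ((q.2.im : ℂ) * dbar Φ q (0, 1) + ∑ i, ((q.1 i).im : ℂ) * dbar Φ q (Pi.single i 1, 0))

/-- `ξ_μ = -2 i y ∑ μ_i ∂/∂𝔷̄_i` with `y = Im τ`. -/
def xiJac {l : ℕ} (μ : Fin l → ℝ) (Φ : (Fin l → ℂ) × ℂ → ℂ) : (Fin l → ℂ) × ℂ → ℂ :=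
  fun q => -2 * Complex.I * (q.2.im : ℂ) * ∑ i, (μ i : ℂ) * dbar Φ q (Pi.single i 1, 0)

/-- For a weakly quasi-Jacobi form `φ` and an operator `T` on almost-holomorphic functions,
`ψ = (ct ∘ T ∘ ct⁻¹)(φ)`: the form `φ` has a completion, and `ψ` is the constant term of `T Φ`
for every completion `Φ` of `φ`. -/
def IsQJacImage {l : ℕ} {N : EvenLattice l} (G : Subgroup (JacobiGroup N)) (k m : ℤ)
    (T : ((Fin l → ℂ) × ℂ → ℂ) → (Fin l → ℂ) × ℂ → ℂ) (φ ψ : (Fin l → ℂ) × ℂ → ℂ) : Prop :=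
  IsQJac G k m φ ∧ ∀ Φ, IsAHJac G k m Φ → IsJacCt Φ φ → IsJacCt (T Φ) ψ

end

end OrthogonalFJ

open OrthogonalFJ

/-!
Almost-holomorphic orthogonal modular forms have Fourier–Jacobi coefficients whose limits
`F_m^lim` are almost-holomorphic Jacobi forms, and the lowering operators correspond. The argument
rests on the following ideas.

*Completions are polynomials.* The functions `ν_b` satisfy `𝖫 ν_b ∝ g_{ab}`, so that on polynomials
in `ν` with holomorphic coefficients `𝖫` is, up to the nondegenerate Gram matrix, the gradient in
`ν`. Conversely, a smooth function killed by a power of the `∂̄`-type operator `𝖫` is such a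
polynomial: by descending induction, `𝖫` of it corresponds to a closed polynomial one-form in `ν`,
which has a polynomial primitive (`exists_isPolyExpansion`, `IsAHMod.exists_isNuExpansion`). The
expansion is unique (`nu_expansion_unique`), so constant terms and Fourier–Jacobi coefficients are
well defined; the latter exist because `exp(e₁ ∧ e)` acts by `ω ↦ ω + 1`.

*Jacobi group action.* An element of the Jacobi group moves the tube domain by the Jacobi action on
`(𝔷, τ)` together with a translation `ω ↦ ω + S(𝔷, τ)`, and its derivative is, up to `J`, a torus
element times a transvection, which absorbs the change of the twist `exp(α ∧ e₁)` (`act_eq`,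
`sum_autLambda`). Feeding this into the invariance of `F`, comparing Fourier coefficients in `ω` and
letting `Im ω → ∞` (where `ν` tends to `(0, 0, 1/(2i Im τ))`) yields the transformation law of
`F_m^lim(v[𝔷, τ])` (`jacobiSlash_fjLim`). The translation `S` accounts for the index-`m`
exponential, the torus for the shift `wt(v)` of the weight.

*Lowering operators.* `F_m^lim(v[𝔷, τ])` is an explicit polynomial `fjPoly` in `α = Im 𝔷 / Im τ` and
`1 / Im τ`. On such polynomials `L^Jac` and `ξ_μ` are the derivations `-∂/∂(1/Im τ)` and
`∑ μ_i ∂/∂α_i`. The first is compared with the `e₁`-component of `𝖫`, the second with the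
derivative of `exp(α ∧ e₁)` (`eval_pderiv_none_fjPoly`, `eval_alphaDer_fjPoly`).

*Vanishing for `m < 0`.* Fix `ν` and restrict a coefficient of index `m` to a complex line in a
direction of `N_ℂ`. Reduction modulo the lattice `K(ℤτ + ℤ)` by Heisenberg elements expresses its
values through those on a compact set; the change of `ν` and of the tensor costs an exponential in
the reducing integer `n`, while the exponential of index `m < 0` decays like a Gaussian in `n`. An
entire function with such a bound vanishes by Liouville's theorem
(`IsFJExpansion.eq_zero_of_neg`). The argument needs a direction in `N_ℂ`, whence the assumption
that the rank of `N` is positive.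

*Constant terms.* An almost-holomorphic Jacobi form is determined by its constant term: transporting
the invariance by unipotent elements translates the non-holomorphic variables by a Zariski-dense
set, so a form with vanishing constant term vanishes identically
(`IsPolyExpansion.eq_zero_of_coeff_zero`). Hence the operators induced on quasi-Jacobi forms do not
depend on a choice of completion, and the quasimodular statements are the constant terms of the
almost-holomorphic ones.

*The groups.* An element of the Jacobi group preserves the integral lattice exactly when it lies in
`Γ₀(r) ⋉ H(N)` (`jacobiPart_OPlus`), and finite index passes to the intersection because relative
index does not increase under intersection with a subgroup (`relIndex_jacobiPart_ne_zero`).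
-/

set_option linter.unusedSectionVars false

namespace OrthogonalFJ

/-! ### Families of polynomials with holomorphic coefficients -/

section HolPoly

variable {E E' σ σ' : Type*} [NormedAddCommGroup E] [NormedSpace ℂ E]
  [NormedAddCommGroup E'] [NormedSpace ℂ E']

/-- The map `Q` is a family of polynomials of bounded degree, parametrized by the points of `D`,
whose coefficients are holomorphic functions on `D`. These are the conditions of an
`IsPolyExpansion` which do not involve the function that is expanded. -/
structure HolPoly (D : Set E) (Q : E → MvPolynomial σ ℂ) : Prop where
  degree_le : ∃ d : ℕ, ∀ p ∈ D, (Q p).totalDegree ≤ d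
  hol : ∀ t : σ →₀ ℕ, DifferentiableOn ℂ (fun p => (Q p).coeff t) D

lemma IsPolyExpansion.holPoly {D : Set E} {X : E → σ → ℂ} {Φ : E → ℂ}
    {Q : E → MvPolynomial σ ℂ} (h : IsPolyExpansion D X Φ Q) : HolPoly D Q :=
  ⟨h.degree_le, h.hol⟩

namespace HolPoly

variable {D : Set E} {P Q : E → MvPolynomial σ ℂ}

lemma isPolyExpansion (h : HolPoly D Q) {X : E → σ → ℂ} {Φ : E → ℂ}
    (he : ∀ p ∈ D, Φ p = MvPolynomial.eval (X p) (Q p)) : IsPolyExpansion D X Φ Q :=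
  ⟨h.degree_le, h.hol, he⟩

lemma congr (h : HolPoly D Q) (he : ∀ p ∈ D, P p = Q p) : HolPoly D P where
  degree_le := by
    obtain ⟨d, hd⟩ := h.degree_le
    exact ⟨d, fun p hp => by rw [he p hp]; exact hd p hp⟩
  hol t := (h.hol t).congr fun p hp => by rw [he p hp]

lemma const (Q : MvPolynomial σ ℂ) : HolPoly D (fun _ => Q) :=
  ⟨⟨Q.totalDegree, fun _ _ => le_rfl⟩, fun _ => differentiableOn_const _⟩

lemma add (hP : HolPoly D P) (hQ : HolPoly D Q) : HolPoly D (fun p => P p + Q p) where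
  degree_le := by
    obtain ⟨d, hd⟩ := hP.degree_le
    obtain ⟨d', hd'⟩ := hQ.degree_le
    exact ⟨max d d', fun p hp => (MvPolynomial.totalDegree_add _ _).trans
      (max_le_max (hd p hp) (hd' p hp))⟩
  hol t := by
    simp only [MvPolynomial.coeff_add]
    exact (hP.hol t).add (hQ.hol t)

lemma mul (hP : HolPoly D P) (hQ : HolPoly D Q) : HolPoly D (fun p => P p * Q p) where
  degree_le := by
    obtain ⟨d, hd⟩ := hP.degree_le
    obtain ⟨d', hd'⟩ := hQ.degree_le
    exact ⟨d + d', fun p hp => (MvPolynomial.totalDegree_mul _ _).trans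
      (add_le_add (hd p hp) (hd' p hp))⟩
  hol t := by
    classical
    simp only [MvPolynomial.coeff_mul]
    exact DifferentiableOn.fun_sum fun x _ => (hP.hol x.1).mul (hQ.hol x.2)

lemma coeffC {f : E → ℂ} (hf : DifferentiableOn ℂ f D) :
    HolPoly D (fun p => (MvPolynomial.C (f p) : MvPolynomial σ ℂ)) where
  degree_le := ⟨0, fun p _ => by simp⟩
  hol t := by
    classical
    simp only [MvPolynomial.coeff_C]
    split_ifs
    · exact hf
    · exact differentiableOn_const _

lemma sum {ι : Type*} (s : Finset ι) {P : ι → E → MvPolynomial σ ℂ}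
    (h : ∀ i ∈ s, HolPoly D (P i)) : HolPoly D (fun p => ∑ i ∈ s, P i p) := by
  classical
  induction s using Finset.induction_on with
  | empty => simpa using const (D := D) (0 : MvPolynomial σ ℂ)
  | insert a s ha ih =>
    simp only [Finset.sum_insert ha]
    exact (h a (Finset.mem_insert_self _ _)).add
      (ih fun i hi => h i (Finset.mem_insert_of_mem hi))

lemma prod {ι : Type*} (s : Finset ι) {P : ι → E → MvPolynomial σ ℂ}
    (h : ∀ i ∈ s, HolPoly D (P i)) : HolPoly D (fun p => ∏ i ∈ s, P i p) := by
  classical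
  induction s using Finset.induction_on with
  | empty => simpa using const (D := D) (1 : MvPolynomial σ ℂ)
  | insert a s ha ih =>
    simp only [Finset.prod_insert ha]
    exact (h a (Finset.mem_insert_self _ _)).mul
      (ih fun i hi => h i (Finset.mem_insert_of_mem hi))

lemma pow (hP : HolPoly D P) (n : ℕ) : HolPoly D (fun p => P p ^ n) := by
  have := prod (D := D) (Finset.range n) (P := fun _ => P) (fun _ _ => hP)
  simpa using this

lemma neg (hP : HolPoly D P) : HolPoly D (fun p => - P p) :=
  ((const (D := D) (-1 : MvPolynomial σ ℂ)).mul hP).congr fun p _ => by ring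

lemma sub (hP : HolPoly D P) (hQ : HolPoly D Q) : HolPoly D (fun p => P p - Q p) :=
  (hP.add hQ.neg).congr fun p _ => by ring

/-- A polynomial of degree at most `d` is the sum of its monomials of degree at most `d`. -/
lemma _root_.OrthogonalFJ.eq_sum_of_totalDegree_le [Finite σ] (d : ℕ) (q : MvPolynomial σ ℂ)
    (hq : q.totalDegree ≤ d) :
    q = ∑ t ∈ (Finsupp.finite_of_degree_le (σ := σ) d).toFinset,
      MvPolynomial.monomial t (q.coeff t) := by
  conv_lhs => rw [q.as_sum]
  refine Finset.sum_subset (fun t ht => ?_) (fun t _ ht => ?_)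
  · simp only [Set.Finite.mem_toFinset, Set.mem_ofPred_eq]
    exact (MvPolynomial.le_totalDegree ht).trans hq
  · rw [MvPolynomial.notMem_support_iff.mp ht, map_zero]

lemma comp {D' : Set E'} {Q : E' → MvPolynomial σ ℂ} (h : HolPoly D' Q) {φ : E → E'}
    (hφ : DifferentiableOn ℂ φ D) (hm : Set.MapsTo φ D D') : HolPoly D (fun p => Q (φ p)) where
  degree_le := by
    obtain ⟨d, hd⟩ := h.degree_le
    exact ⟨d, fun p hp => hd _ (hm hp)⟩
  hol t := (h.hol t).comp hφ hm

lemma bind₁ [Finite σ] (h : HolPoly D Q) {R : σ → E → MvPolynomial σ' ℂ}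
    (hR : ∀ i, HolPoly D (R i)) :
    HolPoly D (fun p => MvPolynomial.bind₁ (fun i => R i p) (Q p)) := by
  obtain ⟨d, hd⟩ := h.degree_le
  refine HolPoly.congr (Q := fun p => ∑ t ∈ (Finsupp.finite_of_degree_le (σ := σ) d).toFinset,
      MvPolynomial.C ((Q p).coeff t) * ∏ i ∈ t.support, R i p ^ t i) ?_ fun p hp => ?_
  · exact sum _ fun t _ => (coeffC (h.hol t)).mul (prod _ fun i _ => (hR i).pow _)
  · conv_lhs => rw [eq_sum_of_totalDegree_le d (Q p) (hd p hp)]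
    simp [map_sum, MvPolynomial.bind₁_monomial]

lemma coeff_pderiv (i : σ) (q : MvPolynomial σ ℂ) (t : σ →₀ ℕ) :
    (MvPolynomial.pderiv i q).coeff t = (t i + 1) * q.coeff (t + Finsupp.single i 1) := by
  classical
  induction q using MvPolynomial.induction_on' with
  | add p q hp hq => simp [hp, hq, mul_add]
  | monomial u a =>
    rw [MvPolynomial.pderiv_monomial, MvPolynomial.coeff_monomial, MvPolynomial.coeff_monomial]
    by_cases h : u = t + Finsupp.single i 1
    · subst h; simp; ring
    · rw [if_neg h]
      split_ifs with h'
      · have : u i = 0 := by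
          by_contra hne
          apply h
          rw [← h', tsub_add_cancel_of_le]
          simpa [Nat.one_le_iff_ne_zero] using hne
        simp [this]
      · simp

lemma totalDegree_pderiv_le (i : σ) (q : MvPolynomial σ ℂ) :
    (MvPolynomial.pderiv i q).totalDegree ≤ q.totalDegree - 1 := by
  classical
  refine Finset.sup_le fun t ht => ?_
  have h : q.coeff (t + Finsupp.single i 1) ≠ 0 := by
    rw [MvPolynomial.mem_support_iff, coeff_pderiv] at ht
    exact right_ne_zero_of_mul ht
  have := MvPolynomial.le_totalDegree (MvPolynomial.mem_support_iff.mpr h)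
  rw [Finsupp.sum_add_index' (by simp) (by simp)] at this
  simp at this
  omega

lemma pderiv (h : HolPoly D Q) (i : σ) : HolPoly D (fun p => MvPolynomial.pderiv i (Q p)) where
  degree_le := by
    obtain ⟨d, hd⟩ := h.degree_le
    exact ⟨d, fun p hp => (totalDegree_pderiv_le _ _).trans ((Nat.sub_le _ _).trans (hd p hp))⟩
  hol t := by
    simp only [coeff_pderiv]
    exact (h.hol _).const_mul _

end HolPoly

end HolPoly

/-! ### The operator `∂̄` -/

section Dbar

variable {E : Type*} [NormedAddCommGroup E] [NormedSpace ℂ E] [NormedSpace ℝ E]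
  [IsScalarTower ℝ ℂ E]
variable {f g : E → ℂ} {p v : E}

lemma dbar_congr (h : f =ᶠ[nhds p] g) (v : E) : dbar f p v = dbar g p v := by
  simp [dbar, h.fderiv_eq]

lemma dbar_congr_of_eqOn {D : Set E} (hD : IsOpen D) (h : ∀ p ∈ D, f p = g p) (hp : p ∈ D)
    (v : E) : dbar f p v = dbar g p v :=
  dbar_congr (Filter.eventuallyEq_of_mem (hD.mem_nhds hp) h) v

lemma dbar_add_vec (f : E → ℂ) (p v w : E) : dbar f p (v + w) = dbar f p v + dbar f p w := by
  simp [dbar, smul_add]; ring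

lemma dbar_real_smul_vec (f : E → ℂ) (p v : E) (c : ℝ) :
    dbar f p ((c : ℂ) • v) = c * dbar f p v := by
  have h1 : ((c : ℂ) • v) = c • v := algebraMap_smul ℂ c v
  have h2 : Complex.I • c • v = c • Complex.I • v := smul_comm _ _ _
  simp only [dbar, h1, h2, map_smul, Complex.real_smul]; ring

lemma dbar_I_smul_vec (f : E → ℂ) (p v : E) :
    dbar f p (Complex.I • v) = - Complex.I * dbar f p v := by
  simp only [dbar, smul_smul, Complex.I_mul_I, neg_smul, one_smul, map_neg]
  linear_combination (1 / 2 * fderiv ℝ f p (Complex.I • v)) * Complex.I_mul_I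

lemma dbar_smul_vec (f : E → ℂ) (p v : E) (c : ℂ) :
    dbar f p (c • v) = (starRingEnd ℂ c) * dbar f p v := by
  conv_lhs => rw [← Complex.re_add_im c, add_smul, mul_comm, mul_smul, dbar_add_vec,
    dbar_I_smul_vec, dbar_real_smul_vec, dbar_real_smul_vec]
  have hc : starRingEnd ℂ c = c.re - c.im * Complex.I := by
    apply Complex.ext <;> simp
  rw [hc]; ring

/-- `∂̄ f` at `p` as an antilinear form. -/
noncomputable def dbarL (f : E → ℂ) (p : E) : E →ₛₗ[starRingEnd ℂ] ℂ where
  toFun := dbar f p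
  map_add' := dbar_add_vec f p
  map_smul' c v := dbar_smul_vec f p v c

lemma dbar_sum_vec {ι : Type*} (s : Finset ι) (f : E → ℂ) (p : E) (v : ι → E) :
    dbar f p (∑ i ∈ s, v i) = ∑ i ∈ s, dbar f p (v i) :=
  map_sum (dbarL f p) v s

lemma dbar_add (hf : DifferentiableAt ℝ f p) (hg : DifferentiableAt ℝ g p) (v : E) :
    dbar (fun q => f q + g q) p v = dbar f p v + dbar g p v := by
  simp only [dbar, fderiv_fun_add hf hg, add_apply]; ring

lemma dbar_sub (hf : DifferentiableAt ℝ f p) (hg : DifferentiableAt ℝ g p) (v : E) :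
    dbar (fun q => f q - g q) p v = dbar f p v - dbar g p v := by
  simp only [dbar, fderiv_fun_sub hf hg, sub_apply]; ring

lemma dbar_mul (hf : DifferentiableAt ℝ f p) (hg : DifferentiableAt ℝ g p) (v : E) :
    dbar (fun q => f q * g q) p v = dbar f p v * g p + f p * dbar g p v := by
  simp only [dbar, fderiv_fun_mul hf hg, add_apply,
    smul_apply, smul_eq_mul]; ring

lemma dbar_const (c : ℂ) (p v : E) : dbar (fun _ : E => c) p v = 0 := by
  simp [dbar]

lemma dbar_fun_sum {ι : Type*} (s : Finset ι) {f : ι → E → ℂ}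
    (hf : ∀ i ∈ s, DifferentiableAt ℝ (f i) p) (v : E) :
    dbar (fun q => ∑ i ∈ s, f i q) p v = ∑ i ∈ s, dbar (f i) p v := by
  simp only [dbar, fderiv_fun_sum hf, sum_apply, Finset.mul_sum,
    ← Finset.sum_add_distrib]

lemma dbar_of_holomorphic (hf : DifferentiableAt ℂ f p) (v : E) : dbar f p v = 0 := by
  have h := (hf.hasFDerivAt.restrictScalars ℝ).fderiv
  simp only [dbar, h, ContinuousLinearMap.coe_restrictScalars', map_smul, smul_eq_mul]
  linear_combination (1 / 2 * (fderiv ℂ f p v)) * Complex.I_mul_I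

/-- A real differentiable function with `∂̄ f = 0` is complex differentiable. -/
lemma holomorphic_of_dbar (hf : DifferentiableAt ℝ f p) (h : ∀ v, dbar f p v = 0) :
    DifferentiableAt ℂ f p := by
  rw [differentiableAt_iff_restrictScalars ℝ hf]
  have hI : ∀ v, fderiv ℝ f p (Complex.I • v) = Complex.I * fderiv ℝ f p v := fun v => by
    have := h v
    simp only [dbar] at this
    linear_combination (-2 * Complex.I) * this + (fderiv ℝ f p (Complex.I • v)) * Complex.I_mul_I
  refine ⟨⟨⟨(fderiv ℝ f p).toLinearMap.toAddMonoidHom.toAddHom, fun c v => ?_⟩,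
    (fderiv ℝ f p).continuous⟩, ?_⟩
  · change fderiv ℝ f p (c • v) = c * fderiv ℝ f p v
    conv_lhs => rw [← Complex.re_add_im c, add_smul, mul_comm, mul_smul, map_add, hI]
    have h1 : ∀ x : ℝ, ((x : ℂ) • v) = x • v := fun x => algebraMap_smul ℂ x v
    conv_rhs => rw [← Complex.re_add_im c]
    rw [h1, h1, map_smul, map_smul, Complex.real_smul, Complex.real_smul]
    ring
  · ext v; rfl

/-- Real smooth functions have smooth `∂̄`-derivatives. -/
lemma contDiffOn_dbar {D : Set E} (hD : IsOpen D) (hf : ContDiffOn ℝ ∞ f D) (v : E) :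
    ContDiffOn ℝ ∞ (fun q => dbar f q v) D := by
  have h := hf.fderiv_of_isOpen (m := ∞) hD (by simp)
  exact contDiffOn_const.mul ((h.clm_apply contDiffOn_const).add
    (contDiffOn_const.mul (h.clm_apply contDiffOn_const)))

/-- The derivatives `∂̄` commute, by the symmetry of second derivatives. -/
lemma dbar_dbar_comm {D : Set E} (hD : IsOpen D) (hf : ContDiffOn ℝ ∞ f D) (hp : p ∈ D)
    (v w : E) : dbar (fun q => dbar f q v) p w = dbar (fun q => dbar f q w) p v := by
  have h := hf.fderiv_of_isOpen (m := ∞) hD (by simp)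
  have hd : DifferentiableAt ℝ (fderiv ℝ f) p :=
    (h.differentiableOn (by simp)).differentiableAt (hD.mem_nhds hp)
  have hsymm : ∀ a b, fderiv ℝ (fderiv ℝ f) p a b = fderiv ℝ (fderiv ℝ f) p b a := by
    have h2 : ContDiffAt ℝ 2 f p := (hf.contDiffAt (hD.mem_nhds hp)).of_le (by norm_cast)
    exact fun a b => (h2.isSymmSndFDerivAt (by simp)).eq a b
  have key : ∀ a b : E, fderiv ℝ (fun q => dbar f q a) p b =
      1 / 2 * (fderiv ℝ (fderiv ℝ f) p b a
        + Complex.I * fderiv ℝ (fderiv ℝ f) p b (Complex.I • a)) := fun a b => by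
    have h1 : ∀ a : E, HasFDerivAt (fun q => fderiv ℝ f q a)
        ((ContinuousLinearMap.apply ℝ ℂ a).comp (fderiv ℝ (fderiv ℝ f) p)) p := fun a =>
      (ContinuousLinearMap.apply ℝ ℂ a).hasFDerivAt.comp p hd.hasFDerivAt
    have h2 := (((h1 a).add ((h1 (Complex.I • a)).const_mul Complex.I)).const_mul (1 / 2)).fderiv
    -- `dbar` is unfolded so that the derivative rules for products and sums apply
    change fderiv ℝ (fun q => 1 / 2 * (fderiv ℝ f q a + Complex.I * fderiv ℝ f q (Complex.I • a)))
      p b = _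
    erw [h2]
    simp [mul_add]
  rw [dbar, dbar, key, key, key, key, hsymm w v, hsymm w, hsymm _ v, hsymm (Complex.I • w)]
  ring

end Dbar

/-! ### Uniqueness of polynomial expansions -/

section PolyExpansion

variable {E σ : Type*} [NormedAddCommGroup E] [NormedSpace ℂ E] [NormedSpace ℝ E]
  [IsScalarTower ℝ ℂ E] {D : Set E} {X : E → σ → ℂ} {Q : E → MvPolynomial σ ℂ}

lemma differentiableAt_eval_const {p : E}
    (hX : ∀ j, DifferentiableAt ℝ (fun q => X q j) p) (P : MvPolynomial σ ℂ) :
    DifferentiableAt ℝ (fun q => MvPolynomial.eval (X q) P) p := by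
  induction P using MvPolynomial.induction_on with
  | C a => simp
  | add P Q hP hQ => simpa using hP.fun_add hQ
  | mul_X P i hP => simpa using hP.fun_mul (hX i)

lemma dbar_eval_const [Fintype σ] {p : E} (hX : ∀ j, DifferentiableAt ℝ (fun q => X q j) p)
    (P : MvPolynomial σ ℂ) (v : E) :
    dbar (fun q => MvPolynomial.eval (X q) P) p v =
      ∑ j, MvPolynomial.eval (X p) (MvPolynomial.pderiv j P) * dbar (fun q => X q j) p v := by
  classical
  induction P using MvPolynomial.induction_on with
  | C a => simp [dbar_const]
  | add P Q hP hQ =>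
    simp only [map_add, add_mul, Finset.sum_add_distrib]
    rw [dbar_add (differentiableAt_eval_const hX P) (differentiableAt_eval_const hX Q), hP, hQ]
  | mul_X P i hP =>
    simp only [map_mul, MvPolynomial.eval_X, Derivation.leibniz, map_add, smul_eq_mul, add_mul,
      Finset.sum_add_distrib, MvPolynomial.pderiv_X]
    rw [dbar_mul (differentiableAt_eval_const hX P) (hX i), hP, add_comm, Finset.sum_mul]
    congr 1
    · rw [Finset.sum_eq_single i]
      · simp
      · intro j _ hj; simp [hj]
      · simp
    · exact Finset.sum_congr rfl fun j _ => by ring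

namespace HolPoly

/-- A finite set of monomials suffices for all members of a family of bounded degree. -/
lemma exists_eq_sum [Finite σ] (hQ : HolPoly D Q) : ∃ T : Finset (σ →₀ ℕ), ∀ p ∈ D,
    Q p = ∑ t ∈ T, MvPolynomial.C ((Q p).coeff t) * MvPolynomial.monomial t 1 := by
  obtain ⟨d, hd⟩ := hQ.degree_le
  refine ⟨(Finsupp.finite_of_degree_le (σ := σ) d).toFinset, fun p hp => ?_⟩
  conv_lhs => rw [eq_sum_of_totalDegree_le d (Q p) (hd p hp)]
  simp [MvPolynomial.C_mul_monomial]

variable [Fintype σ]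

lemma differentiableAt_eval (hD : IsOpen D) (hQ : HolPoly D Q) {p : E} (hp : p ∈ D)
    (hX : ∀ j, DifferentiableAt ℝ (fun q => X q j) p) :
    DifferentiableAt ℝ (fun q => MvPolynomial.eval (X q) (Q q)) p := by
  obtain ⟨T, hT⟩ := hQ.exists_eq_sum
  have h : DifferentiableAt ℝ (fun q => ∑ t ∈ T, (Q q).coeff t *
      MvPolynomial.eval (X q) (MvPolynomial.monomial t 1)) p :=
    DifferentiableAt.fun_sum fun t _ =>
      (((hQ.hol t).differentiableAt (hD.mem_nhds hp)).restrictScalars ℝ).fun_mul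
        (differentiableAt_eval_const hX _)
  refine h.congr_of_eventuallyEq (Filter.eventuallyEq_of_mem (hD.mem_nhds hp) fun q hq => ?_)
  conv_lhs => rw [hT q hq]
  simp only [map_sum, map_mul, MvPolynomial.eval_C]

/-- The chain rule for `∂̄`: holomorphic coefficients do not contribute. -/
lemma dbar_eval (hD : IsOpen D) (hQ : HolPoly D Q) {p : E} (hp : p ∈ D)
    (hX : ∀ j, DifferentiableAt ℝ (fun q => X q j) p) (v : E) :
    dbar (fun q => MvPolynomial.eval (X q) (Q q)) p v =
      ∑ j, MvPolynomial.eval (X p) (MvPolynomial.pderiv j (Q p)) * dbar (fun q => X q j) p v := by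
  obtain ⟨T, hT⟩ := hQ.exists_eq_sum
  have hc : ∀ t, DifferentiableAt ℂ (fun q => (Q q).coeff t) p := fun t =>
    (hQ.hol t).differentiableAt (hD.mem_nhds hp)
  have h := dbar_congr_of_eqOn (f := fun q => MvPolynomial.eval (X q) (Q q))
    (g := fun q => ∑ t ∈ T, (Q q).coeff t * MvPolynomial.eval (X q) (MvPolynomial.monomial t 1))
    hD (fun q hq => by
      conv_lhs => rw [hT q hq]
      simp only [map_sum, map_mul, MvPolynomial.eval_C]) hp v
  rw [h, dbar_fun_sum _ fun t _ => ((hc t).restrictScalars ℝ).fun_mul (differentiableAt_eval_const hX _)]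
  conv_rhs => rw [hT p hp]
  simp only [map_sum, Finset.sum_mul]
  rw [Finset.sum_comm]
  refine Finset.sum_congr rfl fun t _ => ?_
  rw [dbar_mul ((hc t).restrictScalars ℝ) (differentiableAt_eval_const hX _),
    dbar_of_holomorphic (hc t), dbar_eval_const hX, zero_mul, zero_add, Finset.mul_sum]
  refine Finset.sum_congr rfl fun j _ => ?_
  rw [MvPolynomial.pderiv_C_mul, map_mul, MvPolynomial.eval_C, mul_assoc]

lemma eq_C_of_pderiv_eq_zero {q : MvPolynomial σ ℂ} (h : ∀ i, MvPolynomial.pderiv i q = 0) :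
    q = MvPolynomial.C (q.coeff 0) := by
  classical
  ext t
  rw [MvPolynomial.coeff_C]
  split_ifs with ht
  · rw [ht]
  · obtain ⟨i, hi⟩ : ∃ i, t i ≠ 0 := by
      by_contra! hcon
      exact ht (Finsupp.ext fun i => (hcon i).symm)
    have h1 : (MvPolynomial.pderiv i q).coeff (t - Finsupp.single i 1) = 0 := by simp [h i]
    rw [coeff_pderiv, tsub_add_cancel_of_le (by simpa [Nat.one_le_iff_ne_zero] using hi)] at h1
    exact (mul_eq_zero.mp h1).resolve_left (by norm_cast)

/-- Polynomial expansions are unique if the `∂̄`-derivatives of the variables are linearly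
independent. Applying `∂̄` to a polynomial which vanishes shows that its partial derivatives
vanish, by induction on the degree, and what remains is the constant coefficient. -/
theorem eq_zero_of_eval_eq_zero [DecidableEq σ] (hD : IsOpen D)
    (hX : ∀ p ∈ D, ∀ j, DifferentiableAt ℝ (fun q => X q j) p)
    (hw : ∀ p ∈ D, ∀ i, ∃ w : E, ∀ j, dbar (fun q => X q j) p w = if j = i then 1 else 0)
    (hQ : HolPoly D Q) (h0 : ∀ p ∈ D, MvPolynomial.eval (X p) (Q p) = 0) :
    ∀ p ∈ D, Q p = 0 := by
  obtain ⟨d, hd⟩ := hQ.degree_le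
  induction d generalizing Q with
  | zero =>
    intro p hp
    have h1 := MvPolynomial.totalDegree_eq_zero_iff_eq_C.mp (Nat.le_zero.mp (hd p hp))
    have h2 := h0 p hp
    rw [h1, MvPolynomial.eval_C] at h2
    rw [h1, h2, map_zero]
  | succ d ih =>
    have hpd : ∀ i, ∀ p ∈ D, MvPolynomial.pderiv i (Q p) = 0 := fun i => by
      refine ih (hQ.pderiv i) (fun p hp => ?_) fun p hp =>
        (totalDegree_pderiv_le _ _).trans (by have := hd p hp; omega)
      obtain ⟨w, hw⟩ := hw p hp i
      have h1 := hQ.dbar_eval hD hp (hX p hp) w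
      rw [dbar_congr_of_eqOn hD h0 hp, dbar_const] at h1
      simpa [hw, Pi.single_apply] using h1.symm
    intro p hp
    have h1 := eq_C_of_pderiv_eq_zero fun i => hpd i p hp
    have h2 := h0 p hp
    rw [h1, MvPolynomial.eval_C] at h2
    rw [h1, h2, map_zero]

theorem eq_of_eval_eq [DecidableEq σ] (hD : IsOpen D)
    (hX : ∀ p ∈ D, ∀ j, DifferentiableAt ℝ (fun q => X q j) p)
    (hw : ∀ p ∈ D, ∀ i, ∃ w : E, ∀ j, dbar (fun q => X q j) p w = if j = i then 1 else 0)
    {P : E → MvPolynomial σ ℂ} (hP : HolPoly D P) (hQ : HolPoly D Q)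
    (h : ∀ p ∈ D, MvPolynomial.eval (X p) (P p) = MvPolynomial.eval (X p) (Q p)) :
    ∀ p ∈ D, P p = Q p := fun p hp =>
  sub_eq_zero.mp <| eq_zero_of_eval_eq_zero hD hX hw (hP.sub hQ)
    (fun p hp => by rw [map_sub, h p hp, sub_self]) p hp

end HolPoly

/-! ### Integration of polynomial expansions -/

variable [Fintype σ]

/-- Euler's identity, coefficient by coefficient. -/
lemma coeff_sum_X_mul_pderiv (q : MvPolynomial σ ℂ) (t : σ →₀ ℕ) :
    (∑ b, MvPolynomial.X b * MvPolynomial.pderiv b q).coeff t = t.degree * q.coeff t := by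
  classical
  induction q using MvPolynomial.induction_on' with
  | add p q hp hq =>
    simp only [map_add, mul_add, Finset.sum_add_distrib, MvPolynomial.coeff_add, hp, hq]
  | monomial u a =>
    rw [(MvPolynomial.isHomogeneous_monomial (n := u.degree) a rfl).sum_X_mul_pderiv]
    rw [MvPolynomial.coeff_smul, MvPolynomial.coeff_monomial]
    split_ifs with h
    · simp [h]
    · simp

/-- The primitive of the closed form `∑ Q_b dX_b` obtained
by dividing the homogeneous components of `∑ X_b Q_b` by their degree. The constant term is
divided by zero, hence is zero. -/
noncomputable def polyPrimitive (Q : σ → MvPolynomial σ ℂ) : MvPolynomial σ ℂ :=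
  ∑ t ∈ (∑ b, MvPolynomial.X b * Q b).support,
    MvPolynomial.monomial t ((∑ b, MvPolynomial.X b * Q b).coeff t / t.degree)

lemma coeff_polyPrimitive (Q : σ → MvPolynomial σ ℂ) (t : σ →₀ ℕ) :
    (polyPrimitive Q).coeff t = (∑ b, MvPolynomial.X b * Q b).coeff t / t.degree := by
  classical
  rw [polyPrimitive, MvPolynomial.coeff_sum]
  simp only [MvPolynomial.coeff_monomial]
  rw [Finset.sum_ite_eq']
  split_ifs with h
  · rfl
  · rw [MvPolynomial.notMem_support_iff.mp h, zero_div]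

/-- The Poincaré lemma for polynomials. -/
lemma pderiv_polyPrimitive (Q : σ → MvPolynomial σ ℂ)
    (h : ∀ b c, MvPolynomial.pderiv c (Q b) = MvPolynomial.pderiv b (Q c)) (c : σ) :
    MvPolynomial.pderiv c (polyPrimitive Q) = Q c := by
  classical
  have hT : MvPolynomial.pderiv c (∑ b, MvPolynomial.X b * Q b) =
      Q c + ∑ b, MvPolynomial.X b * MvPolynomial.pderiv b (Q c) := by
    simp only [map_sum, Derivation.leibniz, smul_eq_mul, Finset.sum_add_distrib,
      MvPolynomial.pderiv_X, h _ c]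
    rw [add_comm]
    congr 1
    rw [Finset.sum_eq_single c]
    · simp
    · intro b _ hb; simp [hb]
    · simp
  ext t
  have h1 := congrArg (MvPolynomial.coeff t) hT
  rw [HolPoly.coeff_pderiv, MvPolynomial.coeff_add, coeff_sum_X_mul_pderiv] at h1
  rw [HolPoly.coeff_pderiv, coeff_polyPrimitive, mul_div_assoc', h1]
  simp only [map_add, Finsupp.degree_single]
  have : (t.degree : ℂ) + 1 ≠ 0 := by norm_cast
  push_cast
  field_simp
  ring

lemma HolPoly.polyPrimitive {Q : σ → E → MvPolynomial σ ℂ} (hQ : ∀ b, HolPoly D (Q b)) :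
    HolPoly D (fun p => polyPrimitive (fun b => Q b p)) := by
  have h := HolPoly.sum (D := D) Finset.univ
    (fun b _ => (HolPoly.const (D := D) (MvPolynomial.X b)).mul (hQ b))
  refine ⟨?_, fun t => ?_⟩
  · obtain ⟨d, hd⟩ := h.degree_le
    refine ⟨d, fun p hp => (Finset.sup_le fun t ht => ?_)⟩
    rw [MvPolynomial.mem_support_iff, coeff_polyPrimitive] at ht
    refine (MvPolynomial.le_totalDegree (MvPolynomial.mem_support_iff.mpr ?_)).trans (hd p hp)
    intro h0
    exact ht (by rw [h0, zero_div])
  · simp only [coeff_polyPrimitive]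
    simp only [div_eq_mul_inv]
    exact (h.hol t).mul_const _

/-- If the derivatives of `G` along a frame dual to the `∂̄ X_b` are polynomials in `X` with
holomorphic coefficients, then so is `G`. Since `∂̄² = 0`, the form `∑ Q_b dX_b` is closed; a
primitive of it differs from `G` by a function which is killed by `∂̄`. -/
theorem exists_isPolyExpansion [DecidableEq σ] [FiniteDimensional ℂ E]
    (hcard : Fintype.card σ = Module.finrank ℂ E) (hD : IsOpen D)
    (hX : ∀ j, ContDiffOn ℝ ∞ (fun q => X q j) D) {w : E → σ → E}
    (hw : ∀ p ∈ D, ∀ i j, dbar (fun q => X q j) p (w p i) = if j = i then 1 else 0)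
    {G : E → ℂ} (hG : ContDiffOn ℝ ∞ G D) {Q : σ → E → MvPolynomial σ ℂ}
    (hQ : ∀ b, HolPoly D (Q b))
    (hGQ : ∀ p ∈ D, ∀ b, dbar G p (w p b) = MvPolynomial.eval (X p) (Q b p)) :
    ∃ P, IsPolyExpansion D X G P := by
  have hXd : ∀ p ∈ D, ∀ j, DifferentiableAt ℝ (fun q => X q j) p := fun p hp j =>
    ((hX j).differentiableOn (by simp)).differentiableAt (hD.mem_nhds hp)
  have hGd : ∀ p ∈ D, DifferentiableAt ℝ G p := fun p hp =>
    (hG.differentiableOn (by simp)).differentiableAt (hD.mem_nhds hp)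
  have hdX : ∀ p ∈ D, ∀ j e, DifferentiableAt ℝ (fun q => dbar (fun q => X q j) q e) p :=
    fun p hp j e => ((contDiffOn_dbar hD (hX j) e).differentiableOn
      (by simp)).differentiableAt (hD.mem_nhds hp)
  -- the frame spans the tangent space
  have hspan : ∀ p ∈ D, ∀ e, e = ∑ b, starRingEnd ℂ (dbar (fun q => X q b) p e) • w p b := by
    intro p hp e
    have hli : LinearIndependent ℂ (w p) := by
      rw [Fintype.linearIndependent_iff]
      intro g hg i
      have h1 := congrArg (dbar (fun q => X q i) p) hg
      rw [dbar_sum_vec] at h1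
      simp only [dbar_smul_vec, hw p hp] at h1
      have h2 : dbar (fun q => X q i) p 0 = 0 := (dbarL (fun q => X q i) p).map_zero
      rw [h2] at h1
      simpa [Pi.single_apply] using h1
    have hs : e ∈ Submodule.span ℂ (Set.range (w p)) := by
      rw [hli.span_eq_top_of_card_eq_finrank' hcard]; trivial
    obtain ⟨c, hc⟩ := (Submodule.mem_span_range_iff_exists_fun ℂ).mp hs
    rw [← hc]
    refine Finset.sum_congr rfl fun b _ => ?_
    rw [dbar_sum_vec]
    simp [dbar_smul_vec, hw p hp]
  have hGe : ∀ p ∈ D, ∀ e, dbar G p e =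
      ∑ b, MvPolynomial.eval (X p) (Q b p) * dbar (fun q => X q b) p e := by
    intro p hp e
    conv_lhs => rw [hspan p hp e, dbar_sum_vec]
    refine Finset.sum_congr rfl fun b _ => ?_
    rw [dbar_smul_vec, hGQ p hp, Complex.conj_conj, mul_comm]
  have hQd : ∀ p ∈ D, ∀ b, DifferentiableAt ℝ (fun q => MvPolynomial.eval (X q) (Q b q)) p :=
    fun p hp b => (hQ b).differentiableAt_eval hD hp (hXd p hp)
  -- the form is closed
  have hddG : ∀ p ∈ D, ∀ e e', dbar (fun q => dbar G q e) p e' =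
      ∑ b, ((∑ c, MvPolynomial.eval (X p) (MvPolynomial.pderiv c (Q b p)) *
        dbar (fun q => X q c) p e') * dbar (fun q => X q b) p e +
        MvPolynomial.eval (X p) (Q b p) * dbar (fun q => dbar (fun q => X q b) q e) p e') := by
    intro p hp e e'
    rw [dbar_congr_of_eqOn hD (fun q hq => hGe q hq e) hp, dbar_fun_sum _ fun b _ =>
      (hQd p hp b).fun_mul (hdX p hp b e)]
    refine Finset.sum_congr rfl fun b _ => ?_
    rw [dbar_mul (hQd p hp b) (hdX p hp b e), (hQ b).dbar_eval hD hp (hXd p hp)]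
  have hsymm : ∀ b c, ∀ p ∈ D, MvPolynomial.pderiv c (Q b p) = MvPolynomial.pderiv b (Q c p) := by
    intro b c
    refine HolPoly.eq_of_eval_eq hD hXd (fun p hp i => ⟨w p i, hw p hp i⟩) ((hQ b).pderiv c)
      ((hQ c).pderiv b) fun p hp => ?_
    have h1 := dbar_dbar_comm hD hG hp (w p b) (w p c)
    rw [hddG p hp, hddG p hp, Finset.sum_add_distrib, Finset.sum_add_distrib] at h1
    have h2 : ∀ a, dbar (fun q => dbar (fun q => X q a) q (w p b)) p (w p c) =
        dbar (fun q => dbar (fun q => X q a) q (w p c)) p (w p b) := fun a =>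
      dbar_dbar_comm hD (hX a) hp _ _
    simp only [h2] at h1
    have h3 := add_right_cancel h1
    simpa [hw p hp, Pi.single_apply] using h3
  -- subtracting the primitive leaves a holomorphic function
  have hP := HolPoly.polyPrimitive hQ
  set H : E → ℂ := fun p => G p - MvPolynomial.eval (X p) (polyPrimitive fun b => Q b p) with hH
  have hHd : DifferentiableOn ℂ H D := by
    intro p hp
    refine (holomorphic_of_dbar ((hGd p hp).fun_sub (hP.differentiableAt_eval hD hp (hXd p hp)))
      fun v => ?_).differentiableWithinAt
    rw [dbar_sub (hGd p hp) (hP.differentiableAt_eval hD hp (hXd p hp)),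
      hP.dbar_eval hD hp (hXd p hp), hGe p hp, sub_eq_zero]
    refine Finset.sum_congr rfl fun b _ => ?_
    rw [pderiv_polyPrimitive _ (fun b c => hsymm b c p hp)]
  refine ⟨fun p => MvPolynomial.C (H p) + polyPrimitive fun b => Q b p,
    ((HolPoly.coeffC hHd).add hP).isPolyExpansion fun p _ => ?_⟩
  rw [map_add, MvPolynomial.eval_C, hH]
  ring

end PolyExpansion

/-! ### The tube domain and the variables `ν` -/

section Tube

variable {l : ℕ} (N : EvenLattice l) (r : ℕ)

lemma sum_LIdx {K : Type*} [AddCommMonoid K] (f : LIdx l → K) :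
    ∑ a, f a = f iE1 + (∑ i, f (iN i) + f iF1) := by
  simp [Fintype.sum_sum_type]

lemma pair_gramL {K : Type*} [CommRing K] (u v : LIdx l → K) :
    pair (gramL N) u v = u iE1 * v iF1 + u iF1 * v iE1
      - pair N.gram (fun i => u (iN i)) (fun i => v (iN i)) := by
  simp only [pair, dotProduct, Matrix.mulVec, sum_LIdx, Matrix.map_apply, gramL, Matrix.of_apply,
    lvec, Sum.elim_inl, Sum.elim_inr, Pi.zero_apply]
  simp
  ring

lemma pair_gramL_comm {K : Type*} [CommRing K] (u v : LIdx l → K) :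
    pair (gramL N) u v = pair (gramL N) v u := by
  rw [pair_gramL, pair_gramL, pair_comm N]; ring

lemma gramL_symm (a b : LIdx l) : gramL N a b = gramL N b a := by
  have h : ∀ i j, N.gram i j = N.gram j i := fun i j => N.symm.apply j i
  rcases a with _ | i | _ <;> rcases b with _ | j | _ <;> simp [gramL, lvec, h]

/-- The Gram matrix of `L(r)` with real entries. -/
noncomputable def gramLr : Matrix (LIdx l) (LIdx l) ℝ :=
  Matrix.of fun a b => (r : ℝ) * gramL N a b

lemma gramLr_symm (a b : LIdx l) : gramLr N r a b = gramLr N r b a := by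
  simp [gramLr, gramL_symm N a b]

lemma gramLr_mulVec (u : LIdx l → ℝ) (a : LIdx l) :
    (gramLr N r).mulVec u a = ∑ c, gramLr N r a c * u c := rfl

lemma pair_nonneg (x : Fin l → ℝ) : 0 ≤ pair N.gram x x := by
  have h := N.posDef.posSemidef.dotProduct_mulVec_nonneg x
  simpa [pair] using h

lemma pair_pos {x : Fin l → ℝ} (hx : x ≠ 0) : 0 < pair N.gram x x := by
  have h := N.posDef.dotProduct_mulVec_pos hx
  simpa [pair] using h

lemma sum_mul_gramLr (u v : LIdx l → ℝ) :
    ∑ a, u a * (gramLr N r).mulVec v a = r * pair (gramL N) u v := by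
  simp only [pair, dotProduct, Matrix.mulVec, gramLr, Matrix.of_apply, Matrix.map_apply,
    Finset.mul_sum]
  refine Finset.sum_congr rfl fun a _ => Finset.sum_congr rfl fun b _ => by ring

/-- The form on `L(r)` is nondegenerate. -/
lemma gramLr_isUnit [NeZero r] : IsUnit (gramLr N r) := by
  rw [← Matrix.mulVec_injective_iff_isUnit]
  have hr : (r : ℝ) ≠ 0 := Nat.cast_ne_zero.mpr (NeZero.ne r)
  refine (injective_iff_map_eq_zero (Matrix.mulVecLin (gramLr N r))).mpr fun u hu => ?_
  have h : ∀ v, pair (gramL N) v u = 0 := fun v => by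
    have h1 := sum_mul_gramLr N r v u
    rw [Matrix.mulVecLin_apply] at hu
    rw [hu] at h1
    simpa [hr] using h1.symm
  have hE : u iE1 = 0 := by
    have h1 := h vF1
    rw [pair_gramL] at h1
    simpa [vF1, lvec, pair] using h1
  have hF : u iF1 = 0 := by
    have h1 := h vE1
    rw [pair_gramL] at h1
    simpa [vE1, lvec, pair] using h1
  have hN : (fun i => u (iN i)) = 0 := by
    by_contra hne
    have h1 := h u
    rw [pair_gramL, hE, hF] at h1
    have := pair_pos N hne
    linarith
  funext a
  rcases a with _ | i | _
  · exact hE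
  · exact congrFun hN i
  · exact hF

lemma isOpen_tube : IsOpen (tube N) := by
  have h1 : ∀ a, Continuous fun z : LIdx l → ℂ => imVec z a := fun a =>
    Complex.continuous_im.comp (continuous_apply a)
  have h2 : Continuous fun z : LIdx l → ℂ => pair (gramL N) (imVec z) (imVec z) := by
    simp only [pair, dotProduct, Matrix.mulVec]
    fun_prop
  exact (isOpen_lt continuous_const (h1 iE1)).inter
    ((isOpen_lt continuous_const (h1 iF1)).inter (isOpen_lt continuous_const h2))

variable {N}

lemma imSq_pos [NeZero r] {z : LIdx l → ℂ} (hz : z ∈ tube N) : 0 < imSq N r z :=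
  mul_pos (Nat.cast_pos.mpr (Nat.pos_of_ne_zero (NeZero.ne r))) hz.2.2

lemma imSq_ne_zero [NeZero r] {z : LIdx l → ℂ} (hz : z ∈ tube N) : (imSq N r z : ℂ) ≠ 0 :=
  Complex.ofReal_ne_zero.mpr (imSq_pos r hz).ne'

variable (N)

lemma contDiff_imVec (a : LIdx l) : ContDiff ℝ ∞ (fun z : LIdx l → ℂ => (imVec z a : ℂ)) := by
  have h : ContDiff ℝ ∞ (fun z : LIdx l → ℂ => (Complex.imCLM (z a))) :=
    Complex.imCLM.contDiff.comp (contDiff_apply ℝ ℂ a)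
  exact Complex.ofRealCLM.contDiff.comp h

lemma differentiableAt_imVec (z : LIdx l → ℂ) (a : LIdx l) :
    DifferentiableAt ℝ (fun z : LIdx l → ℂ => (imVec z a : ℂ)) z :=
  (contDiff_imVec a).differentiable (by simp) z

/-- The derivative `∂̄` of the imaginary part of a complex linear form. -/
lemma dbar_ofReal_im {E : Type*} [NormedAddCommGroup E] [NormedSpace ℂ E] [NormedSpace ℝ E]
    (f : E →L[ℝ] ℂ) (hf : ∀ v, f (Complex.I • v) = Complex.I * f v) (p v : E) :
    dbar (fun q => ((f q).im : ℂ)) p v = Complex.I / 2 * starRingEnd ℂ (f v) := by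
  have h : HasFDerivAt (fun q => ((f q).im : ℂ))
      ((Complex.ofRealCLM.comp Complex.imCLM).comp f) p :=
    ((Complex.ofRealCLM.comp Complex.imCLM).comp f).hasFDerivAt
  rw [dbar, h.fderiv]
  simp only [ContinuousLinearMap.comp_apply, hf]
  apply Complex.ext <;> simp

lemma dbar_imVec (z v : LIdx l → ℂ) (a : LIdx l) :
    dbar (fun z : LIdx l → ℂ => (imVec z a : ℂ)) z v = Complex.I / 2 * starRingEnd ℂ (v a) :=
  dbar_ofReal_im (ContinuousLinearMap.proj a) (fun v => by simp) z v

/-- The tangent vector along which `∂̄` gives the component `a` of the lowering operator. -/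
noncomputable def lowVec (z : LIdx l → ℂ) (a : LIdx l) : LIdx l → ℂ := fun b =>
  ((imSq N r z * (Pi.single a 1 : LIdx l → ℝ) b
    - 2 * (gramLr N r).mulVec (imVec z) a * imVec z b : ℝ) : ℂ)

lemma lowering_eq_dbar {s : ℕ} (F : (LIdx l → ℂ) → Tensor l s) (z : LIdx l → ℂ)
    (J : Fin (s + 1) → LIdx l) :
    lowering N r F z J =
      dbar (fun w => F w (fun i => J i.castSucc)) z (lowVec N r z (J (Fin.last s))) := by
  have h : lowVec N r z (J (Fin.last s)) =
      ((imSq N r z : ℝ) : ℂ) • (Pi.single (J (Fin.last s)) 1 : LIdx l → ℂ)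
      + ∑ b, ((-(2 * (gramLr N r).mulVec (imVec z) (J (Fin.last s)) * imVec z b) : ℝ) : ℂ) •
        (Pi.single b 1 : LIdx l → ℂ) := by
    funext c
    simp only [lowVec, Pi.add_apply, Finset.sum_apply, Pi.smul_apply, Pi.single_apply, smul_eq_mul,
      mul_ite, mul_one, mul_zero, Finset.sum_ite_eq, Finset.mem_univ, if_true]
    split_ifs <;> push_cast <;> ring
  rw [h, dbar_add_vec, dbar_sum_vec, dbar_real_smul_vec]
  simp only [dbar_real_smul_vec, lowering]
  rw [sub_eq_add_neg]
  congr 1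
  have hg : ∑ c, ((r : ℂ) * (gramL N (J (Fin.last s)) c : ℂ)) * (imVec z c : ℂ) =
      (((gramLr N r).mulVec (imVec z) (J (Fin.last s)) : ℝ) : ℂ) := by
    rw [gramLr_mulVec, Complex.ofReal_sum]
    simp [gramLr]
  rw [hg, mul_assoc, Finset.sum_mul, Finset.mul_sum, ← Finset.sum_neg_distrib]
  refine Finset.sum_congr rfl fun b _ => ?_
  push_cast
  ring

lemma nu_eq (z : LIdx l → ℂ) (b : LIdx l) :
    nu N r z b = (((gramLr N r).mulVec (imVec z) b : ℝ) : ℂ) / (Complex.I * imSq N r z) := by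
  simp only [nu, Matrix.mulVec, dotProduct, gramLr, Matrix.of_apply]
  push_cast
  congr 1
  refine Finset.sum_congr rfl fun a _ => ?_
  rw [gramL_symm]; ring

lemma imSq_eq (z : LIdx l → ℂ) :
    imSq N r z = ∑ a, imVec z a * (gramLr N r).mulVec (imVec z) a := by
  rw [sum_mul_gramLr, imSq]

lemma contDiff_gram_imVec (b : LIdx l) : ContDiff ℝ ∞
    (fun z : LIdx l → ℂ => (((gramLr N r).mulVec (imVec z) b : ℝ) : ℂ)) := by
  simp only [gramLr_mulVec]
  push_cast
  exact ContDiff.sum fun c _ => contDiff_const.mul (contDiff_imVec c)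

lemma contDiff_imSq : ContDiff ℝ ∞ (fun z : LIdx l → ℂ => (imSq N r z : ℂ)) := by
  simp only [imSq_eq]
  push_cast
  exact ContDiff.sum fun c _ => (contDiff_imVec c).mul (contDiff_gram_imVec N r c)

lemma contDiffOn_nu [NeZero r] (b : LIdx l) :
    ContDiffOn ℝ ∞ (fun z => nu N r z b) (tube N) := by
  simp only [nu_eq]
  simp only [div_eq_mul_inv]
  refine (contDiff_gram_imVec N r b).contDiffOn.mul
    ((contDiff_const.mul (contDiff_imSq N r)).contDiffOn.inv ?_)
  exact fun z hz => mul_ne_zero Complex.I_ne_zero (imSq_ne_zero r hz)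

lemma differentiableAt_nu [NeZero r] {z : LIdx l → ℂ} (hz : z ∈ tube N) (b : LIdx l) :
    DifferentiableAt ℝ (fun z => nu N r z b) z :=
  ((contDiffOn_nu N r b).differentiableOn (by simp)).differentiableAt
    ((isOpen_tube N).mem_nhds hz)

/-- The derivative of the linear form `∑ g_bc Im(z_c)`. -/
lemma dbar_gram_imVec (z v : LIdx l → ℂ) (b : LIdx l) :
    dbar (fun z : LIdx l → ℂ => (((gramLr N r).mulVec (imVec z) b : ℝ) : ℂ)) z v =
      Complex.I / 2 * ∑ c, (gramLr N r b c : ℂ) * starRingEnd ℂ (v c) := by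
  simp only [gramLr_mulVec]
  push_cast
  rw [dbar_fun_sum _ fun c _ => (differentiableAt_imVec z c).const_mul _, Finset.mul_sum]
  refine Finset.sum_congr rfl fun c _ => ?_
  rw [dbar_mul (differentiableAt_const _) (differentiableAt_imVec z c), dbar_const, dbar_imVec]
  ring

lemma dbar_imSq (z v : LIdx l → ℂ) :
    dbar (fun z : LIdx l → ℂ => (imSq N r z : ℂ)) z v =
      Complex.I * ∑ c, (((gramLr N r).mulVec (imVec z) c : ℝ) : ℂ) * starRingEnd ℂ (v c) := by
  simp only [imSq_eq]
  push_cast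
  have hd : ∀ c, DifferentiableAt ℝ
      (fun z : LIdx l → ℂ => (((gramLr N r).mulVec (imVec z) c : ℝ) : ℂ)) z := fun c =>
    (contDiff_gram_imVec N r c).differentiable (by simp) z
  rw [dbar_fun_sum _ fun c _ => (differentiableAt_imVec z c).fun_mul (hd c)]
  have h1 : ∀ c, dbar (fun z : LIdx l → ℂ =>
      (imVec z c : ℂ) * (((gramLr N r).mulVec (imVec z) c : ℝ) : ℂ)) z v =
      Complex.I / 2 * ((((gramLr N r).mulVec (imVec z) c : ℝ) : ℂ) * starRingEnd ℂ (v c)) +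
      Complex.I / 2 * ∑ d, (imVec z c : ℂ) * ((gramLr N r c d : ℂ) * starRingEnd ℂ (v d)) :=
    fun c => by
      rw [dbar_mul (differentiableAt_imVec z c) (hd c), dbar_imVec, dbar_gram_imVec,
        ← Finset.mul_sum]
      ring
  rw [Finset.sum_congr rfl fun c _ => h1 c, Finset.sum_add_distrib, ← Finset.mul_sum,
    ← Finset.mul_sum, Finset.sum_comm (f := fun c d => (imVec z c : ℂ) *
      ((gramLr N r c d : ℂ) * starRingEnd ℂ (v d)))]
  have h2 : ∀ d, ∑ c, (imVec z c : ℂ) * ((gramLr N r c d : ℂ) * starRingEnd ℂ (v d)) =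
      (((gramLr N r).mulVec (imVec z) d : ℝ) : ℂ) * starRingEnd ℂ (v d) := fun d => by
    simp only [gramLr_mulVec]
    push_cast
    rw [Finset.sum_mul]
    refine Finset.sum_congr rfl fun c _ => ?_
    rw [gramLr_symm]; ring
  rw [Finset.sum_congr rfl fun d _ => h2 d]
  ring

/-- The lowering operator acts on the variables `ν_b` by constants, hence as `½ ∑ g_ab ∂/∂ν_b`
on polynomials in `ν` with holomorphic coefficients. -/
lemma dbar_nu [NeZero r] {z : LIdx l → ℂ} (hz : z ∈ tube N) (a b : LIdx l) :
    dbar (fun z => nu N r z b) z (lowVec N r z a) = (gramLr N r a b : ℂ) / 2 := by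
  have hY := imSq_ne_zero r hz
  have h1 : DifferentiableAt ℝ (fun z => nu N r z b) z := differentiableAt_nu N r hz b
  have h2 : DifferentiableAt ℝ (fun z : LIdx l → ℂ => Complex.I * (imSq N r z : ℂ)) z :=
    ((contDiff_imSq N r).differentiable (by simp) z).const_mul _
  have h3 := dbar_mul h1 h2 (lowVec N r z a)
  have h4 : dbar (fun z => nu N r z b * (Complex.I * (imSq N r z : ℂ))) z (lowVec N r z a) =
      dbar (fun z : LIdx l → ℂ => (((gramLr N r).mulVec (imVec z) b : ℝ) : ℂ)) z
        (lowVec N r z a) :=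
    dbar_congr_of_eqOn (isOpen_tube N) (fun q hq => by
      rw [nu_eq, div_mul_cancel₀ _ (mul_ne_zero Complex.I_ne_zero (imSq_ne_zero r hq))]) hz _
  have h5 : dbar (fun z : LIdx l → ℂ => Complex.I * (imSq N r z : ℂ)) z (lowVec N r z a) =
      Complex.I * dbar (fun z : LIdx l → ℂ => (imSq N r z : ℂ)) z (lowVec N r z a) := by
    rw [dbar_mul (differentiableAt_const _) ((contDiff_imSq N r).differentiable (by simp) z),
      dbar_const]; ring
  have hr : ∀ c, starRingEnd ℂ (lowVec N r z a c) = lowVec N r z a c := fun c => by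
    rw [lowVec, Complex.conj_ofReal]
  have e1 : ∑ c, gramLr N r b c * (imSq N r z * (Pi.single a 1 : LIdx l → ℝ) c
      - 2 * (gramLr N r).mulVec (imVec z) a * imVec z c) =
      imSq N r z * gramLr N r a b
        - 2 * (gramLr N r).mulVec (imVec z) a * (gramLr N r).mulVec (imVec z) b := by
    simp only [mul_sub, Finset.sum_sub_distrib]
    congr 1
    · rw [Finset.sum_eq_single a]
      · simp [gramLr_symm N r a b]; ring
      · intro c _ hc; simp [hc]
      · simp
    · rw [gramLr_mulVec N r (imVec z) b, Finset.mul_sum]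
      exact Finset.sum_congr rfl fun c _ => by ring
  have e2 : ∑ c, (gramLr N r).mulVec (imVec z) c * (imSq N r z * (Pi.single a 1 : LIdx l → ℝ) c
      - 2 * (gramLr N r).mulVec (imVec z) a * imVec z c) =
      - imSq N r z * (gramLr N r).mulVec (imVec z) a := by
    have h6 : ∑ c, (gramLr N r).mulVec (imVec z) c * (imSq N r z * (Pi.single a 1 : LIdx l → ℝ) c)
        = imSq N r z * (gramLr N r).mulVec (imVec z) a := by
      rw [Finset.sum_eq_single a]
      · simp; ring
      · intro c _ hc; simp [hc]
      · simp
    have h7 : ∑ c, (gramLr N r).mulVec (imVec z) c *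
        (2 * (gramLr N r).mulVec (imVec z) a * imVec z c) =
        2 * (gramLr N r).mulVec (imVec z) a * imSq N r z := by
      rw [imSq_eq, Finset.mul_sum]
      exact Finset.sum_congr rfl fun c _ => by ring
    simp only [mul_sub, Finset.sum_sub_distrib, h6, h7]
    ring
  have e1' := congrArg (fun x : ℝ => (x : ℂ)) e1
  have e2' := congrArg (fun x : ℝ => (x : ℂ)) e2
  simp only [Complex.ofReal_sum, Complex.ofReal_mul (gramLr N r b _),
    Complex.ofReal_mul ((gramLr N r).mulVec (imVec z) _)] at e1' e2'
  rw [h4, dbar_gram_imVec, h5, dbar_imSq] at h3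
  simp only [hr] at h3
  simp only [lowVec] at h3
  rw [e1', e2', nu_eq] at h3
  have hI := Complex.I_ne_zero
  -- the quotient rule, solved for the derivative of `ν_b`
  have h6 : ∀ A B T : ℂ, Complex.I / 2 * A =
      T * (Complex.I * (imSq N r z : ℂ)) +
        B / (Complex.I * (imSq N r z : ℂ)) * (Complex.I * (Complex.I * (-(imSq N r z : ℂ) *
          (((gramLr N r).mulVec (imVec z) a : ℝ) : ℂ)))) →
      A = imSq N r z * gramLr N r a b - 2 * (((gramLr N r).mulVec (imVec z) a : ℝ) : ℂ) * B →
      T = (gramLr N r a b : ℂ) / 2 := by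
    intro A B T h hA
    rw [hA] at h
    field_simp at h
    have hT : (imSq N r z : ℂ) * (2 * T) = imSq N r z * gramLr N r a b := by linear_combination -h
    have := mul_left_cancel₀ hY hT
    linear_combination this / 2
  refine h6 ((imSq N r z * gramLr N r a b
    - 2 * (gramLr N r).mulVec (imVec z) a * (gramLr N r).mulVec (imVec z) b : ℝ) : ℂ)
    (((gramLr N r).mulVec (imVec z) b : ℝ) : ℂ) _ ?_ ?_
  · rw [h3]; push_cast; ring
  · push_cast; ring

/-- The vectors dual to the forms `∂̄ ν_b`. -/
noncomputable def nuFrame (z : LIdx l → ℂ) (i : LIdx l) : LIdx l → ℂ :=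
  ∑ a, ((2 * (gramLr N r)⁻¹ i a : ℝ) : ℂ) • lowVec N r z a

lemma dbar_nuFrame (f : (LIdx l → ℂ) → ℂ) (z : LIdx l → ℂ) (i : LIdx l) :
    dbar f z (nuFrame N r z i) =
      ∑ a, ((2 * (gramLr N r)⁻¹ i a : ℝ) : ℂ) * dbar f z (lowVec N r z a) := by
  simp only [nuFrame, dbar_sum_vec, dbar_real_smul_vec]

lemma dbar_nu_nuFrame [NeZero r] {z : LIdx l → ℂ} (hz : z ∈ tube N) (i j : LIdx l) :
    dbar (fun z => nu N r z j) z (nuFrame N r z i) = if j = i then 1 else 0 := by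
  rw [dbar_nuFrame]
  simp only [dbar_nu N r hz]
  have h := congrFun (congrFun (Matrix.nonsing_inv_mul (gramLr N r)
    ((Matrix.isUnit_iff_isUnit_det _).mp (gramLr_isUnit N r))) i) j
  rw [Matrix.mul_apply, Matrix.one_apply] at h
  have h' := congrArg (fun x : ℝ => (x : ℂ)) h
  simp only [eq_comm (a := j)]
  simp only [Complex.ofReal_sum] at h'
  convert! h' using 1
  · exact Finset.sum_congr rfl fun a _ => by push_cast; ring
  · split_ifs <;> simp

/-- Expansions in `ν` are unique. -/
lemma nu_expansion_unique [NeZero r] {P Q : (LIdx l → ℂ) → MvPolynomial (LIdx l) ℂ}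
    (hP : HolPoly (tube N) P) (hQ : HolPoly (tube N) Q)
    (h : ∀ z ∈ tube N, MvPolynomial.eval (nu N r z) (P z) = MvPolynomial.eval (nu N r z) (Q z)) :
    ∀ z ∈ tube N, P z = Q z :=
  HolPoly.eq_of_eval_eq (isOpen_tube N) (fun _ hz b => differentiableAt_nu N r hz b)
    (fun z hz i => ⟨nuFrame N r z i, dbar_nu_nuFrame N r hz i⟩) hP hQ h

/-- The lowering operator on polynomials in `ν`: its component at `a` is `½ ∑_b g_ab ∂/∂ν_b`. -/
noncomputable def lowerPoly {s : ℕ} (p : (Fin s → LIdx l) → MvPolynomial (LIdx l) ℂ)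
    (J : Fin (s + 1) → LIdx l) : MvPolynomial (LIdx l) ℂ :=
  ∑ b, MvPolynomial.C ((gramLr N r (J (Fin.last s)) b : ℂ) / 2) *
    MvPolynomial.pderiv b (p fun i => J i.castSucc)

lemma HolPoly.lowerPoly {E : Type*} [NormedAddCommGroup E] [NormedSpace ℂ E] {D : Set E} {s : ℕ}
    {p : E → (Fin s → LIdx l) → MvPolynomial (LIdx l) ℂ} (hp : ∀ I, HolPoly D (fun z => p z I))
    (J : Fin (s + 1) → LIdx l) : HolPoly D (fun z => lowerPoly N r (p z) J) :=
  HolPoly.sum _ fun _ _ => (HolPoly.const _).mul ((hp _).pderiv _)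

lemma IsNuExpansion.lowering [NeZero r] {s : ℕ} {F : (LIdx l → ℂ) → Tensor l s}
    {p : (LIdx l → ℂ) → (Fin s → LIdx l) → MvPolynomial (LIdx l) ℂ}
    (hp : IsNuExpansion N r F p) :
    IsNuExpansion N r (lowering N r F) (fun z => lowerPoly N r (p z)) := by
  intro J
  refine (HolPoly.lowerPoly N r (fun I => (hp I).holPoly) J).isPolyExpansion fun z hz => ?_
  have hI := hp fun i => J i.castSucc
  rw [lowering_eq_dbar, dbar_congr_of_eqOn (isOpen_tube N) hI.eq hz,
    hI.holPoly.dbar_eval (isOpen_tube N) hz fun b => differentiableAt_nu N r hz b]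
  simp only [OrthogonalFJ.lowerPoly, map_sum, map_mul, MvPolynomial.eval_C, dbar_nu N r hz]
  exact Finset.sum_congr rfl fun b _ => by ring

/-- A smooth tensor whose image under the lowering operator is a polynomial in `ν` is itself a
polynomial in `ν`. -/
lemma exists_isNuExpansion_of_lowering [NeZero r] {s : ℕ} {F : (LIdx l → ℂ) → Tensor l s}
    (hF : ∀ I, ContDiffOn ℝ ∞ (fun z => F z I) (tube N))
    {p : (LIdx l → ℂ) → (Fin (s + 1) → LIdx l) → MvPolynomial (LIdx l) ℂ}
    (hp : IsNuExpansion N r (OrthogonalFJ.lowering N r F) p) :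
    ∃ q, IsNuExpansion N r F q := by
  have key : ∀ I, ∃ P, IsPolyExpansion (tube N) (nu N r) (fun z => F z I) P := by
    intro I
    refine exists_isPolyExpansion (w := nuFrame N r) (by simp) (isOpen_tube N)
      (contDiffOn_nu N r) (fun z hz i j => dbar_nu_nuFrame N r hz i j) (hF I)
      (Q := fun i z => ∑ a, MvPolynomial.C ((2 * (gramLr N r)⁻¹ i a : ℝ) : ℂ) *
        p z (Fin.snoc (α := fun _ => LIdx l) I a)) (fun i => HolPoly.sum _ fun a _ =>
          (HolPoly.const _).mul (hp _).holPoly) fun z hz i => ?_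
    rw [dbar_nuFrame, map_sum]
    refine Finset.sum_congr rfl fun a _ => ?_
    rw [map_mul, MvPolynomial.eval_C, ← (hp _).eq z hz, lowering_eq_dbar]
    simp
  choose q hq using key
  exact ⟨fun z I => q I z, hq⟩

lemma contDiffOn_lowering {s : ℕ} {F : (LIdx l → ℂ) → Tensor l s}
    (hF : ∀ I, ContDiffOn ℝ ∞ (fun z => F z I) (tube N)) (J : Fin (s + 1) → LIdx l) :
    ContDiffOn ℝ ∞ (fun z => lowering N r F z J) (tube N) := by
  have hd := fun v => contDiffOn_dbar (isOpen_tube N) (hF fun i => J i.castSucc) v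
  refine (((contDiff_imSq N r).contDiffOn).mul (hd _)).sub ((contDiffOn_const.mul
    (ContDiffOn.sum fun b _ => (hd _).mul (contDiff_imVec b).contDiffOn)).mul
    (ContDiffOn.sum fun c _ => contDiffOn_const.mul (contDiff_imVec c).contDiffOn))

lemma contDiffOn_lowerIter {s : ℕ} {F : (LIdx l → ℂ) → Tensor l s}
    (hF : ∀ I, ContDiffOn ℝ ∞ (fun z => F z I) (tube N)) (d : ℕ) :
    ∀ I, ContDiffOn ℝ ∞ (fun z => lowerIter N r F d z I) (tube N) := by
  induction d with
  | zero => exact hF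
  | succ d ih => exact contDiffOn_lowering N r ih

/-- Almost-holomorphic modular forms are polynomials in `ν` with holomorphic coefficients. -/
theorem IsAHMod.exists_isNuExpansion [NeZero r] {s : ℕ} {Γ : Subgroup (GL (MIdx l) ℤ)} {k : ℤ}
    {F : (LIdx l → ℂ) → Tensor l s} (hF : IsAHMod N r Γ k F) : ∃ p, IsNuExpansion N r F p := by
  have hs : ∀ I, ContDiffOn ℝ ∞ (fun z => F z I) (tube N) := contDiffOn_pi.mp hF.smooth
  obtain ⟨d, hd⟩ := hF.almostHol
  have h0 : ∃ p, IsNuExpansion N r (lowerIter N r F d) p :=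
    ⟨fun _ _ => 0, fun I => (HolPoly.const _).isPolyExpansion fun z hz => by simp [hd z hz]⟩
  clear hd
  induction d with
  | zero => exact h0
  | succ d ih =>
    obtain ⟨p, hp⟩ := h0
    exact ih (exists_isNuExpansion_of_lowering N r (contDiffOn_lowerIter N r hs d) hp)

end Tube

/-! ### Fourier expansions on a half plane -/

section Fourier

lemma qexp_add (x y : ℂ) : qexp (x + y) = qexp x * qexp y := by
  rw [qexp, qexp, qexp, ← Complex.exp_add]; ring_nf

lemma qexp_zero : qexp 0 = 1 := by simp [qexp]

lemma qexp_ne_zero (x : ℂ) : qexp x ≠ 0 := Complex.exp_ne_zero _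

lemma qexp_intCast (n : ℤ) : qexp n = 1 := by
  rw [qexp, Complex.exp_eq_one_iff]; exact ⟨n, by ring⟩

lemma norm_qexp (x : ℂ) : ‖qexp x‖ = Real.exp (-(2 * Real.pi * x.im)) := by
  rw [qexp, Complex.norm_exp]; congr 1; simp

lemma differentiable_qexp : Differentiable ℂ qexp := by
  unfold qexp; fun_prop

lemma continuous_qexp : Continuous qexp := differentiable_qexp.continuous

lemma integral_qexp (m : ℤ) : ∫ x in (0 : ℝ)..1, qexp (m * x) = if m = 0 then 1 else 0 := by
  split_ifs with h
  · simp [h, qexp_zero]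
  · have hc : (2 * Real.pi * Complex.I * m : ℂ) ≠ 0 := by
      simp [h, Real.pi_ne_zero]
    have := integral_exp_mul_complex (a := 0) (b := 1) hc
    simp only [qexp]
    rw [show (fun x : ℝ => Complex.exp (2 * Real.pi * Complex.I * (m * x))) =
      fun x : ℝ => Complex.exp (2 * Real.pi * Complex.I * m * x) by funext x; ring_nf, this]
    have h1 := qexp_intCast m
    rw [qexp] at h1
    simp [h1]

/-- The coefficients of a Fourier expansion on one horizontal line are given by integrals. -/
lemma eq_integral_of_hasSum {c : ℤ → ℂ} {y : ℝ} {f : ℂ → ℂ}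
    (h : ∀ x : ℝ, HasSum (fun m : ℤ => c m * qexp (m * (x + y * Complex.I)))
      (f (x + y * Complex.I))) (n : ℤ) :
    c n = ∫ x in (0 : ℝ)..1, f (x + y * Complex.I) * qexp (-(n * (x + y * Complex.I))) := by
  have hs : Summable fun m : ℤ => ‖c m * qexp (m * (y * Complex.I))‖ := by
    have := (h 0).summable.norm
    simpa using this
  let g : ℤ → C(ℝ, ℂ) := fun m => ⟨fun x : ℝ => c m * qexp (m * (x + y * Complex.I)) *
    qexp (-(n * (x + y * Complex.I))), by
      have := continuous_qexp; fun_prop⟩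
  have hg : ∀ m (x : ℝ), g m x = c m * qexp (m * (x + y * Complex.I)) *
    qexp (-(n * (x + y * Complex.I))) := fun _ _ => rfl
  have hnorm : ∀ m (x : ℝ), ‖g m x‖ = ‖c m * qexp (m * (y * Complex.I))‖ *
      ‖qexp (-(n * (y * Complex.I)))‖ := fun m x => by
    rw [hg, norm_mul, norm_mul, norm_mul, norm_qexp, norm_qexp, norm_qexp, norm_qexp]
    simp
  have hsum : Summable fun m : ℤ => ‖(g m).restrict
      (⟨Set.uIcc 0 1, isCompact_uIcc⟩ : TopologicalSpace.Compacts ℝ)‖ := by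
    refine Summable.of_nonneg_of_le (fun _ => norm_nonneg _) (fun m => ?_)
      (hs.mul_right ‖qexp (-(n * (y * Complex.I)))‖)
    refine (ContinuousMap.norm_le _ (by positivity)).mpr fun x => ?_
    exact (hnorm m x).le
  have h1 := intervalIntegral.hasSum_intervalIntegral_of_summable_norm hsum
  have h2 : ∀ x : ℝ, ∑' m, g m x =
      f (x + y * Complex.I) * qexp (-(n * (x + y * Complex.I))) := fun x =>
    ((h x).mul_right _).tsum_eq
  simp only [h2] at h1
  have h3 : ∀ m : ℤ, ∫ x in (0 : ℝ)..1, g m x = if m = n then c n else 0 := fun m => by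
    have h4 : ∀ x : ℝ, g m x = c m * qexp ((m - n : ℤ) * (y * Complex.I)) *
        qexp ((m - n : ℤ) * x) := fun x => by
      rw [hg, mul_assoc, ← qexp_add, mul_assoc, ← qexp_add]
      congr 2; push_cast; ring
    simp only [h4]
    rw [intervalIntegral.integral_const_mul, integral_qexp]
    by_cases hmn : m = n
    · subst hmn; simp [qexp_zero]
    · simp [hmn, sub_eq_zero]
  simp only [h3] at h1
  exact (hasSum_ite_eq n (c n)).unique h1

/-- A Fourier expansion is determined by its sum on one horizontal line. -/
lemma fourier_unique {c d : ℤ → ℂ} {y : ℝ} {f : ℂ → ℂ}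
    (hc : ∀ x : ℝ, HasSum (fun m : ℤ => c m * qexp (m * (x + y * Complex.I)))
      (f (x + y * Complex.I)))
    (hd : ∀ x : ℝ, HasSum (fun m : ℤ => d m * qexp (m * (x + y * Complex.I)))
      (f (x + y * Complex.I))) (n : ℤ) : c n = d n := by
  rw [eq_integral_of_hasSum hc, eq_integral_of_hasSum hd]

/-- The `m`-th Fourier coefficient, computed on the line `Im ω = y`. -/
noncomputable def fourierInt (f : ℂ → ℂ) (y : ℝ) (m : ℤ) : ℂ :=
  ∫ x in (0 : ℝ)..1, f (x + y * Complex.I) * qexp (-(m * (x + y * Complex.I)))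

/-- By Cauchy's theorem, the Fourier coefficients do not depend on the line of integration. -/
lemma fourierInt_eq {f : ℂ → ℂ} {c : ℝ} (hf : DifferentiableOn ℂ f {u | c < u.im})
    (hp : ∀ u, c < u.im → f (u + 1) = f u) (m : ℤ) {y y' : ℝ} (hy : c < y) (hy' : c < y') :
    fourierInt f y m = fourierInt f y' m := by
  set g : ℂ → ℂ := fun u => f u * qexp (-(m * u)) with hg
  have hgd : DifferentiableOn ℂ g {u | c < u.im} :=
    hf.mul (differentiable_qexp.comp (by fun_prop)).differentiableOn
  have hgp : ∀ u, c < u.im → g (u + 1) = g u := fun u hω => by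
    simp only [hg]
    rw [hp u hω, show (-(m * (u + 1)) : ℂ) = -(m * u) + ((-m : ℤ) : ℂ) by push_cast; ring, qexp_add,
      qexp_intCast, mul_one]
  have h := Complex.integral_boundary_rect_eq_zero_of_differentiableOn g (y * Complex.I)
    (1 + y' * Complex.I) (hgd.mono fun u hω => by
      have h2 := hω.2
      simp only [Complex.mul_im, Complex.add_im, Complex.ofReal_re, Complex.ofReal_im,
        Complex.I_im, Complex.I_re, Complex.one_im, mul_one, mul_zero, add_zero, zero_add,
        Set.mem_preimage] at h2
      rw [Set.mem_uIcc] at h2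
      simp only [Set.mem_ofPred_eq]
      rcases h2 with h2 | h2 <;> linarith)
  simp only [Complex.mul_im, Complex.add_im, Complex.mul_re, Complex.add_re, Complex.ofReal_re,
    Complex.ofReal_im, Complex.I_im, Complex.I_re, Complex.one_im, Complex.one_re, mul_one,
    mul_zero, add_zero, zero_add, sub_zero] at h
  have h1 : ∫ t in y..y', g (((1 : ℝ) : ℂ) + t * Complex.I) =
      ∫ t in y..y', g (((0 : ℝ) : ℂ) + t * Complex.I) := by
    refine intervalIntegral.integral_congr fun t ht => ?_
    have : c < t := by
      rw [Set.mem_uIcc] at ht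
      rcases ht with h2 | h2 <;> linarith
    have h2 := hgp (((0 : ℝ) : ℂ) + t * Complex.I) (by simpa using this)
    rw [← h2]
    congr 1; push_cast; ring
  rw [h1] at h
  simp only [fourierInt]
  linear_combination h

lemma fourierInt_norm_le {f : ℂ → ℂ} {y M : ℝ} (hM : ∀ x ∈ Set.Icc (0 : ℝ) 1,
    ‖f (x + y * Complex.I)‖ ≤ M) (m : ℤ) :
    ‖fourierInt f y m‖ ≤ M * Real.exp (2 * Real.pi * m * y) := by
  have h := intervalIntegral.norm_integral_le_of_norm_le_const (a := 0) (b := 1)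
    (f := fun x : ℝ => f (x + y * Complex.I) * qexp (-(m * (x + y * Complex.I))))
    (C := M * Real.exp (2 * Real.pi * m * y)) fun x hx => by
      rw [Set.uIoc_of_le zero_le_one] at hx
      rw [norm_mul, norm_qexp]
      have : -(2 * Real.pi * (-(m * (x + y * Complex.I)) : ℂ).im) = 2 * Real.pi * m * y := by
        simp; ring
      rw [this]
      exact mul_le_mul_of_nonneg_right (hM x ⟨hx.1.le, hx.2⟩) (Real.exp_pos _).le
  simpa [fourierInt] using h

lemma summable_exp_neg_abs {δ : ℝ} (hδ : 0 < δ) :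
    Summable fun m : ℤ => Real.exp (-(δ * |(m : ℝ)|)) := by
  have h : Summable fun n : ℕ => Real.exp (-(δ * (n : ℝ))) := by
    have := Real.summable_exp_nat_mul_iff.mpr (neg_lt_zero.mpr hδ)
    exact this.congr fun n => by ring_nf
  refine Summable.of_nat_of_neg ?_ ?_ <;> simpa using h

/-- A holomorphic function with period `1` on a half plane is the sum of its Fourier series: the
coefficients decay exponentially, as the line of integration may be moved to both sides. -/
theorem hasSum_fourierInt {f : ℂ → ℂ} {c : ℝ} (hf : DifferentiableOn ℂ f {u | c < u.im})
    (hp : ∀ u, c < u.im → f (u + 1) = f u) {y : ℝ} (hy : c < y) {u : ℂ} (hω : c < u.im) :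
    HasSum (fun m : ℤ => fourierInt f y m * qexp (m * u)) (f u) := by
  have hline : ∀ y : ℝ, c < y → Continuous fun x : ℝ => f (x + y * Complex.I) := fun y hy => by
    refine hf.continuousOn.comp_continuous (by fun_prop) fun x => ?_
    simpa using hy
  set y₀ := u.im with hy₀
  have hper : Function.Periodic (fun x : ℝ => f (x + y₀ * Complex.I)) 1 := fun x => by
    have h2 := hp (x + y₀ * Complex.I) (by simpa using hω)
    refine Eq.trans ?_ h2
    change f _ = f _
    congr 1; push_cast; ring
  let F : C(AddCircle (1 : ℝ), ℂ) := ⟨hper.lift, by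
    exact continuous_coinduced_dom.mpr (hline y₀ hω)⟩
  have hF : ∀ x : ℝ, F (x : AddCircle (1 : ℝ)) = f (x + y₀ * Complex.I) := fun x => rfl
  have hcoef : ∀ m : ℤ, fourierCoeff F m =
      fourierInt f y₀ m * qexp (m * (y₀ * Complex.I)) := fun m => by
    rw [fourierCoeff_eq_intervalIntegral F m 0, fourierInt, ← intervalIntegral.integral_mul_const]
    simp only [zero_add, div_one, one_smul, smul_eq_mul, fourier_coe_apply, hF, Complex.ofReal_one]
    refine intervalIntegral.integral_congr fun x _ => ?_
    conv_rhs => rw [mul_assoc, ← qexp_add, mul_comm]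
    congr 1
    rw [qexp]
    congr 1; push_cast; ring
  obtain ⟨δ, hδ, hδ1⟩ : ∃ δ > 0, c < y₀ - δ := ⟨(y₀ - c) / 2, by linarith, by linarith⟩
  have hbd : ∀ y : ℝ, c < y → ∃ M, ∀ x ∈ Set.Icc (0 : ℝ) 1, ‖f (x + y * Complex.I)‖ ≤ M :=
    fun y hy => by
      obtain ⟨M, hM⟩ := isCompact_Icc.exists_bound_of_continuousOn
        (hline y hy).continuousOn (s := Set.Icc (0 : ℝ) 1)
      exact ⟨M, hM⟩
  obtain ⟨M₁, hM₁⟩ := hbd (y₀ - δ) hδ1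
  obtain ⟨M₂, hM₂⟩ := hbd (y₀ + δ) (by linarith)
  have hsum : Summable (fourierCoeff F) := by
    refine Summable.of_norm_bounded (g := fun m : ℤ => (max M₁ M₂) *
      Real.exp (-((2 * Real.pi * δ) * |(m : ℝ)|)))
      ((summable_exp_neg_abs (by positivity)).mul_left _) fun m => ?_
    have hM0 : 0 ≤ max M₁ M₂ := (norm_nonneg _).trans
      ((hM₁ 0 (by simp)).trans (le_max_left _ _))
    rw [hcoef, norm_mul, norm_qexp]
    rcases le_total 0 (m : ℝ) with hm | hm
    · rw [fourierInt_eq hf hp m hω hδ1]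
      refine (mul_le_mul_of_nonneg_right (fourierInt_norm_le hM₁ m) (Real.exp_pos _).le).trans ?_
      rw [mul_assoc, ← Real.exp_add, abs_of_nonneg hm]
      refine mul_le_mul (le_max_left _ _) (Real.exp_le_exp.mpr ?_) (Real.exp_pos _).le hM0
      simp; ring_nf; rfl
    · rw [fourierInt_eq hf hp m hω (show c < y₀ + δ by linarith)]
      refine (mul_le_mul_of_nonneg_right (fourierInt_norm_le hM₂ m) (Real.exp_pos _).le).trans ?_
      rw [mul_assoc, ← Real.exp_add, abs_of_nonpos hm]
      refine mul_le_mul (le_max_right _ _) (Real.exp_le_exp.mpr ?_) (Real.exp_pos _).le hM0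
      simp; ring_nf; rfl
  have h := has_pointwise_sum_fourier_series_of_summable hsum (u.re : AddCircle (1 : ℝ))
  rw [hF] at h
  have hu : (u.re : ℂ) + y₀ * Complex.I = u := Complex.re_add_im u
  rw [hu] at h
  have hterm : (fun m : ℤ => fourierInt f y m * qexp (m * u)) =
      fun m : ℤ => fourierCoeff F m • fourier m (u.re : AddCircle (1 : ℝ)) := by
    funext m
    rw [hcoef, fourierInt_eq hf hp m hy hω, smul_eq_mul, fourier_coe_apply, mul_assoc]
    conv_lhs => rw [← hu, mul_add, add_comm, qexp_add]
    congr 2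
    rw [qexp]
    congr 1
    push_cast; ring
  rw [hterm]
  exact h

end Fourier

/-! ### Integrals of holomorphic functions with parameters -/

section ParametricIntegral

open Metric Set

/-- The derivative of a holomorphic function of several variables is continuous: by the Cauchy
estimates, the difference `u ↦ h (z + u) - h (z₀ + u)` has a small derivative at `0`. -/
lemma continuousOn_fderiv_of_holomorphic {E : Type*} [NormedAddCommGroup E] [NormedSpace ℂ E]
    [ProperSpace E] {D : Set E} (hD : IsOpen D) {h : E → ℂ} (hh : DifferentiableOn ℂ h D) :
    ContinuousOn (fderiv ℂ h) D := by
  intro z₀ hz₀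
  refine ContinuousAt.continuousWithinAt ?_
  obtain ⟨δ, hδ, hball⟩ : ∃ δ > 0, closedBall z₀ (2 * δ) ⊆ D := by
    obtain ⟨ε, hε, h⟩ := Metric.isOpen_iff.mp hD z₀ hz₀
    exact ⟨ε / 4, by linarith, (closedBall_subset_ball (by linarith)).trans h⟩
  rw [Metric.continuousAt_iff]
  intro ε hε
  have huc := (isCompact_closedBall z₀ (2 * δ)).uniformContinuousOn_of_continuous
    (hh.continuousOn.mono hball)
  obtain ⟨η, hη, hu⟩ := Metric.uniformContinuousOn_iff.mp huc (ε * δ / 4) (by positivity)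
  refine ⟨min η δ, lt_min hη hδ, fun {z} hz => ?_⟩
  have hzη := hz.trans_le (min_le_left _ _)
  have hzδ := hz.trans_le (min_le_right _ _)
  have hin : ∀ u ∈ ball (0 : E) δ, z + u ∈ closedBall z₀ (2 * δ) ∧ z₀ + u ∈ closedBall z₀ (2 * δ) := by
    intro u hu
    rw [mem_ball_zero_iff] at hu
    rw [dist_eq_norm] at hzδ
    constructor
    · rw [mem_closedBall, dist_eq_norm]
      calc ‖z + u - z₀‖ = ‖(z - z₀) + u‖ := by congr 1; abel
        _ ≤ ‖z - z₀‖ + ‖u‖ := norm_add_le _ _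
        _ ≤ 2 * δ := by linarith
    · rw [mem_closedBall, dist_eq_norm, add_sub_cancel_left]; linarith
  have hat : ∀ w ∈ closedBall z₀ (2 * δ), DifferentiableAt ℂ h w := fun w hw =>
    hh.differentiableAt (hD.mem_nhds (hball hw))
  have hdiff : DifferentiableOn ℂ (fun u => h (z + u) - h (z₀ + u)) (ball 0 δ) := fun u hu =>
    (((hat _ (hin u hu).1).comp u (by fun_prop)).sub
      ((hat _ (hin u hu).2).comp u (by fun_prop))).differentiableWithinAt
  have hclose : ∀ u ∈ ball (0 : E) δ, ‖h (z + u) - h (z₀ + u)‖ < ε * δ / 4 := fun u hu' => by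
    rw [← dist_eq_norm]
    exact hu _ (hin u hu').1 _ (hin u hu').2 (by simpa using hzη)
  have hmaps : MapsTo (fun u => h (z + u) - h (z₀ + u)) (ball 0 δ)
      (closedBall ((fun u => h (z + u) - h (z₀ + u)) 0) (ε * δ / 2)) := fun u hu' => by
    rw [mem_closedBall, dist_eq_norm]
    have h1 := hclose u hu'
    have h2 := hclose 0 (by simpa using hδ)
    refine (norm_sub_le _ _).trans ?_
    linarith
  have h3 := Complex.norm_fderiv_le_div_of_mapsTo_ball hdiff hmaps hδ
  have h0 := hin 0 (by simpa using hδ)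
  simp only [add_zero] at h0
  have h4 : fderiv ℂ (fun u => h (z + u) - h (z₀ + u)) 0 = fderiv ℂ h z - fderiv ℂ h z₀ := by
    have e1 : HasFDerivAt (fun u => h (z + u)) (fderiv ℂ h z) 0 := by
      have h5 := (hat z h0.1).hasFDerivAt
      have h6 : HasFDerivAt (fun u : E => z + u) (ContinuousLinearMap.id ℂ E) 0 :=
        (hasFDerivAt_id 0).const_add z
      rw [← add_zero z] at h5
      have h7 := h5.comp 0 h6
      rw [ContinuousLinearMap.comp_id, add_zero] at h7
      exact h7
    have e2 : HasFDerivAt (fun u => h (z₀ + u)) (fderiv ℂ h z₀) 0 := by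
      have h5 := (hat z₀ h0.2).hasFDerivAt
      have h6 : HasFDerivAt (fun u : E => z₀ + u) (ContinuousLinearMap.id ℂ E) 0 :=
        (hasFDerivAt_id 0).const_add z₀
      rw [← add_zero z₀] at h5
      have h7 := h5.comp 0 h6
      rw [ContinuousLinearMap.comp_id, add_zero] at h7
      exact h7
    exact (e1.sub e2).fderiv
  rw [h4] at h3
  rw [dist_eq_norm]
  refine h3.trans_lt ?_
  rw [div_lt_iff₀ hδ]
  nlinarith [mul_pos hε hδ]

/-- Integrals of holomorphic functions over a segment depend holomorphically on parameters. -/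
lemma differentiableAt_integral_of_holomorphic {E : Type*} [NormedAddCommGroup E]
    [NormedSpace ℂ E] [ProperSpace E] {D : Set (ℂ × E)} (hD : IsOpen D) {K : ℂ × E → ℂ}
    (hK : DifferentiableOn ℂ K D) {y : ℝ} {q₀ : E}
    (hq₀ : ∀ x ∈ Icc (0 : ℝ) 1, ((x : ℂ) + y * Complex.I, q₀) ∈ D) :
    DifferentiableAt ℂ (fun q => ∫ x in (0 : ℝ)..1, K ((x : ℂ) + y * Complex.I, q)) q₀ := by
  have hφ : Continuous fun p : ℝ × E => ((p.1 : ℂ) + y * Complex.I, p.2) := by fun_prop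
  obtain ⟨u, v, -, hv, hu, hqv, huv⟩ := generalized_tube_lemma (s := Icc (0 : ℝ) 1) isCompact_Icc
    (t := {q₀}) isCompact_singleton (hD.preimage hφ) (by
      rintro ⟨x, q⟩ ⟨hx, hq⟩
      obtain rfl : q = q₀ := hq
      exact hq₀ x hx)
  obtain ⟨δ, hδ, hball⟩ := Metric.nhds_basis_closedBall.mem_iff.mp
    (hv.mem_nhds (hqv (mem_singleton q₀)))
  have hin : ∀ x ∈ Icc (0 : ℝ) 1, ∀ q ∈ closedBall q₀ δ, ((x : ℂ) + y * Complex.I, q) ∈ D :=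
    fun x hx q hq => huv (mk_mem_prod (hu hx) (hball hq))
  set K' : E → ℝ → E →L[ℂ] ℂ := fun q x =>
    (fderiv ℂ K ((x : ℂ) + y * Complex.I, q)).comp (ContinuousLinearMap.inr ℂ ℂ E) with hK'
  have hcont : ContinuousOn (fun p : ℝ × E => K' p.2 p.1) (Icc (0 : ℝ) 1 ×ˢ closedBall q₀ δ) := by
    have h1 : ContinuousOn (fun p : ℝ × E => fderiv ℂ K ((p.1 : ℂ) + y * Complex.I, p.2))
        (Icc (0 : ℝ) 1 ×ˢ closedBall q₀ δ) :=
      (continuousOn_fderiv_of_holomorphic hD hK).comp hφ.continuousOn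
        fun p hp => hin _ hp.1 _ hp.2
    exact h1.clm_comp continuousOn_const
  obtain ⟨C, hC⟩ := (isCompact_Icc.prod (isCompact_closedBall q₀ δ)).exists_bound_of_continuousOn
    hcont
  have hIoc : uIoc (0 : ℝ) 1 ⊆ Icc 0 1 := by
    rw [uIoc_of_le zero_le_one]; exact Ioc_subset_Icc_self
  have hKc : ∀ q ∈ closedBall q₀ δ,
      ContinuousOn (fun x : ℝ => K ((x : ℂ) + y * Complex.I, q)) (Icc 0 1) := fun q hq =>
    hK.continuousOn.comp (by fun_prop) fun x hx => hin x hx q hq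
  have hq0 : q₀ ∈ closedBall q₀ δ := mem_closedBall_self hδ.le
  refine (intervalIntegral.hasFDerivAt_integral_of_dominated_of_fderiv_le (𝕜 := ℂ)
    (μ := MeasureTheory.volume) (bound := fun _ => C) (F' := K') (closedBall_mem_nhds q₀ hδ) ?_ ?_ ?_ ?_
    intervalIntegrable_const ?_).differentiableAt
  · filter_upwards [closedBall_mem_nhds q₀ hδ] with q hq
    exact ((hKc q hq).mono hIoc).aestronglyMeasurable measurableSet_uIoc
  · exact ContinuousOn.intervalIntegrable (by rw [uIcc_of_le zero_le_one]; exact hKc q₀ hq0)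
  · have h1 : ContinuousOn (K' q₀) (Icc 0 1) := hcont.comp
      (f := fun x : ℝ => (x, q₀)) (by fun_prop) fun x hx => ⟨hx, hq0⟩
    exact (h1.mono hIoc).aestronglyMeasurable measurableSet_uIoc
  · exact Filter.Eventually.of_forall fun x hx q hq => hC (x, q) ⟨hIoc hx, hq⟩
  · refine Filter.Eventually.of_forall fun x hx q hq => ?_
    have h1 := (hK.differentiableAt (hD.mem_nhds (hin x (hIoc hx) q hq))).hasFDerivAt
    have h2 : HasFDerivAt (fun q : E => ((x : ℂ) + y * Complex.I, q))
        (ContinuousLinearMap.inr ℂ ℂ E) q := hasFDerivAt_prodMk_right _ _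
    exact h1.comp q h2

end ParametricIntegral

/-! ### Fourier–Jacobi expansions of holomorphic functions -/

section Slices

variable {l : ℕ} (N : EvenLattice l)

/-- The point `(u, 𝔷, τ)` of `L_ℂ`. -/
def slicePt (u : ℂ) (q : (Fin l → ℂ) × ℂ) : LIdx l → ℂ := lvec u q.1 q.2

/-- The infimum of `Im ω` over the points `(ω, 𝔷, τ)` of the tube domain. -/
noncomputable def hgt (q : (Fin l → ℂ) × ℂ) : ℝ :=
  pair N.gram (fun i => (q.1 i).im) (fun i => (q.1 i).im) / (2 * q.2.im)

variable {N}

lemma slicePt_iE1 (u : ℂ) (q : (Fin l → ℂ) × ℂ) : slicePt u q iE1 = u := rfl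

lemma zTau_slicePt (u : ℂ) (q : (Fin l → ℂ) × ℂ) : zTau (slicePt u q) = q := rfl

lemma slicePt_zTau (z : LIdx l → ℂ) : slicePt (z iE1) (zTau z) = z := by
  funext a; rcases a with _ | i | _ <;> rfl

lemma slicePt_add (u c : ℂ) (q : (Fin l → ℂ) × ℂ) :
    slicePt (u + c) q = slicePt u q + c • vE1 := by
  funext a; rcases a with _ | i | _ <;> simp [slicePt, lvec, vE1]

lemma mem_tube_iff {z : LIdx l → ℂ} :
    z ∈ tube N ↔ zTau z ∈ jacobiDomain l ∧ hgt N (zTau z) < (z iE1).im := by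
  have hp : pair (gramL N) (imVec z) (imVec z) = 2 * (z iE1).im * (z iF1).im -
      pair N.gram (fun i => ((zTau z).1 i).im) (fun i => ((zTau z).1 i).im) := by
    rw [pair_gramL]; simp only [imVec, zTau]; ring
  have h0 := pair_nonneg N (fun i => ((zTau z).1 i).im)
  simp only [tube, jacobiDomain, Set.mem_ofPred_eq, hp, hgt]
  change _ ↔ 0 < (z iF1).im ∧ _ / (2 * (z iF1).im) < _
  constructor
  · rintro ⟨-, h2, h3⟩
    exact ⟨h2, by rw [div_lt_iff₀ (by linarith)]; linarith⟩
  · rintro ⟨h2, h3⟩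
    rw [div_lt_iff₀ (by linarith)] at h3
    refine ⟨?_, h2, by linarith⟩
    by_contra hcon
    have := mul_nonneg_of_nonpos_of_nonpos (not_lt.mp hcon) (neg_nonpos.mpr h2.le)
    nlinarith

lemma slicePt_mem_tube {u : ℂ} {q : (Fin l → ℂ) × ℂ} :
    slicePt u q ∈ tube N ↔ q ∈ jacobiDomain l ∧ hgt N q < u.im := mem_tube_iff

lemma isOpen_jacobiDomain : IsOpen (jacobiDomain l) :=
  isOpen_lt continuous_const (Complex.continuous_im.comp continuous_snd)

lemma differentiable_slicePt :
    Differentiable ℂ (fun p : ℂ × ((Fin l → ℂ) × ℂ) => slicePt p.1 p.2) := by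
  refine differentiable_pi.mpr fun a => ?_
  rcases a with _ | i | _ <;> simp only [slicePt, lvec, Sum.elim_inl, Sum.elim_inr] <;> fun_prop

lemma continuousOn_hgt : ContinuousOn (hgt N) (jacobiDomain l) := by
  have h : Continuous fun q : (Fin l → ℂ) × ℂ =>
      pair N.gram (fun i => (q.1 i).im) (fun i => (q.1 i).im) := by
    simp only [pair, dotProduct, Matrix.mulVec]; fun_prop
  refine h.continuousOn.div (by fun_prop) fun q hq => ?_
  have : 0 < q.2.im := hq
  positivity

variable {h : (LIdx l → ℂ) → ℂ} {a b : ℤ → (Fin l → ℂ) × ℂ → ℂ}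

lemma IsFourierExpansion.eq_fourierInt (ha : IsFourierExpansion N h a)
    {q : (Fin l → ℂ) × ℂ} (hq : q ∈ jacobiDomain l) {y : ℝ} (hy : hgt N q < y) (m : ℤ) :
    a m q = fourierInt (fun u => h (slicePt u q)) y m := by
  refine eq_integral_of_hasSum (c := fun m => a m q) (f := fun u => h (slicePt u q)) (fun x => ?_) m
  exact ha _ (slicePt_mem_tube.mpr ⟨hq, by simpa using hy⟩)

lemma IsFourierExpansion.unique (ha : IsFourierExpansion N h a) (hb : IsFourierExpansion N h b)
    {q : (Fin l → ℂ) × ℂ} (hq : q ∈ jacobiDomain l) (m : ℤ) : a m q = b m q := by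
  rw [ha.eq_fourierInt hq (lt_add_one _), hb.eq_fourierInt hq (lt_add_one _)]

/-- The Fourier–Jacobi coefficients of a holomorphic function are holomorphic. -/
lemma IsFourierExpansion.differentiableOn (ha : IsFourierExpansion N h a)
    (hh : DifferentiableOn ℂ h (tube N)) (m : ℤ) : DifferentiableOn ℂ (a m) (jacobiDomain l) := by
  intro q₀ hq₀
  set y : ℝ := hgt N q₀ + 1 with hy
  have hmem : {q | q ∈ jacobiDomain l ∧ hgt N q < y} ∈ nhds q₀ := by
    have h1 := isOpen_jacobiDomain.mem_nhds hq₀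
    have h2 := (continuousOn_hgt (N := N)).continuousAt h1
    filter_upwards [h1, h2.eventually_lt continuousAt_const (show hgt N q₀ < y by rw [hy]; linarith)]
      with q hq hq' using ⟨hq, hq'⟩
  have hD : IsOpen {p : ℂ × ((Fin l → ℂ) × ℂ) | slicePt p.1 p.2 ∈ tube N} :=
    (isOpen_tube N).preimage differentiable_slicePt.continuous
  have hK : DifferentiableOn ℂ (fun p : ℂ × ((Fin l → ℂ) × ℂ) =>
      h (slicePt p.1 p.2) * qexp (-(m * p.1))) {p | slicePt p.1 p.2 ∈ tube N} :=
    (hh.comp differentiable_slicePt.differentiableOn fun p hp => hp).mul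
      (differentiable_qexp.comp (by fun_prop)).differentiableOn
  have hd := differentiableAt_integral_of_holomorphic hD hK (y := y) (q₀ := q₀) fun x _ =>
    slicePt_mem_tube.mpr ⟨hq₀, by simp [hy]⟩
  refine (hd.congr_of_eventuallyEq ?_).differentiableWithinAt
  filter_upwards [hmem] with q hq
  rw [ha.eq_fourierInt hq.1 hq.2, fourierInt]

/-- Holomorphic functions on the tube domain which are invariant under `ω ↦ ω + 1` have a
Fourier–Jacobi expansion. -/
lemma exists_isFourierExpansion (hh : DifferentiableOn ℂ h (tube N))
    (hp : ∀ z ∈ tube N, h (z + vE1) = h z) : ∃ a, IsFourierExpansion N h a := by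
  refine ⟨fun m q => fourierInt (fun u => h (slicePt u q)) (hgt N q + 1) m, fun z hz => ?_⟩
  obtain ⟨hq, hu⟩ := mem_tube_iff.mp hz
  have hd : DifferentiableOn ℂ (fun u => h (slicePt u (zTau z))) {u | hgt N (zTau z) < u.im} :=
    hh.comp (differentiable_slicePt.comp (by fun_prop :
      Differentiable ℂ fun u : ℂ => (u, zTau z))).differentiableOn
      fun u hu => slicePt_mem_tube.mpr ⟨hq, hu⟩
  have := hasSum_fourierInt hd (fun u hu => by
    have h1 := hp _ (slicePt_mem_tube.mpr ⟨hq, hu⟩)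
    rw [slicePt_add, one_smul, h1]) (lt_add_one _) hu
  rwa [slicePt_zTau] at this

end Slices

/-! ### Fourier–Jacobi expansions of polynomials in `ν` -/

section FJExpansion

variable {l s : ℕ} {N : EvenLattice l} {r : ℕ}
  {F : (LIdx l → ℂ) → Tensor l s}
  {P P' : ℤ → (Fin l → ℂ) × ℂ → (Fin s → LIdx l) → MvPolynomial (LIdx l) ℂ}

lemma exists_mem_tube {q : (Fin l → ℂ) × ℂ} (hq : q ∈ jacobiDomain l) :
    slicePt (((hgt N q + 1 : ℝ) : ℂ) * Complex.I) q ∈ tube N :=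
  slicePt_mem_tube.mpr ⟨hq, by simp⟩

lemma totalDegree_le_of_expansion {p : (LIdx l → ℂ) → MvPolynomial (LIdx l) ℂ} {d : ℕ}
    (hd : ∀ z ∈ tube N, (p z).totalDegree ≤ d)
    {R : ℤ → (Fin l → ℂ) × ℂ → MvPolynomial (LIdx l) ℂ}
    (hR : ∀ t, IsFourierExpansion N (fun z => (p z).coeff t) (fun m q => (R m q).coeff t))
    (m : ℤ) {q : (Fin l → ℂ) × ℂ} (hq : q ∈ jacobiDomain l) : (R m q).totalDegree ≤ d := by
  refine Finset.sup_le fun t ht => ?_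
  by_contra hcon
  refine MvPolynomial.mem_support_iff.mp ht ?_
  have h0 : IsFourierExpansion N (fun z => (p z).coeff t) (fun _ _ => 0) := by
    intro z hz
    have : (p z).coeff t = 0 := by
      refine MvPolynomial.notMem_support_iff.mp fun hmem => hcon ?_
      exact (MvPolynomial.le_totalDegree hmem).trans (hd z hz)
    simp [this]
  exact (hR t).unique h0 hq m

/-- The expansions of the coefficients of a polynomial, whose degree is bounded, give the
expansion of its values at a fixed point. -/
lemma hasSum_eval {p : (LIdx l → ℂ) → MvPolynomial (LIdx l) ℂ} (hp : HolPoly (tube N) p)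
    {R : ℤ → (Fin l → ℂ) × ℂ → MvPolynomial (LIdx l) ℂ}
    (hR : ∀ t, IsFourierExpansion N (fun z => (p z).coeff t) (fun m q => (R m q).coeff t))
    (ν : LIdx l → ℂ) {z : LIdx l → ℂ} (hz : z ∈ tube N) :
    HasSum (fun m : ℤ => MvPolynomial.eval ν (R m (zTau z)) * qexp (m * z iE1))
      (MvPolynomial.eval ν (p z)) := by
  obtain ⟨d, hd⟩ := hp.degree_le
  have h1 : ∀ Q : MvPolynomial (LIdx l) ℂ, Q.totalDegree ≤ d → MvPolynomial.eval ν Q =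
      ∑ t ∈ (Finsupp.finite_of_degree_le (σ := LIdx l) d).toFinset,
        Q.coeff t * MvPolynomial.eval ν (MvPolynomial.monomial t 1) := fun Q hQ => by
    conv_lhs => rw [eq_sum_of_totalDegree_le d Q hQ]
    simp [map_sum, MvPolynomial.eval_monomial]
  rw [h1 _ (hd z hz)]
  simp only [h1 _ (totalDegree_le_of_expansion hd hR _ (mem_tube_iff.mp hz).1), Finset.sum_mul]
  refine hasSum_sum fun t _ => ?_
  have := (hR t z hz).mul_right (MvPolynomial.eval ν (MvPolynomial.monomial t 1))
  convert! this using 2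
  ring

lemma IsFJExpansion.holPoly (hP : IsFJExpansion N r F P) (m : ℤ) (I : Fin s → LIdx l) :
    HolPoly (jacobiDomain l) (fun q => P m q I) := by
  obtain ⟨p, hp, hpP⟩ := hP
  obtain ⟨d, hd⟩ := (hp I).degree_le
  exact ⟨⟨d, fun q hq => totalDegree_le_of_expansion hd (hpP I) m hq⟩,
    fun t => (hpP I t).differentiableOn ((hp I).hol t) m⟩

variable [NeZero r]

lemma IsFJExpansion.unique (hP : IsFJExpansion N r F P) (hP' : IsFJExpansion N r F P') (m : ℤ)
    {q : (Fin l → ℂ) × ℂ} (hq : q ∈ jacobiDomain l) : P m q = P' m q := by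
  obtain ⟨p, hp, hpP⟩ := hP
  obtain ⟨p', hp', hpP'⟩ := hP'
  funext I
  have heq := nu_expansion_unique N r (hp I).holPoly (hp' I).holPoly fun z hz => by
    rw [← (hp I).eq z hz, (hp' I).eq z hz]
  ext t
  refine (hpP I t).unique (b := fun m q => (P' m q I).coeff t) (fun z hz => ?_) hq m
  simp only [heq z hz]
  exact hpP' I t z hz

lemma IsFJExpansion.hasSum (hP : IsFJExpansion N r F P) (I : Fin s → LIdx l)
    {z : LIdx l → ℂ} (hz : z ∈ tube N) :
    HasSum (fun m : ℤ => MvPolynomial.eval (nu N r z) (P m (zTau z) I) * qexp (m * z iE1))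
      (F z I) := by
  obtain ⟨p, hp, hpP⟩ := hP
  rw [(hp I).eq z hz]
  exact hasSum_eval (hp I).holPoly (hpP I) _ hz

/-- The Fourier–Jacobi expansion of `𝖫(F)` is obtained coefficient by coefficient. -/
lemma IsFJExpansion.lowering (hP : IsFJExpansion N r F P) :
    IsFJExpansion N r (OrthogonalFJ.lowering N r F) (fun m q => lowerPoly N r (P m q)) := by
  obtain ⟨p, hp, hpP⟩ := hP
  refine ⟨_, IsNuExpansion.lowering N r hp, fun J t z hz => ?_⟩
  simp only [lowerPoly, MvPolynomial.coeff_sum, MvPolynomial.coeff_C_mul, HolPoly.coeff_pderiv,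
    Finset.sum_mul]
  refine hasSum_sum fun b _ => ?_
  have := ((hpP (fun i => J i.castSucc) (t + Finsupp.single b 1) z hz).mul_left
    ((t b : ℂ) + 1)).mul_left ((gramLr N r (J (Fin.last s)) b : ℂ) / 2)
  convert! this using 2
  ring

lemma imVec_add_vE1 (z : LIdx l → ℂ) : imVec (z + vE1) = imVec z := by
  funext a; rcases a with _ | i | _ <;> simp [imVec, vE1, lvec]

lemma tube_add_vE1 {z : LIdx l → ℂ} (hz : z ∈ tube N) : z + vE1 ∈ tube N := by
  refine ⟨?_, ?_, ?_⟩
  · simpa [vE1, lvec] using hz.1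
  · simpa [vE1, lvec] using hz.2.1
  · rw [imVec_add_vE1]; exact hz.2.2

/-- By uniqueness of the expansion in `ν`, invariance under `ω ↦ ω + 1` is inherited by the
holomorphic coefficients. -/
lemma exists_isFJExpansion {p : (LIdx l → ℂ) → (Fin s → LIdx l) → MvPolynomial (LIdx l) ℂ}
    (hp : IsNuExpansion N r F p) (hF : ∀ z ∈ tube N, F (z + vE1) = F z) :
    ∃ P, IsFJExpansion N r F P := by
  have hnu : ∀ z, nu N r (z + vE1) = nu N r z := fun z => by
    funext b; simp only [nu, imSq, imVec_add_vE1]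
  have hper : ∀ I, ∀ z ∈ tube N, p (z + vE1) I = p z I := fun I =>
    nu_expansion_unique N r ((hp I).holPoly.comp (φ := fun z => z + vE1) (by fun_prop)
      fun z hz => tube_add_vE1 hz) (hp I).holPoly fun z hz => by
        rw [← (hp I).eq z hz, ← hF z hz, (hp I).eq _ (tube_add_vE1 hz), hnu]
  have hc := fun I t => exists_isFourierExpansion ((hp I).hol t) fun z hz => by rw [hper I z hz]
  choose A hA using hc
  -- only finitely many coefficients are nonzero
  have hd := fun I => (hp I).degree_le
  choose d hd using hd
  refine ⟨fun m q I => ∑ t ∈ (Finsupp.finite_of_degree_le (σ := LIdx l) (d I)).toFinset,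
    MvPolynomial.monomial t (A I t m q), p, hp, fun I t z hz => ?_⟩
  classical
  simp only [MvPolynomial.coeff_sum, MvPolynomial.coeff_monomial, Finset.sum_ite_eq']
  split_ifs with h
  · exact hA I t z hz
  · have : (p z I).coeff t = 0 := by
      refine MvPolynomial.notMem_support_iff.mp fun hmem => h ?_
      simp only [Set.Finite.mem_toFinset, Set.mem_ofPred_eq]
      exact (MvPolynomial.le_totalDegree hmem).trans (hd I z hz)
    simp [this]

/-- A Fourier–Jacobi expansion of `F` gives one of its constant term. -/
lemma IsFJExpansion.tensorExpansion {f : (LIdx l → ℂ) → Tensor l s}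
    (hP : IsFJExpansion N r F P) (hf : IsCt N r F f) :
    IsTensorExpansion N f (fun m q I => (P m q I).coeff 0) := by
  obtain ⟨p, hp, hpP⟩ := hP
  obtain ⟨p', hp', hf⟩ := hf
  intro I z hz
  have heq := nu_expansion_unique N r (hp I).holPoly (hp' I).holPoly fun z hz => by
    rw [← (hp I).eq z hz, (hp' I).eq z hz]
  simp only [hf z hz I, ← heq z hz]
  exact hpP I 0 z hz

end FJExpansion

/-! ### The Jacobi group inside `O⁺(M)` -/

section GroupAction

variable {l : ℕ} (N : EvenLattice l) (r : ℕ)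

open JacobiGroup

lemma pair_gramM {K : Type*} [CommRing K] (Z W : MIdx l → K) :
    pair (gramM N r) Z W = Z (Sum.inl ()) * W iF + Z iF * W (Sum.inl ())
      + r * pair (gramL N) (fun a => Z (iL a)) (fun a => W (iL a)) := by
  have h : ∀ (f : MIdx l → K), ∑ i, f i = f (Sum.inl ()) + (∑ a, f (iL a) + f iF) := fun f => by
    simp [Fintype.sum_sum_type]
  simp only [pair, dotProduct, Matrix.mulVec, Matrix.map_apply]
  rw [h]
  simp only [h, gramM, Matrix.of_apply, mvec, Sum.elim_inl, Sum.elim_inr]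
  simp only [Pi.zero_apply, Int.cast_zero, zero_mul, Finset.sum_const_zero, Int.cast_one, one_mul,
    Int.cast_mul, Int.cast_natCast, zero_add, add_zero, mul_assoc, ← Finset.mul_sum,
    mul_left_comm _ (r : K)]
  ring

lemma complexify_single {ι : Type*} [DecidableEq ι] (j : ι) :
    complexify (Pi.single j 1) = Pi.single j 1 := by
  funext i; simp only [complexify, Pi.single_apply]; split_ifs <;> simp

lemma ofReal_pair {ι : Type*} [Fintype ι] (G : Matrix ι ι ℤ) (x y : ι → ℝ) :
    ((pair G x y : ℝ) : ℂ) = pair G (complexify x) (complexify y) := by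
  simp [pair, dotProduct, Matrix.mulVec, complexify]

lemma pair_eq_sum_single {ι K : Type*} [Fintype ι] [DecidableEq ι] [CommRing K]
    (G : Matrix ι ι ℤ) (x y : ι → K) :
    pair G x y = ∑ j, pair G x (Pi.single j 1) * y j := by
  simp only [pair, Matrix.mulVec_single_one, Matrix.dotProduct_mulVec]
  rfl

lemma heis_mulVec (x y : Fin l → ℝ) (κ : ℝ) (Z : MIdx l → ℂ) :
    ((heisMatrix N r x y κ).map Complex.ofReal).mulVec Z =
      mvec (Z (Sum.inl ()) + r * pair N.gram (complexify y) (fun i => Z (iL (iN i)))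
          + (r / 2 * pair N.gram (complexify x) (complexify y) - r * κ) * Z (iL iF1)
          + r / 2 * pair N.gram (complexify y) (complexify y) * Z iF)
        (lvec (Z (iL iE1) + pair N.gram (complexify x) (fun i => Z (iL (iN i)))
          + 1 / 2 * pair N.gram (complexify x) (complexify x) * Z (iL iF1)
          + (1 / 2 * pair N.gram (complexify x) (complexify y) + κ) * Z iF)
          (fun i => Z (iL (iN i)) + x i * Z (iL iF1) + y i * Z iF) (Z (iL iF1))) (Z iF) := by
  funext i
  rw [Matrix.mulVec, dotProduct, sum_MIdx]
  rcases i with _ | (_ | i | _) | _ <;>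
    simp [heisMatrix, mvec, lvec, Pi.single_apply, apply_ite Complex.ofReal, ite_mul, ofReal_pair,
      complexify_single, mul_assoc, ← Finset.mul_sum, ← pair_eq_sum_single] <;> ring

lemma sl_mulVec (A : SL(2, ℝ)) (Z : MIdx l → ℂ) :
    ((slMatrix (l := l) r A).map Complex.ofReal).mulVec Z =
      mvec (A 0 0 * Z (Sum.inl ()) - r * A 0 1 * Z (iL iE1))
        (lvec (-(A 1 0 / r) * Z (Sum.inl ()) + A 1 1 * Z (iL iE1))
          (fun i => Z (iL (iN i))) (A 0 0 * Z (iL iF1) + A 0 1 * Z iF))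
        (A 1 0 * Z (iL iF1) + A 1 1 * Z iF) := by
  funext i
  rw [Matrix.mulVec, dotProduct, sum_MIdx]
  rcases i with _ | (_ | i | _) | _ <;>
    simp [slMatrix, mvec, lvec, Pi.single_apply, apply_ite Complex.ofReal, ite_mul] <;> ring

/-- The matrix of an element of the real Jacobi group acting on `M_ℂ`. -/
noncomputable def toMC (γ : JacobiGroup N) : Matrix (MIdx l) (MIdx l) ℂ :=
  (toMatrix r γ).map Complex.ofReal

lemma toMC_mulVec (γ : JacobiGroup N) (Z : MIdx l → ℂ) :
    (toMC N r γ).mulVec Z = ((slMatrix (l := l) r γ.A).map Complex.ofReal).mulVec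
      (((heisMatrix N r γ.x γ.y γ.κ).map Complex.ofReal).mulVec Z) := by
  rw [Matrix.mulVec_mulVec, toMC, toMatrix]
  congr 1
  exact Matrix.map_mul (f := Complex.ofRealHom)

lemma toMC_mulVec_star (γ : JacobiGroup N) (Z : MIdx l → ℂ) :
    (toMC N r γ).mulVec (star Z) = star ((toMC N r γ).mulVec Z) := by
  funext i
  simp [Matrix.mulVec, dotProduct, toMC]

variable [NeZero r]

/-- The real Jacobi group acts by isometries of `M_ℂ`. -/
lemma pair_gramM_toMC (γ : JacobiGroup N) (Z W : MIdx l → ℂ) :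
    pair (gramM N r) ((toMC N r γ).mulVec Z) ((toMC N r γ).mulVec W) =
      pair (gramM N r) Z W := by
  have hr : (r : ℂ) ≠ 0 := Nat.cast_ne_zero.mpr (NeZero.ne r)
  have hd : (γ.A 0 0 * γ.A 1 1 - γ.A 0 1 * γ.A 1 0 : ℂ) = 1 := by exact_mod_cast det_eq γ.A
  have h1 : ∀ Z W : MIdx l → ℂ,
      pair (gramM N r) (((slMatrix (l := l) r γ.A).map Complex.ofReal).mulVec Z)
        (((slMatrix (l := l) r γ.A).map Complex.ofReal).mulVec W) = pair (gramM N r) Z W := by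
    intro Z W
    rw [sl_mulVec, sl_mulVec, pair_gramM, pair_gramM, pair_gramL, pair_gramL]
    simp only [mvec, lvec, Sum.elim_inl, Sum.elim_inr]
    field_simp
    linear_combination (Z (Sum.inl ()) * W iF + Z iF * W (Sum.inl ())
      + r * (Z (iL iE1) * W (iL iF1) + Z (iL iF1) * W (iL iE1))) * hd
  rw [toMC_mulVec, toMC_mulVec, h1, heis_mulVec, heis_mulVec, pair_gramM, pair_gramM, pair_gramL,
    pair_gramL]
  simp only [mvec, lvec, Sum.elim_inl, Sum.elim_inr]
  have hv : ∀ Z : MIdx l → ℂ, (fun i => Z (iL (iN i)) + (γ.x i : ℂ) * Z (iL iF1)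
      + (γ.y i : ℂ) * Z iF) = (fun i => Z (iL (iN i))) + Z (iL iF1) • complexify γ.x
        + Z iF • complexify γ.y := fun Z => by
    funext i; simp [complexify, mul_comm]
  simp only [hv, pair_add_left, pair_add_right, pair_smul_left, pair_smul_right]
  have c1 := pair_comm N (complexify γ.x) (fun i => Z (iL (iN i)))
  have c2 := pair_comm N (complexify γ.y) (fun i => Z (iL (iN i)))
  have c5 := pair_comm N (complexify γ.y) (complexify γ.x)
  rw [c1, c2, c5]
  ring

lemma toMC_mem_affCone (γ : JacobiGroup N) (Z : MIdx l → ℂ) :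
    (toMC N r γ).mulVec Z ∈ affCone N r ↔ Z ∈ affCone N r := by
  have h : (((toMC N r γ).mulVec Z (iL iF1)) * star ((toMC N r γ).mulVec Z iF)).im =
      (Z (iL iF1) * star (Z iF)).im := by
    rw [toMC_mulVec, sl_mulVec, heis_mulVec]
    simp only [mvec, lvec, Sum.elim_inl, Sum.elim_inr]
    have hd := det_eq γ.A
    simp
    linear_combination ((Z (iL iF1)).im * (Z iF).re - (Z (iL iF1)).re * (Z iF).im) * hd
  simp only [affCone, Set.mem_ofPred_eq, h]
  rw [← toMC_mulVec_star, pair_gramM_toMC, pair_gramM_toMC]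

lemma toC_eq_toMC {g : GL (MIdx l) ℤ} {γ : JacobiGroup N}
    (h : Matrix.GeneralLinearGroup.map (Int.castRingHom ℝ) g = toGL N r γ) :
    toC g = toMC N r γ := by
  have h1 := congrArg (fun u : GL (MIdx l) ℝ => (u : Matrix (MIdx l) (MIdx l) ℝ)) h
  simp only [coe_toGL] at h1
  rw [toMC, ← h1]
  ext i j
  simp [toC]

lemma mem_jacobiPart {Γ : Subgroup (GL (MIdx l) ℤ)} {γ : JacobiGroup N} :
    γ ∈ jacobiPart N r Γ ↔
      ∃ g ∈ Γ, Matrix.GeneralLinearGroup.map (Int.castRingHom ℝ) g = toGL N r γ := by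
  simp [jacobiPart, Subgroup.mem_map]

/-- A real matrix with integral entries. -/
def IsIntegralMatrix {ι : Type*} (A : Matrix ι ι ℝ) : Prop :=
  ∀ i j, A i j ∈ (Int.castRingHom ℝ).range

lemma IsIntegralMatrix.mul {ι : Type*} [Fintype ι] {A B : Matrix ι ι ℝ} (hA : IsIntegralMatrix A)
    (hB : IsIntegralMatrix B) : IsIntegralMatrix (A * B) := fun i j => by
  rw [Matrix.mul_apply]
  exact sum_mem fun k _ => mul_mem (hA i k) (hB k j)

/-- An element of the real Jacobi group lies in `O⁺(M)` if and only if it and its inverse have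
integral matrices: it preserves the form and the affine cone in any case. -/
lemma mem_jacobiPart_OPlus_iff {γ : JacobiGroup N} :
    γ ∈ jacobiPart N r (OPlus N r) ↔
      IsIntegralMatrix (toMatrix r γ) ∧ IsIntegralMatrix (toMatrix r γ⁻¹) := by
  rw [mem_jacobiPart]
  constructor
  · rintro ⟨g, -, hg⟩
    have key : ∀ (g : GL (MIdx l) ℤ) (γ : JacobiGroup N),
        Matrix.GeneralLinearGroup.map (Int.castRingHom ℝ) g = toGL N r γ →
        IsIntegralMatrix (toMatrix r γ) := fun g γ hg i j => by
      rw [← coe_toGL, ← hg]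
      exact ⟨(g : Matrix (MIdx l) (MIdx l) ℤ) i j, rfl⟩
    exact ⟨key g γ hg, key g⁻¹ γ⁻¹ (by rw [map_inv, map_inv, hg])⟩
  · rintro ⟨h1, h2⟩
    choose A hA using h1
    choose B hB using h2
    have hA' : (Matrix.of A).map (Int.castRingHom ℝ) = toMatrix r γ := by ext i j; exact hA i j
    have hB' : (Matrix.of B).map (Int.castRingHom ℝ) = toMatrix r γ⁻¹ := by ext i j; exact hB i j
    have hinj : Function.Injective
        (fun A : Matrix (MIdx l) (MIdx l) ℤ => A.map (Int.castRingHom ℝ)) :=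
      Matrix.map_injective (Int.cast_injective (α := ℝ))
    have hmul : ∀ γ δ : JacobiGroup N, toMatrix r γ * toMatrix r δ = toMatrix r (γ * δ) :=
      fun γ δ => by
        rw [← coe_toGL, ← coe_toGL, ← coe_toGL, map_mul]; rfl
    have hone : toMatrix r (1 : JacobiGroup N) = 1 := by
      rw [← coe_toGL, map_one]; rfl
    have hAB : Matrix.of A * Matrix.of B = 1 := hinj (by
      simp only [Matrix.map_mul, hA', hB', hmul, mul_inv_cancel, hone]
      simp)
    have hBA : Matrix.of B * Matrix.of A = 1 := hinj (by
      simp only [Matrix.map_mul, hA', hB', hmul, inv_mul_cancel, hone]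
      simp)
    set g : GL (MIdx l) ℤ := ⟨Matrix.of A, Matrix.of B, hAB, hBA⟩ with hg
    have hgγ : Matrix.GeneralLinearGroup.map (Int.castRingHom ℝ) g = toGL N r γ := by
      apply Units.ext
      rw [coe_toGL, ← hA']
      rfl
    have hc := toC_eq_toMC N r hgγ
    refine ⟨g, ⟨fun x y => ?_, fun Z => ?_⟩, hgγ⟩
    · have h3 := pair_gramM_toMC N r γ (fun i => (x i : ℂ)) (fun i => (y i : ℂ))
      rw [← hc] at h3
      have hcast : ∀ x y : MIdx l → ℤ, pair (gramM N r) (fun i => (x i : ℂ)) (fun i => (y i : ℂ)) =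
          ((pair (gramM N r) x y : ℤ) : ℂ) := fun x y => by
        simp [pair, dotProduct, Matrix.mulVec]
      have hv : ∀ x : MIdx l → ℤ, (toC g).mulVec (fun i => (x i : ℂ)) =
          fun i => (((g : Matrix (MIdx l) (MIdx l) ℤ).mulVec x i : ℤ) : ℂ) := fun x => by
        funext i
        simp [toC, Matrix.mulVec, dotProduct]
      rw [hv, hv, hcast, hcast] at h3
      exact_mod_cast h3
    · rw [hc]; exact toMC_mem_affCone N r γ Z

lemma isIntegral_of_mem_gammaZeroHeis {γ : JacobiGroup N} (hγ : γ ∈ gammaZeroHeis N r) :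
    IsIntegralMatrix (toMatrix r γ) := by
  obtain ⟨⟨A, hA, hγA⟩, x, y, n, hx, hy, hn⟩ := hγ
  have hr : (r : ℝ) ≠ 0 := Nat.cast_ne_zero.mpr (NeZero.ne r)
  have hA' : ∀ i j, γ.A i j = (A i j : ℤ) := fun i j => by simp [hγA]
  obtain ⟨c, hc⟩ : (r : ℤ) ∣ A 1 0 := by
    rw [← ZMod.intCast_zmod_eq_zero_iff_dvd]
    exact CongruenceSubgroup.Gamma0_mem.mp hA
  have hint : ∀ n : ℤ, (n : ℝ) ∈ (Int.castRingHom ℝ).range := fun n => ⟨n, rfl⟩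
  have hnat : (r : ℝ) ∈ (Int.castRingHom ℝ).range := ⟨r, by simp⟩
  have hnorm : ∀ u : Fin l → ℤ, 1 / 2 * pair N.gram (fun i => (u i : ℝ)) (fun i => (u i : ℝ)) ∈
      (Int.castRingHom ℝ).range := fun u => by
    obtain ⟨k, hk⟩ := N.even u
    rw [pair_intCast, hk]
    exact ⟨k, by simp; ring⟩
  have hsingle : ∀ (u : Fin l → ℤ) j, pair N.gram (fun i => (u i : ℝ)) (Pi.single j 1) ∈
      (Int.castRingHom ℝ).range := fun u j => by
    have : (Pi.single j 1 : Fin l → ℝ) = fun i => ((Pi.single j 1 : Fin l → ℤ) i : ℝ) := by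
      funext i; simp only [Pi.single_apply]; split_ifs <;> simp
    rw [this, pair_intCast]
    exact hint _
  rw [toMatrix]
  refine IsIntegralMatrix.mul ?_ ?_
  · intro i j
    rcases i with _ | (_ | i | _) | _ <;> rcases j with _ | (_ | j | _) | _ <;>
      simp only [slMatrix, mvec, lvec, Matrix.of_apply, Sum.elim_inl, Sum.elim_inr, hA',
        Pi.zero_apply, Pi.single_apply]
    any_goals exact hint _
    any_goals exact zero_mem _
    · exact neg_mem (mul_mem hnat (hint _))
    · rw [hc]
      refine ⟨-c, ?_⟩
      push_cast
      field_simp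
      simp
    · split_ifs
      · exact one_mem _
      · exact zero_mem _
  · rw [hx, hy] at hn ⊢
    have hκ : γ.κ = n - 1 / 2 * (pair N.gram x y : ℤ) := by
      rw [← pair_intCast]; linarith
    intro i j
    rcases i with _ | (_ | i | _) | _ <;> rcases j with _ | (_ | j | _) | _ <;>
      simp only [heisMatrix, mvec, lvec, Matrix.of_apply, Sum.elim_inl, Sum.elim_inr,
        Pi.zero_apply, Pi.single_apply]
    any_goals exact hint _
    any_goals exact zero_mem _
    any_goals exact one_mem _
    any_goals exact hsingle _ _
    any_goals exact hnorm _
    · exact mul_mem hnat (hsingle _ _)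
    · rw [hκ, pair_intCast]
      exact ⟨r * (pair N.gram x y - n), by simp; ring⟩
    · rw [div_mul_eq_mul_div, mul_div_assoc, div_eq_inv_mul, ← one_div]
      exact mul_mem hnat (hnorm _)
    · rw [hκ, pair_intCast]
      exact ⟨n, by simp⟩
    · split_ifs
      · exact one_mem _
      · exact zero_mem _

/-- The Jacobi part of `O⁺(M)`. The entries at which the Heisenberg part acts trivially show that
the `SL₂` part is in `Γ₀(r)`; division by it leaves an integral Heisenberg matrix. -/
theorem jacobiPart_OPlus : jacobiPart N r (OPlus N r) = gammaZeroHeis N r := by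
  have hr : (r : ℝ) ≠ 0 := Nat.cast_ne_zero.mpr (NeZero.ne r)
  ext γ
  rw [mem_jacobiPart_OPlus_iff]
  refine ⟨fun ⟨h, _⟩ => ?_, fun h => ⟨isIntegral_of_mem_gammaZeroHeis N r h,
    isIntegral_of_mem_gammaZeroHeis N r (inv_mem h)⟩⟩
  have hentry : ∀ i j, toMatrix r γ i j = ∑ k, slMatrix r γ.A i k *
      heisMatrix N r γ.x γ.y γ.κ k j := fun i j => by
    rw [toMatrix, Matrix.mul_apply]
  obtain ⟨a, ha⟩ := h (Sum.inl ()) (Sum.inl ())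
  obtain ⟨c', hc'⟩ := h (iL iE1) (Sum.inl ())
  obtain ⟨b, hb⟩ := h (iL iF1) iF
  obtain ⟨d, hd⟩ := h iF iF
  have hx := fun i => h (iL (iN i)) (iL iF1)
  have hy := fun i => h (iL (iN i)) iF
  choose x hx using hx
  choose y hy using hy
  simp only [hentry, sum_MIdx] at ha hc' hb hd hx hy
  simp [slMatrix, heisMatrix, mvec, lvec, Pi.single_apply] at ha hc' hb hd hx hy
  have hc : γ.A 1 0 = ((-(r : ℤ) * c' : ℤ) : ℝ) := by
    push_cast; rw [hc']; field_simp
  have hdet := det_eq γ.A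
  rw [← ha, ← hb, ← hd, hc] at hdet
  set A : SL(2, ℤ) := ⟨!![a, b; -(r : ℤ) * c', d], by
    rw [Matrix.det_fin_two_of]; exact_mod_cast hdet⟩ with hA
  have hγA : γ.A = Matrix.SpecialLinearGroup.map (Int.castRingHom ℝ) A := by
    ext i j
    fin_cases i <;> fin_cases j
    · exact ha.symm
    · exact hb.symm
    · exact hc
    · exact hd.symm
  have hA0 : A ∈ CongruenceSubgroup.Gamma0 r := by
    rw [CongruenceSubgroup.Gamma0_mem]
    simp [hA]
  refine ⟨⟨A, hA0, hγA⟩, x, y, ?_⟩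
  -- the Heisenberg part is integral since the `SL₂` part and its inverse are
  have hinv : IsIntegralMatrix (heisMatrix N r γ.x γ.y γ.κ) := by
    have h0 : (⟨γ.A⁻¹, 0, 0, 0⟩ : JacobiGroup N) ∈ gammaZeroHeis N r :=
      ⟨⟨A⁻¹, inv_mem hA0, by simp [hγA]⟩, 0, 0, 0, by ext i; simp, by ext i; simp, by simp [pair]⟩
    have h1 := (isIntegral_of_mem_gammaZeroHeis N r h0).mul h
    simp only [toMatrix, heisMatrix_zero, mul_one] at h1
    rwa [← Matrix.mul_assoc, ← slMatrix_mul, inv_mul_cancel, slMatrix_one, one_mul] at h1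
  obtain ⟨n, hn⟩ := hinv (iL iE1) iF
  simp [heisMatrix, mvec, lvec] at hn
  exact ⟨n, by ext i; exact (hx i).symm, by ext i; exact (hy i).symm, by rw [hn]; ring⟩

lemma gammaZeroHeis_le : gammaZeroHeis N r ≤ gammaZeroHeis N 1 := by
  rintro γ ⟨⟨A, -, hA⟩, h⟩
  refine ⟨⟨A, ?_, hA⟩, h⟩
  rw [CongruenceSubgroup.Gamma0_mem]
  exact Subsingleton.elim _ _

lemma jacobiPart_mono {Γ Γ' : Subgroup (GL (MIdx l) ℤ)} (h : Γ ≤ Γ') :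
    jacobiPart N r Γ ≤ jacobiPart N r Γ' :=
  Subgroup.comap_mono (Subgroup.map_mono h)

/-- The projection of the real Jacobi group to `SL₂(ℝ)`. -/
def projSL : JacobiGroup N →* SL(2, ℝ) where
  toFun γ := γ.A
  map_one' := rfl
  map_mul' _ _ := rfl

lemma relIndex_gammaZeroHeis_ne_zero :
    (gammaZeroHeis N r).relIndex (gammaZeroHeis N 1) ≠ 0 := by
  set φ := Matrix.SpecialLinearGroup.map (n := Fin 2) (Int.castRingHom ℝ) with hφ
  have hle : ((CongruenceSubgroup.Gamma0 r).map φ).comap (projSL N) ⊓ gammaZeroHeis N 1 ≤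
      gammaZeroHeis N r := by
    rintro γ ⟨⟨A, hA, hAγ⟩, -, h⟩
    exact ⟨⟨A, hA, hAγ.symm⟩, h⟩
  have h1 : ((CongruenceSubgroup.Gamma0 r).map φ).relIndex φ.range ≠ 0 := by
    have h2 : ((CongruenceSubgroup.Gamma0 r).map φ).relIndex ((⊤ : Subgroup SL(2, ℤ)).map φ) ≠ 0 := by
      rw [Subgroup.relIndex_map_map_of_injective]
      · rw [Subgroup.relIndex_top_right]
        exact (inferInstance : (CongruenceSubgroup.Gamma0 r).FiniteIndex).index_ne_zero
      · intro A B h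
        ext i j
        have h4 := congrArg (fun u : SL(2, ℝ) => u i j) h
        exact Int.cast_injective (α := ℝ) h4
    rwa [← MonoidHom.range_eq_map] at h2
  have h3 : (((CongruenceSubgroup.Gamma0 r).map φ).comap (projSL N)).relIndex
      (gammaZeroHeis N 1) ≠ 0 := by
    rw [Subgroup.relIndex_comap]
    refine mt (Subgroup.relIndex_eq_zero_of_le_right ?_) h1
    rintro _ ⟨γ, ⟨⟨A, -, hA⟩, -⟩, rfl⟩
    exact ⟨A, hA.symm⟩
  rw [← Subgroup.inf_relIndex_right] at h3
  exact mt (Subgroup.relIndex_eq_zero_of_le_left hle) h3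

/-- Finite index is inherited by the intersections with the Jacobi group. -/
lemma relIndex_jacobiPart_ne_zero {Γ : Subgroup (GL (MIdx l) ℤ)}
    (hfin : Γ.relIndex (OPlus N r) ≠ 0) :
    (jacobiPart N r Γ).relIndex (gammaZeroHeis N 1) ≠ 0 := by
  have hinj : Function.Injective
      (Matrix.GeneralLinearGroup.map (n := MIdx l) (Int.castRingHom ℝ)) := by
    intro g g' h
    apply Units.ext
    have h1 := congrArg (fun u : GL (MIdx l) ℝ => (u : Matrix (MIdx l) (MIdx l) ℝ)) h
    exact Matrix.map_injective (Int.cast_injective (α := ℝ)) h1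
  have h1 : (jacobiPart N r Γ).relIndex (jacobiPart N r (OPlus N r)) ≠ 0 := by
    rw [jacobiPart, Subgroup.relIndex_comap]
    rw [← Subgroup.relIndex_map_map_of_injective _ _ hinj] at hfin
    exact mt (Subgroup.relIndex_eq_zero_of_le_right (by
      rintro _ ⟨γ, hγ, rfl⟩
      exact hγ)) hfin
  rw [jacobiPart_OPlus] at h1
  exact Subgroup.relIndex_ne_zero_trans h1 (relIndex_gammaZeroHeis_ne_zero N r)

lemma exp_of_pow_three {K ι : Type*} [RCLike K] [Fintype ι] [DecidableEq ι] {A : Matrix ι ι K}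
    (hA : A ^ 3 = 0) : NormedSpace.exp A = 1 + A + (1 / 2 : K) • A ^ 2 := by
  rw [NormedSpace.exp_eq_tsum K]
  simp only []
  rw [tsum_eq_sum (s := Finset.range 3)]
  · simp [Finset.sum_range_succ]
  · intro n hn
    have : 3 ≤ n := by simpa using hn
    rw [pow_eq_zero_of_le this hA, smul_zero]

/-- The transvection `exp(e₁ ∧ e)` is the Heisenberg element `[0, 0; 1]`. -/
lemma exp_eichler_eq : NormedSpace.exp (eichler (gramM N r) (mvec 0 vE1 0) (mvec 1 0 0) :
    Matrix (MIdx l) (MIdx l) ℝ) = toMatrix (N := N) r ⟨1, 0, 0, 1⟩ := by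
  have hE : (eichler (gramM N r) (mvec 0 vE1 0) (mvec 1 0 0) : Matrix (MIdx l) (MIdx l) ℝ) =
      heisMatrix N r 0 0 1 - 1 := by
    ext i j
    simp only [eichler, Matrix.of_apply, pair_gramM, pair_gramL, Matrix.sub_apply]
    rcases i with _ | (_ | i | _) | _ <;> rcases j with _ | (_ | j | _) | _ <;>
      simp [heisMatrix, mvec, lvec, vE1, Matrix.one_apply, Pi.single_apply, pair, eq_comm]
  have hsq : (heisMatrix N r 0 0 1 - 1) ^ 2 = 0 := by
    have h1 := heisMatrix_mul (N := N) r 0 0 0 0 1 1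
    have h2 : heisMatrix N r (0 + 0) (0 + 0) (1 + 1 + 1 / 2 * (pair N.gram 0 0 - pair N.gram 0 0))
        = 2 • heisMatrix N r 0 0 1 - 1 := by
      ext i j
      simp only [Matrix.sub_apply, Matrix.smul_apply]
      rcases i with _ | (_ | i | _) | _ <;> rcases j with _ | (_ | j | _) | _ <;>
        simp [heisMatrix, mvec, lvec, Matrix.one_apply, Pi.single_apply, pair, eq_comm] <;>
        (try split_ifs) <;> norm_num <;> ring
    rw [h2] at h1
    rw [sq, sub_mul, mul_sub, h1]
    simp only [mul_one, one_mul, two_smul]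
    abel
  rw [hE, exp_of_pow_three (by rw [pow_succ, hsq, zero_mul]), hsq, toMatrix, slMatrix_one]
  simp

end GroupAction

/-! ### Transvections -/

section Twist

variable {l : ℕ} (N : EvenLattice l)

/-- The vector `exp(α ∧ e₁) v` of `L_ℂ`. -/
noncomputable def twVec (α : Fin l → ℂ) (v : LIdx l → ℂ) : LIdx l → ℂ :=
  lvec (v iE1 + pair N.gram α (fun i => v (iN i)) + 1 / 2 * pair N.gram α α * v iF1)
    (fun i => v (iN i) + v iF1 * α i) (v iF1)

lemma twVec_add (α β : Fin l → ℂ) (v : LIdx l → ℂ) :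
    twVec N (α + β) v = twVec N α (twVec N β v) := by
  have h : (fun i => v (iN i) + v iF1 * β i) = (fun i => v (iN i)) + v iF1 • β := rfl
  funext a
  rcases a with _ | i | _ <;> simp only [twVec, lvec, Sum.elim_inl, Sum.elim_inr, Pi.add_apply]
  · rw [h]
    simp only [pair_add_left, pair_add_right, pair_smul_right, pair_comm N β α]
    ring
  · ring

lemma pair_zero_left {ι K : Type*} [Fintype ι] [CommRing K] (G : Matrix ι ι ℤ) (x : ι → K) :
    pair G 0 x = 0 := by simp [pair]

lemma pair_zero_right {ι K : Type*} [Fintype ι] [CommRing K] (G : Matrix ι ι ℤ) (x : ι → K) :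
    pair G x 0 = 0 := by simp [pair]

lemma twVec_zero (v : LIdx l → ℂ) : twVec N 0 v = v := by
  funext a
  rcases a with _ | i | _ <;> simp [twVec, lvec, pair_zero_left]

lemma eichler_mulVec (α : Fin l → ℂ) (v : LIdx l → ℂ) :
    (eichler (gramL N) (lvec 0 α 0) vE1).mulVec v =
      lvec (pair N.gram α (fun i => v (iN i))) (v iF1 • α) 0 := by
  have h : (eichler (gramL N) (lvec 0 α 0) vE1).mulVec v =
      fun i => pair (gramL N) vE1 v * (lvec 0 α 0 : LIdx l → ℂ) i
        - pair (gramL N) (lvec 0 α 0) v * (vE1 : LIdx l → ℂ) i := by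
    funext i
    simp only [eichler, Matrix.mulVec, dotProduct, Matrix.of_apply]
    rw [pair_eq_sum_single _ vE1 v, pair_eq_sum_single _ (lvec 0 α 0) v, Finset.sum_mul,
      Finset.sum_mul, ← Finset.sum_sub_distrib]
    exact Finset.sum_congr rfl fun j _ => by ring
  rw [h]
  funext a
  rcases a with _ | i | _ <;> simp [pair_gramL, lvec, vE1, ← Pi.zero_def, pair_zero_left]

/-- The exponential series of `α ∧ e₁` has three terms. -/
lemma exp_eichler_mulVec (α : Fin l → ℂ) (v : LIdx l → ℂ) :
    (NormedSpace.exp (eichler (gramL N) (lvec 0 α 0) vE1)).mulVec v = twVec N α v := by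
  set E := eichler (gramL N) (lvec 0 α 0) vE1 with hE
  have h3 : E ^ 3 = 0 := by
    apply Matrix.toLin'.injective
    refine LinearMap.ext fun v => ?_
    rw [Matrix.toLin'_apply, pow_succ, pow_two, ← Matrix.mulVec_mulVec, ← Matrix.mulVec_mulVec,
      hE, eichler_mulVec, eichler_mulVec, eichler_mulVec]
    funext a
    rcases a with _ | i | _ <;> simp [lvec, ← Pi.zero_def, pair_zero_right]
  rw [exp_of_pow_three h3, Matrix.add_mulVec, Matrix.add_mulVec, Matrix.smul_mulVec, pow_two,
    ← Matrix.mulVec_mulVec, Matrix.one_mulVec, hE, eichler_mulVec, eichler_mulVec]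
  funext a
  rcases a with _ | i | _ <;> simp [lvec, twVec]
  · have : (fun i => v iF1 * α i) = v iF1 • α := rfl
    rw [this, pair_smul_right]; ring

lemma twist_mulVec (q : (Fin l → ℂ) × ℂ) (v : LIdx l → ℂ) :
    (twist N q).mulVec v = twVec N (fun i => jacobiVars q (some i)) v :=
  exp_eichler_mulVec N _ v

/-- The image of `v` under the torus element which multiplies `e₁` by `J` and `f₁` by `J⁻¹`. -/
noncomputable def scaleVec (J : ℂ) (v : LIdx l → ℂ) : LIdx l → ℂ :=
  lvec (J * v iE1) (fun i => v (iN i)) (J⁻¹ * v iF1)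

lemma scaleVec_twVec {J : ℂ} (hJ : J ≠ 0) (α : Fin l → ℂ) (v : LIdx l → ℂ) :
    scaleVec J (twVec N α v) = twVec N (J • α) (scaleVec J v) := by
  funext a
  rcases a with _ | i | _ <;>
    simp only [twVec, scaleVec, lvec, Sum.elim_inl, Sum.elim_inr, pair_smul_left, pair_smul_right,
      Pi.smul_apply, smul_eq_mul] <;> field_simp

lemma twVec_smul (α : Fin l → ℂ) (c : ℂ) (v : LIdx l → ℂ) :
    twVec N α (c • v) = c • twVec N α v := by
  funext a
  have : (fun i => c * v (iN i)) = c • fun i => v (iN i) := rfl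
  rcases a with _ | i | _ <;> simp [twVec, lvec, this, pair_smul_right] <;> ring

end Twist

/-! ### The action of the Jacobi group on `N_ℂ × ℍ` -/

section Cocycle

variable {l : ℕ} {N : EvenLattice l}

namespace JacobiGroup

/-- The factor `cτ + d`. -/
noncomputable def factor (γ : JacobiGroup N) (q : (Fin l → ℂ) × ℂ) : ℂ :=
  γ.A 1 0 * q.2 + γ.A 1 1

/-- The vector `w = 𝔷 + xτ + y`. -/
noncomputable def shift (γ : JacobiGroup N) (q : (Fin l → ℂ) × ℂ) : Fin l → ℂ :=
  q.1 + q.2 • complexify γ.x + complexify γ.y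

/-- The action of the Jacobi group on `N_ℂ × ℍ`. -/
noncomputable def actPt (γ : JacobiGroup N) (q : (Fin l → ℂ) × ℂ) : (Fin l → ℂ) × ℂ :=
  ((γ.factor q)⁻¹ • γ.shift q, (γ.A 0 0 * q.2 + γ.A 0 1) / γ.factor q)

/-- The exponent of the Jacobi slash operator: `γ` maps `(ω, 𝔷, τ)` to a point with first
coordinate `ω + S(𝔷, τ)`. -/
noncomputable def expo (γ : JacobiGroup N) (q : (Fin l → ℂ) × ℂ) : ℂ :=
  -(1 / 2) * (γ.A 1 0 * pair N.gram (γ.shift q) (γ.shift q)) / γ.factor q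
    + 1 / 2 * pair N.gram (complexify γ.x) (complexify γ.x) * q.2
    + pair N.gram (complexify γ.x) q.1
    + 1 / 2 * pair N.gram (complexify γ.x) (complexify γ.y) + γ.κ

/-- The derivative of the action of `γ` on the tube domain, multiplied by the factor `cτ + d`. -/
noncomputable def deriv (γ : JacobiGroup N) (q : (Fin l → ℂ) × ℂ) (V : LIdx l → ℂ) : LIdx l → ℂ :=
  scaleVec (γ.factor q) (twVec N (complexify γ.x -
    (((γ.A 1 0 : ℝ) : ℂ) / γ.factor q) • γ.shift q) V)

end JacobiGroup

lemma jacobiSlash_apply (k m : ℤ) (γ : JacobiGroup N) (Φ : (Fin l → ℂ) × ℂ → ℂ)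
    (q : (Fin l → ℂ) × ℂ) :
    jacobiSlash k m γ Φ q = Φ (γ.actPt q) * γ.factor q ^ (-k) * qexp (m * γ.expo q) := rfl

open JacobiGroup

lemma factor_ne_zero (γ : JacobiGroup N) {q : (Fin l → ℂ) × ℂ} (hq : q ∈ jacobiDomain l) :
    γ.factor q ≠ 0 := by
  intro h
  have h1 := congrArg Complex.im h
  have h2 := congrArg Complex.re h
  have hq' : q.2.im ≠ 0 := (show 0 < q.2.im from hq).ne'
  simp [factor, hq'] at h1 h2
  have := det_eq γ.A
  simp [h1] at this h2
  simp [h2] at this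

/-- The conjugate of `cτ + d`. -/
lemma factor_sub (γ : JacobiGroup N) (q : (Fin l → ℂ) × ℂ) :
    starRingEnd ℂ (γ.factor q) = γ.factor q - 2 * Complex.I * γ.A 1 0 * q.2.im := by
  apply Complex.ext <;> simp [factor]; ring

lemma im_actPt (γ : JacobiGroup N) {q : (Fin l → ℂ) × ℂ} (hq : q ∈ jacobiDomain l) :
    ((γ.actPt q).2.im : ℂ) = q.2.im / (γ.factor q * starRingEnd ℂ (γ.factor q)) := by
  have hd := det_eq γ.A
  have hJ := factor_ne_zero γ hq
  rw [Complex.mul_conj, actPt, Complex.div_im, ← Complex.ofReal_div]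
  congr 1
  rw [← sub_div]
  congr 1
  simp [factor]
  linear_combination q.2.im * hd

lemma actPt_mem (γ : JacobiGroup N) {q : (Fin l → ℂ) × ℂ} (hq : q ∈ jacobiDomain l) :
    γ.actPt q ∈ jacobiDomain l := by
  have h := im_actPt γ hq
  rw [Complex.mul_conj, ← Complex.ofReal_div] at h
  have h' := Complex.ofReal_injective h
  change 0 < (γ.actPt q).2.im
  rw [h']
  exact div_pos hq (Complex.normSq_pos.mpr (factor_ne_zero γ hq))

/-- The transformation of `1 / Im τ`. -/
lemma jacobiVars_actPt_none (γ : JacobiGroup N) {q : (Fin l → ℂ) × ℂ} (hq : q ∈ jacobiDomain l) :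
    jacobiVars (γ.actPt q) none =
      γ.factor q ^ 2 * jacobiVars q none - 2 * Complex.I * γ.A 1 0 * γ.factor q := by
  have hq' : (q.2.im : ℂ) ≠ 0 := Complex.ofReal_ne_zero.mpr (show 0 < q.2.im from hq).ne'
  simp only [jacobiVars]
  push_cast
  rw [im_actPt γ hq, factor_sub, one_div_div]
  field_simp

/-- The transformation of `α = Im 𝔷 / Im τ`. -/
lemma jacobiVars_actPt_some (γ : JacobiGroup N) {q : (Fin l → ℂ) × ℂ} (hq : q ∈ jacobiDomain l)
    (i : Fin l) : jacobiVars (γ.actPt q) (some i) =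
      γ.factor q * (jacobiVars q (some i) + γ.x i) - γ.A 1 0 * γ.shift q i := by
  have hd := det_eq γ.A
  have hJ := factor_ne_zero γ hq
  have hy : 0 < q.2.im := hq
  -- in terms of real vectors, `𝔷 = u + τ α`
  set α : ℝ := (q.1 i).im / q.2.im with hα
  set u : ℝ := (q.1 i).re - q.2.re * α with hu
  have hz : q.1 i = u + q.2 * α := by
    apply Complex.ext
    · simp [hu]
    · simp [hα]; field_simp
  have hw : γ.shift q i = (u + γ.y i : ℝ) + q.2 * (α + γ.x i : ℝ) := by
    simp [shift, complexify, hz]; ring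
  have h1 : (γ.actPt q).1 i = ((γ.A 0 0 * (u + γ.y i) - γ.A 0 1 * (α + γ.x i) : ℝ) : ℂ) +
      (γ.actPt q).2 * ((γ.A 1 1 * (α + γ.x i) - γ.A 1 0 * (u + γ.y i) : ℝ) : ℂ) := by
    simp only [actPt, Pi.smul_apply, smul_eq_mul, hw]
    have hd' : (γ.A 0 0 * γ.A 1 1 - γ.A 0 1 * γ.A 1 0 : ℂ) = 1 := by exact_mod_cast hd
    field_simp
    simp only [factor]
    push_cast
    linear_combination (-(u + γ.y i) - q.2 * (α + γ.x i) : ℂ) * hd'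
  have him : ((γ.actPt q).1 i).im = (γ.actPt q).2.im *
      (γ.A 1 1 * (α + γ.x i) - γ.A 1 0 * (u + γ.y i)) := by
    rw [h1, Complex.add_im, Complex.im_mul_ofReal, Complex.ofReal_im, zero_add]
  have hpos : 0 < (γ.actPt q).2.im := actPt_mem γ hq
  have h2 : jacobiVars (γ.actPt q) (some i) =
      ((γ.A 1 1 * (α + γ.x i) - γ.A 1 0 * (u + γ.y i) : ℝ) : ℂ) := by
    simp only [jacobiVars, him]
    congr 1
    field_simp
  have h3 : jacobiVars q (some i) = (α : ℂ) := rfl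
  rw [h2, h3, hw, factor]
  push_cast
  ring

end Cocycle

/-! ### The action of the Jacobi group on the tube domain -/

section TubeAction

variable {l : ℕ} (N : EvenLattice l) (r : ℕ) [NeZero r]

open JacobiGroup

/-- The coordinates of `γ φ̃(z)`. -/
lemma toMC_phiTilde (γ : JacobiGroup N) (z : LIdx l → ℂ) :
    (toMC N r γ).mulVec (phiTilde N r z) iF = γ.factor (zTau z) ∧
    (toMC N r γ).mulVec (phiTilde N r z) (iL iF1) = γ.A 0 0 * z iF1 + γ.A 0 1 ∧
    (∀ i, (toMC N r γ).mulVec (phiTilde N r z) (iL (iN i)) = γ.shift (zTau z) i) ∧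
    (γ.factor (zTau z) ≠ 0 → (toMC N r γ).mulVec (phiTilde N r z) (iL iE1) =
      γ.factor (zTau z) * (z iE1 + γ.expo (zTau z))) := by
  have hr : (r : ℂ) ≠ 0 := Nat.cast_ne_zero.mpr (NeZero.ne r)
  rw [toMC_mulVec, sl_mulVec, heis_mulVec]
  simp only [mvec, lvec, phiTilde, Sum.elim_inl, Sum.elim_inr]
  refine ⟨by simp [factor, zTau], by simp, fun i => by simp [shift, zTau, complexify]; ring,
    fun hJ => ?_⟩
  have h1 : γ.factor (zTau z) * (z iE1 + γ.expo (zTau z)) =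
      γ.factor (zTau z) * (z iE1
        + 1 / 2 * pair N.gram (complexify γ.x) (complexify γ.x) * z iF1
        + pair N.gram (complexify γ.x) (zTau z).1
        + 1 / 2 * pair N.gram (complexify γ.x) (complexify γ.y) + γ.κ)
        - 1 / 2 * (γ.A 1 0 * pair N.gram (γ.shift (zTau z)) (γ.shift (zTau z))) := by
    simp only [expo]
    field_simp
    simp only [zTau]
    ring
  rw [h1, pair_gramL]
  have hz : (fun i => z (iN i)) = (zTau z).1 := rfl
  have ht : z iF1 = (zTau z).2 := rfl
  simp only [shift, pair_add_left, pair_add_right, pair_smul_left, pair_smul_right, factor, hz, ht]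
  rw [pair_comm N (complexify γ.x) (zTau z).1, pair_comm N (complexify γ.y) (zTau z).1,
    pair_comm N (complexify γ.y) (complexify γ.x)]
  field_simp
  ring

lemma pair_phiTilde (z : LIdx l → ℂ) : pair (gramM N r) (phiTilde N r z) (phiTilde N r z) = 0 := by
  rw [pair_gramM]
  simp only [phiTilde, mvec, Sum.elim_inl, Sum.elim_inr]
  ring

lemma pair_gramL_star (z : LIdx l → ℂ) :
    pair (gramL N) z (star z) = 1 / 2 * pair (gramL N) z z
      + 1 / 2 * starRingEnd ℂ (pair (gramL N) z z)
      + (2 * pair (gramL N) (imVec z) (imVec z) : ℝ) := by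
  have h0 : complexify (imVec z) = (-(Complex.I / 2)) • (z + (-1 : ℂ) • star z) := by
    funext a
    apply Complex.ext <;> simp [complexify, imVec]
    ring
  have h1 : starRingEnd ℂ (pair (gramL N) z z) = pair (gramL N) (star z) (star z) := by
    simp [pair, dotProduct, Matrix.mulVec]
  rw [h1]
  push_cast
  rw [ofReal_pair, h0]
  simp only [pair_add_left, pair_add_right, pair_smul_left, pair_smul_right,
    pair_gramL_comm N (star z) z]
  linear_combination (1 / 2 * (2 * pair (gramL N) z (star z) - pair (gramL N) z z
    - pair (gramL N) (star z) (star z))) * Complex.I_sq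

lemma pair_phiTilde_star (z : LIdx l → ℂ) :
    pair (gramM N r) (phiTilde N r z) (star (phiTilde N r z)) = ((2 * imSq N r z : ℝ) : ℂ) := by
  have h : (fun a => star (phiTilde N r z) (iL a)) = star z := rfl
  rw [pair_gramM, h]
  change _ + _ + r * pair (gramL N) z (star z) = _
  rw [pair_gramL_star]
  simp only [phiTilde, mvec, Pi.star_apply, Sum.elim_inl, Sum.elim_inr, imSq]
  simp
  ring

lemma phiTilde_mem_affCone {z : LIdx l → ℂ} (hz : z ∈ tube N) : phiTilde N r z ∈ affCone N r := by
  refine ⟨pair_phiTilde N r z, ?_, ?_⟩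
  · rw [pair_phiTilde_star, Complex.ofReal_re]
    linarith [imSq_pos r hz]
  · simpa [phiTilde, mvec] using hz.2.1

/-- Every line in the affine cone meets the image of the tube domain. -/
lemma mem_tube_of_mem_affCone {Z : MIdx l → ℂ} (hZ : Z ∈ affCone N r) :
    (fun a => Z (iL a) / Z iF) ∈ tube N := by
  obtain ⟨h1, h2, h3⟩ := hZ
  have hF : Z iF ≠ 0 := fun h => by simp [h] at h3
  set u : LIdx l → ℂ := fun a => Z (iL a) / Z iF with hu
  have hL : (fun a => Z (iL a)) = Z iF • u := by
    funext a; simp [hu]; field_simp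
  have hZ : Z = Z iF • phiTilde N r u := by
    funext i
    rcases i with _ | (a | _)
    · rw [pair_gramM, hL, pair_smul_left, pair_smul_right] at h1
      simp only [phiTilde, mvec, Pi.smul_apply, Sum.elim_inl, smul_eq_mul]
      refine mul_left_cancel₀ (mul_ne_zero two_ne_zero hF) ?_
      linear_combination h1
    · exact congrFun hL a
    · simp [phiTilde, mvec]
  have hpos : 0 < Complex.normSq (Z iF) := Complex.normSq_pos.mpr hF
  have h4 : 0 < imSq N r u := by
    rw [hZ, star_smul, pair_smul_left, pair_smul_right, pair_phiTilde_star, ← mul_assoc] at h2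
    have h5 : Z iF * star (Z iF) = ((Complex.normSq (Z iF) : ℝ) : ℂ) := Complex.mul_conj _
    rw [h5, ← Complex.ofReal_mul, Complex.ofReal_re] at h2
    have := pos_of_mul_pos_right h2 hpos.le
    linarith
  have h6 : 0 < pair (gramL N) (imVec u) (imVec u) :=
    pos_of_mul_pos_right h4 (Nat.cast_nonneg r)
  have h7 : 0 < (u iF1).im := by
    have h8 : (Z (iL iF1) * star (Z iF)).im = Complex.normSq (Z iF) * (u iF1).im := by
      rw [show Z (iL iF1) = Z iF * u iF1 from congrFun hL iF1, mul_right_comm,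
        show Z iF * star (Z iF) = ((Complex.normSq (Z iF) : ℝ) : ℂ) from Complex.mul_conj _,
        Complex.im_ofReal_mul]
    rw [h8] at h3
    exact pos_of_mul_pos_right h3 hpos.le
  refine mem_tube_iff.mpr ⟨h7, ?_⟩
  change _ / (2 * (u iF1).im) < _
  rw [div_lt_iff₀ (by linarith)]
  rw [pair_gramL] at h6
  simp only [imVec] at h6
  simp only [zTau]
  linarith

variable {N r} {g : GL (MIdx l) ℤ} {γ : JacobiGroup N}

lemma autJ_eq (hg : Matrix.GeneralLinearGroup.map (Int.castRingHom ℝ) g = toGL N r γ)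
    (z : LIdx l → ℂ) : autJ N r g z = γ.factor (zTau z) := by
  rw [autJ, toC_eq_toMC N r hg]
  exact (toMC_phiTilde N r γ z).1

/-- The Jacobi group acts by translations on the coordinate `ω`. -/
lemma act_eq (hg : Matrix.GeneralLinearGroup.map (Int.castRingHom ℝ) g = toGL N r γ)
    {z : LIdx l → ℂ} (hz : zTau z ∈ jacobiDomain l) :
    act N r g z = slicePt (z iE1 + γ.expo (zTau z)) (γ.actPt (zTau z)) := by
  have hJ := factor_ne_zero γ hz
  obtain ⟨-, h1, h2, h3⟩ := toMC_phiTilde N r γ z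
  funext a
  simp only [act, autJ_eq hg, toC_eq_toMC N r hg]
  rcases a with _ | i | _
  · rw [h3 hJ]
    simp only [slicePt, lvec, Sum.elim_inl]
    field_simp
  · rw [h2]
    simp only [slicePt, lvec, Sum.elim_inr, Sum.elim_inl, actPt, Pi.smul_apply, smul_eq_mul]
    field_simp
  · rw [h1]; rfl

lemma act_mem_tube (hg : Matrix.GeneralLinearGroup.map (Int.castRingHom ℝ) g = toGL N r γ)
    {z : LIdx l → ℂ} (hz : z ∈ tube N) : act N r g z ∈ tube N := by
  have h := (toMC_mem_affCone N r γ _).mpr (phiTilde_mem_affCone N r hz)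
  have := mem_tube_of_mem_affCone N r h
  rwa [← toC_eq_toMC N r hg] at this

/-- Along a line, the coordinates of the action are quotients of this form, up to an affine
function. -/
lemma hasDerivAt_frac {J : ℂ} (hJ : J ≠ 0) (A B C K : ℂ) :
    HasDerivAt (fun t : ℂ => (A + t * B + t ^ 2 * C) / (J + t * K)) ((B * J - A * K) / J ^ 2) 0 := by
  have h1 : HasDerivAt (fun t : ℂ => A + t * B + t ^ 2 * C) B 0 := by
    have := ((((hasDerivAt_id (0 : ℂ)).mul_const B).const_add A).fun_add
      (((hasDerivAt_id (0 : ℂ)).pow 2).mul_const C))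
    simpa using this
  have h2 : HasDerivAt (fun t : ℂ => J + t * K) K 0 := by
    simpa using ((hasDerivAt_id (0 : ℂ)).mul_const K).const_add J
  convert! h1.fun_div h2 (by simpa using hJ) using 1
  simp

lemma differentiableAt_slicePt_actPt {z : LIdx l → ℂ} (hz : zTau z ∈ jacobiDomain l) :
    DifferentiableAt ℂ (fun z => slicePt (z iE1 + γ.expo (zTau z)) (γ.actPt (zTau z))) z := by
  have hJ := factor_ne_zero γ hz
  simp only [factor, zTau] at hJ
  refine differentiableAt_pi.mpr fun a => ?_
  rcases a with _ | i | _ <;>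
    simp only [slicePt, lvec, Sum.elim_inl, Sum.elim_inr, expo, actPt, factor, shift, zTau, pair,
      dotProduct, Matrix.mulVec, Pi.add_apply, Pi.smul_apply, smul_eq_mul] <;>
    fun_prop (disch := assumption)

/-- The derivative of the action of `γ` is, up to `J`, a product of a torus element and a
transvection. -/
lemma sum_autLambda (hg : Matrix.GeneralLinearGroup.map (Int.castRingHom ℝ) g = toGL N r γ)
    {z : LIdx l → ℂ} (hz : zTau z ∈ jacobiDomain l) (V : LIdx l → ℂ)
    (i : LIdx l) : ∑ j, autLambda N r g z i j * V j =
      γ.deriv (zTau z) V i := by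
  have hJ := factor_ne_zero γ hz
  set B : (LIdx l → ℂ) → LIdx l → ℂ :=
    fun z => slicePt (z iE1 + γ.expo (zTau z)) (γ.actPt (zTau z)) with hB
  have hopen : IsOpen {z : LIdx l → ℂ | zTau z ∈ jacobiDomain l} :=
    isOpen_lt continuous_const (Complex.continuous_im.comp (continuous_apply iF1))
  have heq : act N r g =ᶠ[nhds z] B :=
    Filter.eventuallyEq_of_mem (hopen.mem_nhds hz) fun z hz => act_eq hg hz
  have hd : DifferentiableAt ℂ B z := differentiableAt_slicePt_actPt hz
  have hV : ∑ j, autLambda N r g z i j * V j = γ.factor (zTau z) * fderiv ℂ B z V i := by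
    have h1 : V = ∑ j, V j • (Pi.single j 1 : LIdx l → ℂ) := by
      funext a; simp [Finset.sum_apply, Pi.single_apply]
    conv_rhs => rw [h1, map_sum, Finset.sum_apply, Finset.mul_sum]
    refine Finset.sum_congr rfl fun j _ => ?_
    rw [autLambda, autJ_eq hg, heq.fderiv_eq, map_smul, Pi.smul_apply, smul_eq_mul]
    ring
  rw [hV]
  set q := zTau z with hq
  set J := γ.factor q with hJdef
  set w := γ.shift q with hw
  set c : ℂ := ((γ.A 1 0 : ℝ) : ℂ) with hc
  set x : Fin l → ℂ := complexify γ.x with hx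
  have hder : γ.deriv q V = scaleVec J (twVec N (x - (c / J) • w) V) := rfl
  rw [hder]
  -- the derivative along the line `z + t V`
  have hline : HasDerivAt (fun t : ℂ => B (z + t • V) i) (fderiv ℂ B z V i) 0 :=
    hasDerivAt_pi.mp (hd.hasFDerivAt.hasLineDerivAt V) i
  set w' : Fin l → ℂ := (fun i => V (iN i)) + V iF1 • x with hw'
  have e1 : ∀ t : ℂ, γ.factor (zTau (z + t • V)) = J + t * (c * V iF1) := fun t => by
    simp only [factor, zTau, hJdef, hc, hq, Pi.add_apply, Pi.smul_apply, smul_eq_mul]; ring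
  have e2 : ∀ t : ℂ, γ.shift (zTau (z + t • V)) = w + t • w' := fun t => by
    funext i
    simp only [shift, zTau, hw, hw', hx, hq, Pi.add_apply, Pi.smul_apply, smul_eq_mul]; ring
  rcases i with _ | i | _
  · have h1 : ∀ t : ℂ, B (z + t • V) iE1 = (z iE1 + t * V iE1)
        + (-(1 / 2 * c) * ((pair N.gram w w + t * (2 * pair N.gram w w')
            + t ^ 2 * pair N.gram w' w') / (J + t * (c * V iF1)))
        + 1 / 2 * pair N.gram x x * (q.2 + t * V iF1)
        + (pair N.gram x q.1 + t * pair N.gram x (fun i => V (iN i)))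
        + 1 / 2 * pair N.gram x (complexify γ.y) + γ.κ) := fun t => by
      have e3 : (zTau (z + t • V)).1 = q.1 + t • (fun i => V (iN i)) := rfl
      have e4 : (zTau (z + t • V)).2 = q.2 + t * V iF1 := rfl
      simp only [hB, slicePt, lvec, Sum.elim_inl, expo, e1, e2, e3, e4, pair_add_left,
        pair_add_right, pair_smul_left, pair_smul_right, pair_comm N w' w, Pi.add_apply,
        Pi.smul_apply, smul_eq_mul, ← hx, ← hc]
      ring
    have hlin : ∀ a b : ℂ, HasDerivAt (fun t : ℂ => a + t * b) b 0 := fun a b => by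
      simpa using ((hasDerivAt_id (0 : ℂ)).mul_const b).const_add a
    have h2 := (hlin (z iE1) (V iE1)).fun_add (((((((hasDerivAt_frac hJ (pair N.gram w w)
      (2 * pair N.gram w w') (pair N.gram w' w') (c * V iF1)).const_mul (-(1 / 2 * c))).fun_add
      ((hlin q.2 (V iF1)).const_mul (1 / 2 * pair N.gram x x))).fun_add
      (hlin (pair N.gram x q.1) (pair N.gram x (fun i => V (iN i)))))).add_const
        (1 / 2 * pair N.gram x (complexify γ.y))).add_const (γ.κ : ℂ))
    have h3 := hline.unique (h2.congr_of_eventuallyEq (Filter.Eventually.of_forall h1))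
    rw [show (Sum.inl () : LIdx l) = iE1 from rfl, h3]
    simp only [scaleVec, twVec, lvec, Sum.elim_inl, hw', sub_eq_add_neg, ← neg_smul, pair_add_left,
      pair_add_right, pair_smul_left, pair_smul_right, pair_comm N w x]
    field_simp
    ring
  · have h1 : ∀ t : ℂ, B (z + t • V) (iN i) =
        (w i + t * w' i + t ^ 2 * 0) / (J + t * (c * V iF1)) := fun t => by
      simp only [hB, slicePt, lvec, Sum.elim_inr, Sum.elim_inl, actPt, e1, e2, Pi.smul_apply,
        Pi.add_apply, smul_eq_mul]
      ring
    have h3 := hline.unique ((hasDerivAt_frac hJ (w i) (w' i) 0 (c * V iF1)).congr_of_eventuallyEq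
      (Filter.Eventually.of_forall h1))
    rw [show (Sum.inr (Sum.inl i) : LIdx l) = iN i from rfl, h3]
    simp only [scaleVec, twVec, lvec, Sum.elim_inr, Sum.elim_inl, hw', Pi.sub_apply, Pi.add_apply,
      Pi.smul_apply, smul_eq_mul]
    field_simp
    ring
  · have h1 : ∀ t : ℂ, B (z + t • V) iF1 =
        ((γ.A 0 0 * q.2 + γ.A 0 1) + t * (γ.A 0 0 * V iF1) + t ^ 2 * 0) / (J + t * (c * V iF1)) :=
      fun t => by
        simp only [hB, slicePt, lvec, Sum.elim_inr, actPt, e1]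
        simp only [zTau, hq, Pi.add_apply, Pi.smul_apply, smul_eq_mul]
        ring
    have h3 := hline.unique ((hasDerivAt_frac hJ (γ.A 0 0 * q.2 + γ.A 0 1)
      (γ.A 0 0 * V iF1) 0 (c * V iF1)).congr_of_eventuallyEq (Filter.Eventually.of_forall h1))
    have hdet : (γ.A 0 0 * γ.A 1 1 - γ.A 0 1 * γ.A 1 0 : ℂ) = 1 := by exact_mod_cast det_eq γ.A
    rw [show (Sum.inr (Sum.inr ()) : LIdx l) = iF1 from rfl, h3]
    simp only [scaleVec, twVec, lvec, Sum.elim_inr]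
    field_simp
    simp only [hJdef, factor]
    linear_combination V iF1 * hdet

end TubeAction

/-! ### Evaluation of tensors -/

section TensorEval

variable {l s : ℕ}

lemma tensorEval_smul (T : Tensor l s) (a : Fin s → ℂ) (v : Fin s → LIdx l → ℂ) :
    tensorEval T (fun j => a j • v j) = (∏ j, a j) * tensorEval T v := by
  simp only [tensorEval, Finset.mul_sum, Pi.smul_apply, smul_eq_mul, Finset.prod_mul_distrib]
  exact Finset.sum_congr rfl fun I _ => by ring

lemma tensorEval_single (T : Tensor l s) (J : Fin s → LIdx l) :
    tensorEval T (fun j => Pi.single (J j) 1) = T J := by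
  rw [tensorEval, Finset.sum_eq_single J]
  · simp
  · intro I _ hI
    obtain ⟨j, hj⟩ := Function.ne_iff.mp hI
    rw [Finset.prod_eq_zero (Finset.mem_univ j) (by simp [hj]), mul_zero]
  · simp

/-- A tensor can be evaluated on the images of vectors under matrices. -/
lemma tensorEval_comp (T : Tensor l s) (A : LIdx l → LIdx l → ℂ) (v : Fin s → LIdx l → ℂ) :
    tensorEval (fun J => ∑ I, T I * ∏ j, A (I j) (J j)) v =
      tensorEval T (fun j i => ∑ a, A i a * v j a) := by
  simp only [tensorEval, Finset.prod_univ_sum, Finset.sum_mul]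
  rw [Finset.sum_comm]
  refine Finset.sum_congr rfl fun I _ => ?_
  simp only [Finset.mul_sum, Fintype.piFinset_univ, Finset.prod_mul_distrib]
  exact Finset.sum_congr rfl fun J _ => by ring

lemma tensorEval_mul_left (c : ℂ) (T : Tensor l s) (v : Fin s → LIdx l → ℂ) :
    tensorEval (fun J => c * T J) v = c * tensorEval T v := by
  simp only [tensorEval, Finset.mul_sum, mul_assoc]

lemma continuous_tensorEval (v : Fin s → LIdx l → ℂ) :
    Continuous fun T : Tensor l s => tensorEval T v := by
  unfold tensorEval; fun_prop

end TensorEval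

/-! ### Transformation of the Fourier–Jacobi coefficients -/

section Limit

variable {l s : ℕ} {N : EvenLattice l} {r : ℕ} [NeZero r]
  {F : (LIdx l → ℂ) → Tensor l s}
  {P : ℤ → (Fin l → ℂ) × ℂ → (Fin s → LIdx l) → MvPolynomial (LIdx l) ℂ}

open JacobiGroup Filter Topology

lemma tensorEval_slash {g : GL (MIdx l) ℤ} {γ : JacobiGroup N}
    (hg : Matrix.GeneralLinearGroup.map (Int.castRingHom ℝ) g = toGL N r γ) (k : ℤ)
    {z : LIdx l → ℂ} (hz : zTau z ∈ jacobiDomain l) (v : Fin s → LIdx l → ℂ) :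
    tensorEval (slash N r k g F z) v = γ.factor (zTau z) ^ (-k) *
      tensorEval (F (slicePt (z iE1 + γ.expo (zTau z)) (γ.actPt (zTau z))))
        (fun j => γ.deriv (zTau z) (v j)) := by
  unfold slash
  rw [tensorEval_mul_left, tensorEval_comp, autJ_eq hg, act_eq hg hz]
  congr 2
  funext j i
  exact sum_autLambda hg hz (v j) i

lemma deriv_translation (q : (Fin l → ℂ) × ℂ) (V : LIdx l → ℂ) :
    (⟨1, 0, 0, 1⟩ : JacobiGroup N).deriv q V = V := by
  have h : complexify (0 : Fin l → ℝ) = 0 := by funext i; simp [complexify]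
  simp only [JacobiGroup.deriv, h]
  funext a
  rcases a with _ | i | _ <;> simp [factor, scaleVec, lvec, twVec, pair_zero_left]

/-- Invariance under `exp(e₁ ∧ e)` is invariance under the translation `ω ↦ ω + 1`. -/
lemma IsAHMod.add_vE1 {Γ : Subgroup (GL (MIdx l) ℤ)} {k : ℤ} (hF : IsAHMod N r Γ k F)
    (hexp : ∃ γ ∈ Γ, (γ : Matrix (MIdx l) (MIdx l) ℤ).map (Int.cast : ℤ → ℝ) =
      NormedSpace.exp (eichler (gramM N r) (mvec 0 vE1 0) (mvec 1 0 0)))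
    {z : LIdx l → ℂ} (hz : z ∈ tube N) : F (z + vE1) = F z := by
  obtain ⟨g, hg, hgm⟩ := hexp
  have hg' : Matrix.GeneralLinearGroup.map (Int.castRingHom ℝ) g =
      toGL N r ⟨1, 0, 0, 1⟩ := by
    apply Units.ext
    rw [coe_toGL, ← exp_eichler_eq, ← hgm]
    rfl
  have hq := (mem_tube_iff.mp hz).1
  funext J
  rw [← congrFun (hF.slash_eq g hg z hz) J, ← tensorEval_single (slash N r k g F z),
    tensorEval_slash hg' k hq]
  simp only [deriv_translation, tensorEval_single]
  have h0 : complexify (0 : Fin l → ℝ) = 0 := by funext i; simp [complexify]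
  have h1 : (⟨1, 0, 0, 1⟩ : JacobiGroup N).expo (zTau z) = 1 := by
    simp [expo, h0, pair_zero_left]
  have h2 : (⟨1, 0, 0, 1⟩ : JacobiGroup N).actPt (zTau z) = zTau z := by
    simp [actPt, factor, JacobiGroup.shift, h0]
  have h3 : (⟨1, 0, 0, 1⟩ : JacobiGroup N).factor (zTau z) = 1 := by simp [factor]
  rw [h1, h2, h3, slicePt_add, slicePt_zTau]
  simp

lemma nu_congr {z z' : LIdx l → ℂ} (h : imVec z = imVec z') : nu N r z = nu N r z' := by
  funext b; simp only [nu, imSq, h]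

/-- The variables `ν` in the coordinates `(ω, 𝔷, τ)`; the integer `r` cancels. -/
lemma nu_slicePt (u : ℂ) (q : (Fin l → ℂ) × ℂ) :
    nu N r (slicePt u q) = lvec
      ((q.2.im : ℂ) / (Complex.I * (2 * u.im * q.2.im
        - pair N.gram (fun i => (q.1 i).im) (fun i => (q.1 i).im) : ℝ)))
      (fun i => -(pair N.gram (fun i => (q.1 i).im) (Pi.single i 1) : ℝ) / (Complex.I *
        (2 * u.im * q.2.im - pair N.gram (fun i => (q.1 i).im) (fun i => (q.1 i).im) : ℝ)))
      ((u.im : ℂ) / (Complex.I * (2 * u.im * q.2.im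
        - pair N.gram (fun i => (q.1 i).im) (fun i => (q.1 i).im) : ℝ))) := by
  have hr : (r : ℂ) ≠ 0 := Nat.cast_ne_zero.mpr (NeZero.ne r)
  have him : pair (gramL N) (imVec (slicePt u q)) (imVec (slicePt u q)) = 2 * u.im * q.2.im
        - pair N.gram (fun i => (q.1 i).im) (fun i => (q.1 i).im) := by
    rw [pair_gramL]; simp only [imVec, slicePt, lvec, Sum.elim_inl, Sum.elim_inr]; ring
  have hnum : ∀ b, (∑ a, (imVec (slicePt u q) a : ℂ) * ((r : ℂ) * (gramL N a b : ℂ))) =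
      r * ((pair (gramL N) (imVec (slicePt u q)) (Pi.single b 1) : ℝ) : ℂ) := fun b => by
    rw [pair, Matrix.mulVec_single_one, dotProduct]
    push_cast
    rw [Finset.mul_sum]
    refine Finset.sum_congr rfl fun a _ => ?_
    simp [Matrix.col]
    ring
  funext b
  rw [nu, hnum, imSq, him, pair_gramL]
  have hc : ∀ A B : ℂ, (r : ℂ) * A / (Complex.I * (r * B)) = A / (Complex.I * B) := fun A B => by
    rw [mul_left_comm, mul_div_mul_left _ _ hr]
  rw [Complex.ofReal_mul, Complex.ofReal_natCast, hc]
  rcases b with _ | i | _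
  · simp [lvec, imVec, slicePt, ← Pi.zero_def, pair_zero_right]
  · have : (fun j => (Pi.single (iN i) 1 : LIdx l → ℝ) (iN j)) = Pi.single i 1 := by
      funext j; simp [Pi.single_apply]
    rw [this]
    simp [lvec, imVec, slicePt]
  · simp [lvec, imVec, slicePt, ← Pi.zero_def, pair_zero_right]

/-- The limit of `ν` for `Im ω → ∞`. -/
noncomputable def nuLim (q : (Fin l → ℂ) × ℂ) : LIdx l → ℂ :=
  lvec 0 0 (1 / (2 * Complex.I * (q.2.im : ℂ)))

/-- For `Im ω → ∞`, only `ν_τ` survives. -/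
lemma tendsto_nu {q : (Fin l → ℂ) × ℂ} (hq : q ∈ jacobiDomain l) (c : ℂ) :
    Tendsto (fun y : ℝ => nu N r (slicePt (y * Complex.I + c) q)) atTop (𝓝 (nuLim q)) := by
  have hy : (0 : ℝ) < q.2.im := hq
  set A := pair N.gram (fun i => (q.1 i).im) (fun i => (q.1 i).im) with hA
  have him : ∀ y : ℝ, (y * Complex.I + c).im = y + c.im := fun y => by simp
  have h1 : Tendsto (fun y : ℝ => y + c.im) atTop atTop :=
    tendsto_atTop_add_const_right _ _ tendsto_id
  have h2 : Tendsto (fun y : ℝ => 2 * (y + c.im) * q.2.im - A) atTop atTop :=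
    tendsto_atTop_add_const_right _ (-A) ((h1.const_mul_atTop two_pos).atTop_mul_const hy)
  have h3 : ∀ B : ℂ, Tendsto (fun y : ℝ => B / (Complex.I * ((2 * (y + c.im) * q.2.im - A : ℝ) : ℂ)))
      atTop (𝓝 0) := fun B => by
    have h4 : Tendsto (fun y : ℝ => ((2 * (y + c.im) * q.2.im - A)⁻¹ : ℝ)) atTop (𝓝 0) :=
      tendsto_inv_atTop_zero.comp h2
    have h5 := ((Complex.continuous_ofReal.tendsto 0).comp h4).const_mul (B / Complex.I)
    rw [Complex.ofReal_zero, mul_zero] at h5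
    refine h5.congr fun y => ?_
    simp only [Function.comp, Complex.ofReal_inv]
    rw [div_mul_eq_div_div, div_eq_mul_inv (B / Complex.I)]
  refine tendsto_pi_nhds.mpr fun b => ?_
  simp only [nu_slicePt, him, ← hA]
  rcases b with _ | i | _
  · exact h3 _
  · exact h3 _
  · simp only [lvec, Sum.elim_inr, nuLim]
    have hne : ∀ᶠ y : ℝ in atTop, 2 * (y + c.im) * q.2.im - A ≠ 0 :=
      (h2.eventually_gt_atTop 0).mono fun y h => h.ne'
    have h6 := ((h3 ((A : ℂ) / (2 * q.2.im))).const_add (1 / (2 * Complex.I * (q.2.im : ℂ))))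
    rw [add_zero] at h6
    refine h6.congr' ?_
    filter_upwards [hne] with y hy'
    have hy0 : (q.2.im : ℂ) ≠ 0 := Complex.ofReal_ne_zero.mpr hy.ne'
    have hy1 : ((2 * (y + c.im) * q.2.im - A : ℝ) : ℂ) ≠ 0 := Complex.ofReal_ne_zero.mpr hy'
    field_simp
    push_cast
    ring

/-- The value on `v` of the Fourier–Jacobi coefficient, with `ν` specialized to a vector. -/
noncomputable def coeffEval (P : ℤ → (Fin l → ℂ) × ℂ → (Fin s → LIdx l) → MvPolynomial (LIdx l) ℂ)
    (m : ℤ) (q : (Fin l → ℂ) × ℂ) (ν : LIdx l → ℂ) (v : Fin s → LIdx l → ℂ) : ℂ :=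
  tensorEval (fun I => MvPolynomial.eval ν (P m q I)) v

lemma IsFJExpansion.hasSum_coeffEval (hP : IsFJExpansion N r F P) (v : Fin s → LIdx l → ℂ)
    {z : LIdx l → ℂ} (hz : z ∈ tube N) :
    HasSum (fun m : ℤ => coeffEval P m (zTau z) (nu N r z) v * qexp (m * z iE1))
      (tensorEval (F z) v) := by
  simp only [coeffEval, tensorEval, Finset.sum_mul]
  refine hasSum_sum fun I _ => ?_
  convert! (hP.hasSum I hz).mul_right (∏ j, v j (I j)) using 2
  ring

/-- The transformation of the Fourier–Jacobi coefficients, obtained from the uniqueness of Fourier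
expansions on the lines on which `Im ω` is constant. -/
lemma coeffEval_slash {g : GL (MIdx l) ℤ} {γ : JacobiGroup N}
    (hg : Matrix.GeneralLinearGroup.map (Int.castRingHom ℝ) g = toGL N r γ) {k : ℤ}
    (hF : ∀ z ∈ tube N, slash N r k g F z = F z) (hP : IsFJExpansion N r F P)
    {q : (Fin l → ℂ) × ℂ} (hq : q ∈ jacobiDomain l) {y : ℝ} (hy : hgt N q < y)
    (m : ℤ) (v : Fin s → LIdx l → ℂ) :
    coeffEval P m q (nu N r (slicePt (y * Complex.I) q)) v =
      γ.factor q ^ (-k) * qexp (m * γ.expo q) * coeffEval P m (γ.actPt q)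
        (nu N r (slicePt (y * Complex.I + γ.expo q) (γ.actPt q))) (fun j => γ.deriv q (v j)) := by
  refine fourier_unique (y := y)
    (c := fun m => coeffEval P m q (nu N r (slicePt (y * Complex.I) q)) v)
    (d := fun m => γ.factor q ^ (-k) * qexp (m * γ.expo q) * coeffEval P m (γ.actPt q)
        (nu N r (slicePt (y * Complex.I + γ.expo q) (γ.actPt q))) (fun j => γ.deriv q (v j)))
    (f := fun u => tensorEval (F (slicePt u q)) v) (fun x => ?_) (fun x => ?_) m
  · have hz : slicePt ((x : ℂ) + y * Complex.I) q ∈ tube N :=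
      slicePt_mem_tube.mpr ⟨hq, by simpa using hy⟩
    have h := hP.hasSum_coeffEval v hz
    rwa [nu_congr (z' := slicePt (y * Complex.I) q) (by
      funext a; rcases a with _ | i | _ <;> simp [imVec, slicePt, lvec])] at h
  · have hz : slicePt ((x : ℂ) + y * Complex.I) q ∈ tube N :=
      slicePt_mem_tube.mpr ⟨hq, by simpa using hy⟩
    have hz' := act_mem_tube hg hz
    rw [act_eq hg (by exact hq)] at hz'
    have h := (hP.hasSum_coeffEval (fun j => γ.deriv q (v j)) hz').mul_left (γ.factor q ^ (-k))
    simp only [zTau_slicePt, slicePt_iE1] at h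
    have h2 := tensorEval_slash (F := F) hg k (z := slicePt ((x : ℂ) + y * Complex.I) q) hq v
    rw [hF _ hz] at h2
    simp only [zTau_slicePt, slicePt_iE1] at h2
    rw [h2]
    rw [nu_congr (z' := slicePt (y * Complex.I + γ.expo q) (γ.actPt q)) (by
      funext a; rcases a with _ | i | _ <;> simp [imVec, slicePt, lvec])] at h
    convert! h using 2 with n
    rw [mul_add (n : ℂ) (_ + _) (γ.expo q), qexp_add (_ * _) (_ * γ.expo q)]
    ring

/-- The limit `Im ω → ∞` of the transformation of the Fourier–Jacobi coefficients. -/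
lemma coeffEval_nuLim {g : GL (MIdx l) ℤ} {γ : JacobiGroup N}
    (hg : Matrix.GeneralLinearGroup.map (Int.castRingHom ℝ) g = toGL N r γ) {k : ℤ}
    (hF : ∀ z ∈ tube N, slash N r k g F z = F z) (hP : IsFJExpansion N r F P)
    {q : (Fin l → ℂ) × ℂ} (hq : q ∈ jacobiDomain l) (m : ℤ) (v : Fin s → LIdx l → ℂ) :
    coeffEval P m q (nuLim q) v = γ.factor q ^ (-k) * qexp (m * γ.expo q) *
      coeffEval P m (γ.actPt q) (nuLim (γ.actPt q)) (fun j => γ.deriv q (v j)) := by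
  have hcont : ∀ q v, Continuous fun ν => coeffEval P m q ν v := fun q v =>
    (continuous_tensorEval v).comp (continuous_pi fun I => MvPolynomial.continuous_eval _)
  have h1 := ((hcont q v).tendsto _).comp (tendsto_nu (N := N) (r := r) hq 0)
  have h2 := (((hcont (γ.actPt q) (fun j => γ.deriv q (v j))).tendsto _).comp
    (tendsto_nu (N := N) (r := r) (actPt_mem γ hq) (γ.expo q))).const_mul
      (γ.factor q ^ (-k) * qexp (m * γ.expo q))
  refine tendsto_nhds_unique (h1.congr' ?_) h2
  filter_upwards [eventually_gt_atTop (hgt N q)] with y hy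
  simp only [Function.comp, add_zero]
  exact coeffEval_slash hg hF hP hq hy m v

/-- The dependence of `v[𝔷, τ]` on `Im 𝔷 / Im τ` compensates the unipotent part of the derivative
of the action, so that only the torus part remains. -/
lemma deriv_twVec {γ : JacobiGroup N} {q : (Fin l → ℂ) × ℂ} (hq : q ∈ jacobiDomain l)
    (v : LIdx l → ℂ) : γ.deriv q (twVec N (fun i => jacobiVars q (some i)) v) =
      twVec N (fun i => jacobiVars (γ.actPt q) (some i)) (scaleVec (γ.factor q) v) := by
  have hJ := factor_ne_zero γ hq
  rw [JacobiGroup.deriv, ← twVec_add, scaleVec_twVec N hJ]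
  congr 1
  funext i
  rw [jacobiVars_actPt_some γ hq]
  simp only [Pi.smul_apply, Pi.add_apply, Pi.sub_apply, smul_eq_mul, complexify]
  field_simp
  ring

open Classical in
/-- The weight of a homogeneous vector. -/
noncomputable def wtVec (v : LIdx l → ℝ) : ℤ :=
  (if v = vF1 then 1 else 0) - (if v = vE1 then 1 else 0)

lemma wt_eq_sum (v : Fin s → LIdx l → ℝ) : wt v = ∑ j, wtVec (v j) := by
  rw [wt, Finset.card_filter, Finset.card_filter]
  push_cast
  rw [← Finset.sum_sub_distrib]
  rfl

/-- Homogeneous vectors are eigenvectors of the torus. -/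
lemma scaleVec_complexify (J : ℂ) {v : LIdx l → ℝ}
    (hv : v = vE1 ∨ v = vF1 ∨ ∃ x : Fin l → ℝ, v = lvec 0 x 0) :
    scaleVec J (complexify v) = J ^ (-wtVec v) • complexify v := by
  have hEF : (vE1 : LIdx l → ℝ) ≠ vF1 := fun h => by
    simpa [vE1, vF1, lvec] using congrFun h iE1
  rcases hv with rfl | rfl | ⟨x, rfl⟩
  · funext a
    rcases a with _ | i | _ <;> simp [scaleVec, complexify, lvec, wtVec, hEF] <;> simp [vE1, lvec]
  · funext a
    rcases a with _ | i | _ <;> simp [scaleVec, complexify, lvec, wtVec, hEF.symm] <;>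
      simp [vF1, lvec]
  · have h1 : (lvec 0 x 0 : LIdx l → ℝ) ≠ vE1 := fun h => by
      simpa [vE1, lvec] using congrFun h iE1
    have h2 : (lvec 0 x 0 : LIdx l → ℝ) ≠ vF1 := fun h => by
      simpa [vF1, lvec] using congrFun h iF1
    funext a
    rcases a with _ | i | _ <;> simp [scaleVec, complexify, wtVec, h1, h2] <;> simp [lvec]

lemma fjLim_eq (m : ℤ) (v : Fin s → LIdx l → ℝ) (q : (Fin l → ℂ) × ℂ) :
    fjLim N P m v q = coeffEval P m q (nuLim q)
      (fun j => twVec N (fun i => jacobiVars q (some i)) (complexify (v j))) := by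
  simp only [fjLim, coeffEval, nuLim, twist_mulVec]

/-- The functions `F_m^lim(v[𝔷, τ])` transform like Jacobi forms. -/
theorem jacobiSlash_fjLim {g : GL (MIdx l) ℤ} {γ : JacobiGroup N}
    (hg : Matrix.GeneralLinearGroup.map (Int.castRingHom ℝ) g = toGL N r γ) {k : ℤ}
    (hF : ∀ z ∈ tube N, slash N r k g F z = F z) (hP : IsFJExpansion N r F P)
    {v : Fin s → LIdx l → ℝ} (hv : IsHomogeneous v) (m : ℤ)
    {q : (Fin l → ℂ) × ℂ} (hq : q ∈ jacobiDomain l) :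
    jacobiSlash (k + wt v) m γ (fjLim N P m v) q = fjLim N P m v q := by
  have hJ := factor_ne_zero γ hq
  have hprod : ∏ j, γ.factor q ^ (-wtVec (v j)) = γ.factor q ^ (-wt v) := by
    rw [wt_eq_sum, ← Finset.sum_neg_distrib]
    generalize (Finset.univ : Finset (Fin s)) = S
    induction S using Finset.induction_on with
    | empty => simp
    | insert a S ha ih => rw [Finset.prod_insert ha, Finset.sum_insert ha, zpow_add₀ hJ, ih]
  rw [jacobiSlash_apply, fjLim_eq, fjLim_eq, coeffEval_nuLim hg hF hP hq]
  simp only [deriv_twVec hq, scaleVec_complexify _ (hv _), twVec_smul]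
  rw [coeffEval, coeffEval, tensorEval_smul, hprod, neg_add, zpow_add₀ hJ]
  ring

end Limit

/-! ### The variables `Im 𝔷 / Im τ` and `1 / Im τ` -/

section JacobiVariables

variable {l : ℕ}

lemma differentiableAt_jacobiVars {q : (Fin l → ℂ) × ℂ} (hq : q ∈ jacobiDomain l)
    (j : Option (Fin l)) : DifferentiableAt ℝ (fun q => jacobiVars q j) q := by
  have hq' : q.2.im ≠ 0 := (show 0 < q.2.im from hq).ne'
  have h1 : DifferentiableAt ℝ (fun q : (Fin l → ℂ) × ℂ => q.2.im) q :=
    Complex.imCLM.differentiableAt.comp q differentiableAt_snd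
  rcases j with _ | i
  · simp only [jacobiVars]
    have h2 : DifferentiableAt ℝ (fun q : (Fin l → ℂ) × ℂ => 1 / q.2.im) q :=
      by simpa using h1.fun_inv hq'
    exact Complex.ofRealCLM.differentiableAt.comp q h2
  · simp only [jacobiVars]
    have h2 : DifferentiableAt ℝ (fun q : (Fin l → ℂ) × ℂ => (q.1 i).im) q :=
      Complex.imCLM.differentiableAt.comp q
        (differentiableAt_pi.mp differentiableAt_fst i)
    have h3 : DifferentiableAt ℝ (fun q : (Fin l → ℂ) × ℂ => (q.1 i).im / q.2.im) q :=
      by simpa only [div_eq_mul_inv] using h2.fun_mul (h1.fun_inv hq')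
    exact Complex.ofRealCLM.differentiableAt.comp q h3

lemma dbar_im_snd (q v : (Fin l → ℂ) × ℂ) :
    dbar (fun q : (Fin l → ℂ) × ℂ => (q.2.im : ℂ)) q v = Complex.I / 2 * starRingEnd ℂ v.2 :=
  dbar_ofReal_im (ContinuousLinearMap.snd ℝ (Fin l → ℂ) ℂ) (fun _ => rfl) q v

lemma dbar_im_fst (q v : (Fin l → ℂ) × ℂ) (i : Fin l) :
    dbar (fun q : (Fin l → ℂ) × ℂ => ((q.1 i).im : ℂ)) q v =
      Complex.I / 2 * starRingEnd ℂ (v.1 i) :=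
  dbar_ofReal_im ((ContinuousLinearMap.proj i).comp (ContinuousLinearMap.fst ℝ (Fin l → ℂ) ℂ))
    (fun _ => rfl) q v

lemma differentiableAt_im_snd (q : (Fin l → ℂ) × ℂ) :
    DifferentiableAt ℝ (fun q : (Fin l → ℂ) × ℂ => (q.2.im : ℂ)) q :=
  Complex.ofRealCLM.differentiableAt.comp q
    (Complex.imCLM.differentiableAt.comp q differentiableAt_snd)

lemma dbar_jacobiVars_none {q : (Fin l → ℂ) × ℂ} (hq : q ∈ jacobiDomain l)
    (v : (Fin l → ℂ) × ℂ) : dbar (fun q => jacobiVars q none) q v =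
      -(Complex.I / 2 * starRingEnd ℂ v.2) / (q.2.im : ℂ) ^ 2 := by
  have hq' : (q.2.im : ℂ) ≠ 0 := Complex.ofReal_ne_zero.mpr (show 0 < q.2.im from hq).ne'
  have h1 := dbar_mul (differentiableAt_jacobiVars hq none) (differentiableAt_im_snd q) v
  rw [dbar_congr_of_eqOn (g := fun _ => 1) isOpen_jacobiDomain (fun q hq => by
    have hq' : (q.2.im : ℂ) ≠ 0 := Complex.ofReal_ne_zero.mpr (show 0 < q.2.im from hq).ne'
    simp [jacobiVars, hq']) hq, dbar_const, dbar_im_snd] at h1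
  rw [show jacobiVars q none = 1 / (q.2.im : ℂ) by simp [jacobiVars]] at h1
  field_simp at h1 ⊢
  linear_combination -h1

lemma dbar_jacobiVars_some {q : (Fin l → ℂ) × ℂ} (hq : q ∈ jacobiDomain l)
    (v : (Fin l → ℂ) × ℂ) (i : Fin l) : dbar (fun q => jacobiVars q (some i)) q v =
      Complex.I / 2 * (starRingEnd ℂ (v.1 i) - jacobiVars q (some i) * starRingEnd ℂ v.2)
        / q.2.im := by
  have hq' : (q.2.im : ℂ) ≠ 0 := Complex.ofReal_ne_zero.mpr (show 0 < q.2.im from hq).ne'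
  have h1 := dbar_mul (differentiableAt_jacobiVars hq (some i)) (differentiableAt_im_snd q) v
  rw [dbar_congr_of_eqOn (g := fun q => ((q.1 i).im : ℂ)) isOpen_jacobiDomain (fun q hq => by
    have hq' : (q.2.im : ℂ) ≠ 0 := Complex.ofReal_ne_zero.mpr (show 0 < q.2.im from hq).ne'
    simp [jacobiVars, hq']) hq, dbar_im_fst, dbar_im_snd] at h1
  field_simp
  linear_combination -2 * h1

/-- Expansions in the variables `α_i` and `1 / Im τ` are unique. The vectors dual to the forms
`∂̄ X` are multiples of `(Im 𝔷, Im τ)`, along which `α` is constant, and of the basis vectors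
of `N`. -/
lemma jacobi_expansion_unique {P Q : (Fin l → ℂ) × ℂ → MvPolynomial (Option (Fin l)) ℂ}
    (hP : HolPoly (jacobiDomain l) P) (hQ : HolPoly (jacobiDomain l) Q)
    (h : ∀ q ∈ jacobiDomain l, MvPolynomial.eval (jacobiVars q) (P q) =
      MvPolynomial.eval (jacobiVars q) (Q q)) : ∀ q ∈ jacobiDomain l, P q = Q q := by
  refine HolPoly.eq_of_eval_eq isOpen_jacobiDomain (fun q hq j => differentiableAt_jacobiVars hq j)
    (fun q hq i => ?_) hP hQ h
  have hq' : (q.2.im : ℂ) ≠ 0 := Complex.ofReal_ne_zero.mpr (show 0 < q.2.im from hq).ne'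
  rcases i with _ | i
  · refine ⟨(fun i => -(2 * Complex.I * (q.2.im : ℂ)) * (q.1 i).im,
      -(2 * Complex.I * (q.2.im : ℂ)) * q.2.im), fun j => ?_⟩
    rcases j with _ | j
    · rw [dbar_jacobiVars_none hq]
      simp
      field_simp
      rw [Complex.conj_ofNat, Complex.I_sq]; ring
    · rw [dbar_jacobiVars_some hq]
      simp [jacobiVars]
      field_simp
      simp
  · refine ⟨(Pi.single i (2 * Complex.I * (q.2.im : ℂ)), 0), fun j => ?_⟩
    rcases j with _ | j
    · rw [dbar_jacobiVars_none hq]; simp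
    · rw [dbar_jacobiVars_some hq]
      rcases eq_or_ne j i with rfl | hij
      · simp
        field_simp
        rw [Complex.conj_ofNat, Complex.I_sq]; ring
      · simp [hij]

variable {Φ : (Fin l → ℂ) × ℂ → ℂ} {Q : (Fin l → ℂ) × ℂ → MvPolynomial (Option (Fin l)) ℂ}

lemma dbar_of_isPolyExpansion (hQ : IsPolyExpansion (jacobiDomain l) jacobiVars Φ Q)
    {q : (Fin l → ℂ) × ℂ} (hq : q ∈ jacobiDomain l) (v : (Fin l → ℂ) × ℂ) :
    dbar Φ q v = ∑ j, MvPolynomial.eval (jacobiVars q) (MvPolynomial.pderiv j (Q q)) *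
      dbar (fun q => jacobiVars q j) q v := by
  rw [dbar_congr_of_eqOn isOpen_jacobiDomain hQ.eq hq,
    hQ.holPoly.dbar_eval isOpen_jacobiDomain hq fun j => differentiableAt_jacobiVars hq j]

/-- The operator `L^Jac` is `-∂/∂(1 / Im τ)`. -/
lemma IsPolyExpansion.lowerJac (hQ : IsPolyExpansion (jacobiDomain l) jacobiVars Φ Q) :
    IsPolyExpansion (jacobiDomain l) jacobiVars (lowerJac Φ)
      (fun q => -MvPolynomial.pderiv none (Q q)) := by
  refine (hQ.holPoly.pderiv none).neg.isPolyExpansion fun q hq => ?_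
  have hq' : (q.2.im : ℂ) ≠ 0 := Complex.ofReal_ne_zero.mpr (show 0 < q.2.im from hq).ne'
  have h1 : (q.2.im : ℂ) * dbar Φ q (0, 1) + ∑ i, ((q.1 i).im : ℂ) * dbar Φ q (Pi.single i 1, 0) =
      dbar Φ q (fun i => ((q.1 i).im : ℂ), (q.2.im : ℂ)) := by
    have h2 : ((fun i => ((q.1 i).im : ℂ), (q.2.im : ℂ)) : (Fin l → ℂ) × ℂ) =
        ((q.2.im : ℝ) : ℂ) • ((0, 1) : (Fin l → ℂ) × ℂ) +
          ∑ i, (((q.1 i).im : ℝ) : ℂ) • ((Pi.single i 1, 0) : (Fin l → ℂ) × ℂ) := by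
      refine Prod.ext ?_ ?_
      · funext j
        simp [Prod.fst_sum, Finset.sum_apply, Pi.single_apply]
      · simp [Prod.snd_sum]
    rw [h2, dbar_add_vec, dbar_sum_vec, dbar_real_smul_vec]
    simp only [dbar_real_smul_vec]
  rw [OrthogonalFJ.lowerJac, h1, dbar_of_isPolyExpansion hQ hq, Fintype.sum_option]
  have h3 : ∀ i, dbar (fun q => jacobiVars q (some i)) q
      (fun i => ((q.1 i).im : ℂ), (q.2.im : ℂ)) = 0 := fun i => by
    rw [dbar_jacobiVars_some hq]
    simp only [Complex.conj_ofReal, jacobiVars]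
    push_cast
    field_simp
    ring
  simp only [h3, mul_zero, Finset.sum_const_zero, add_zero]
  rw [dbar_jacobiVars_none hq, Complex.conj_ofReal, map_neg]
  field_simp
  linear_combination (MvPolynomial.eval (jacobiVars q) (MvPolynomial.pderiv none (Q q)))
    * Complex.I_sq

/-- The operator `ξ_μ` is `∑ μ_i ∂/∂α_i`. -/
lemma IsPolyExpansion.xiJac (hQ : IsPolyExpansion (jacobiDomain l) jacobiVars Φ Q)
    (μ : Fin l → ℝ) : IsPolyExpansion (jacobiDomain l) jacobiVars (xiJac μ Φ)
      (fun q => ∑ i, MvPolynomial.C (μ i : ℂ) * MvPolynomial.pderiv (some i) (Q q)) := by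
  refine (HolPoly.sum _ fun i _ =>
    (HolPoly.const _).mul (hQ.holPoly.pderiv (some i))).isPolyExpansion fun q hq => ?_
  have hq' : (q.2.im : ℂ) ≠ 0 := Complex.ofReal_ne_zero.mpr (show 0 < q.2.im from hq).ne'
  rw [OrthogonalFJ.xiJac, map_sum, Finset.mul_sum]
  refine Finset.sum_congr rfl fun i _ => ?_
  rw [dbar_of_isPolyExpansion hQ hq, Fintype.sum_option, dbar_jacobiVars_none hq,
    Finset.sum_eq_single i, dbar_jacobiVars_some hq]
  · simp
    field_simp
    linear_combination (-(μ i : ℂ) * MvPolynomial.eval (jacobiVars q)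
      (MvPolynomial.pderiv (some i) (Q q))) * Complex.I_sq
  · intro j _ hj
    rw [dbar_jacobiVars_some hq]
    simp [hj]
  · simp

end JacobiVariables

/-! ### The limit as a polynomial in the Jacobi variables -/

section FJLimit

variable {l s : ℕ} (N : EvenLattice l)

/-- The polynomials in `α` which give the coordinates of `exp(α ∧ e₁) v`. -/
noncomputable def twPoly (v : LIdx l → ℝ) : LIdx l → MvPolynomial (Option (Fin l)) ℂ :=
  lvec (MvPolynomial.C (v iE1 : ℂ)
      + ∑ i, MvPolynomial.C (pair N.gram (Pi.single i 1) (fun i => v (iN i)) : ℂ) *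
        MvPolynomial.X (some i)
      + MvPolynomial.C (1 / 2 * v iF1 : ℂ) * ∑ i, ∑ j, MvPolynomial.C (N.gram i j : ℂ) *
        (MvPolynomial.X (some i) * MvPolynomial.X (some j)))
    (fun i => MvPolynomial.C (v (iN i) : ℂ) + MvPolynomial.C (v iF1 : ℂ) * MvPolynomial.X (some i))
    (MvPolynomial.C (v iF1 : ℂ))

lemma pair_eq_sum_sum {ι K : Type*} [Fintype ι] [CommRing K] (G : Matrix ι ι ℤ) (x y : ι → K) :
    pair G x y = ∑ i, ∑ j, (G i j : K) * (x i * y j) := by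
  simp only [pair, dotProduct, Matrix.mulVec, Matrix.map_apply, Finset.mul_sum]
  exact Finset.sum_congr rfl fun i _ => Finset.sum_congr rfl fun j _ => by ring

lemma eval_twPoly (v : LIdx l → ℝ) (X : Option (Fin l) → ℂ) (a : LIdx l) :
    MvPolynomial.eval X (twPoly N v a) = twVec N (fun i => X (some i)) (complexify v) a := by
  rcases a with _ | i | _
  · simp only [twPoly, lvec, Sum.elim_inl, map_add, map_mul, map_sum, MvPolynomial.eval_C,
      MvPolynomial.eval_X, twVec, complexify]
    rw [← pair_eq_sum_sum N.gram (fun i => X (some i)) (fun i => X (some i))]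
    have : ∑ i, pair N.gram (Pi.single i 1) (fun i => (v (iN i) : ℂ)) * X (some i) =
        pair N.gram (fun i => X (some i)) (fun i => (v (iN i) : ℂ)) := by
      rw [pair_comm, pair_eq_sum_single]
      exact Finset.sum_congr rfl fun i _ => by rw [pair_comm]
    rw [this]
    ring
  · simp [twPoly, lvec, twVec, complexify]
  · simp [twPoly, lvec, twVec, complexify]

lemma pderiv_none_twPoly (v : LIdx l → ℝ) (a : LIdx l) :
    MvPolynomial.pderiv none (twPoly N v a) = 0 := by
  rcases a with _ | i | _ <;> simp [twPoly, lvec, MvPolynomial.pderiv_X]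

lemma complexify_eichler_mulVec (μ : Fin l → ℝ) (v : LIdx l → ℝ) :
    complexify ((eichler (gramL N) (lvec 0 μ 0) vE1).mulVec v) =
      lvec (pair N.gram (complexify μ) (fun i => (v (iN i) : ℂ))) (fun i => v iF1 * μ i) 0 := by
  have h := eichler_mulVec N (complexify μ) (complexify v)
  have h2 : complexify ((eichler (gramL N) (lvec 0 μ 0) vE1).mulVec v) =
      (eichler (gramL N) (lvec 0 (complexify μ) 0) vE1).mulVec (complexify v) := by
    funext a
    simp only [complexify, Matrix.mulVec, dotProduct, eichler, Matrix.of_apply, Complex.ofReal_sum,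
      Complex.ofReal_mul, Complex.ofReal_sub, ofReal_pair]
    refine Finset.sum_congr rfl fun b _ => ?_
    have e1 : complexify (vE1 : LIdx l → ℝ) = vE1 := by
      funext a; rcases a with _ | i | _ <;> simp [complexify, vE1, lvec]
    have e2 : complexify (lvec 0 μ 0 : LIdx l → ℝ) = lvec 0 (complexify μ) 0 := by
      funext a; rcases a with _ | i | _ <;> simp [complexify, lvec]
    rw [e1, e2, complexify_single, ← congrFun e1 a, ← congrFun e2 a]
    rfl
  rw [h2, h]
  rfl

lemma derivation_prod {A ι : Type*} [CommRing A] [Algebra ℂ A] [DecidableEq ι]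
    (D : Derivation ℂ A A) (S : Finset ι) (f : ι → A) :
    D (∏ i ∈ S, f i) = ∑ i ∈ S, (∏ j ∈ S.erase i, f j) * D (f i) := by
  induction S using Finset.induction_on with
  | empty => simp
  | insert a S ha ih =>
    rw [Finset.prod_insert ha, Derivation.leibniz, ih, Finset.sum_insert ha,
      Finset.erase_insert ha, smul_eq_mul, smul_eq_mul, Finset.mul_sum, add_comm]
    congr 1
    refine Finset.sum_congr rfl fun i hi => ?_
    have hia : a ≠ i := fun h => ha (h ▸ hi)
    rw [Finset.erase_insert_of_ne hia, Finset.prod_insert (fun h => ha (Finset.mem_of_mem_erase h)),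
      mul_assoc]

/-- The derivation `∑ μ_i ∂/∂α_i`. -/
noncomputable def alphaDer (μ : Fin l → ℝ) :
    Derivation ℂ (MvPolynomial (Option (Fin l)) ℂ) (MvPolynomial (Option (Fin l)) ℂ) :=
  ∑ i, (μ i : ℂ) • MvPolynomial.pderiv (some i)

lemma alphaDer_apply (μ : Fin l → ℝ) (p : MvPolynomial (Option (Fin l)) ℂ) :
    alphaDer μ p = ∑ i, MvPolynomial.C (μ i : ℂ) * MvPolynomial.pderiv (some i) p := by
  rw [alphaDer, ← Derivation.coeFnAddMonoidHom_apply, map_sum, Finset.sum_apply]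
  exact Finset.sum_congr rfl fun i _ => by
    rw [Derivation.coeFnAddMonoidHom_apply, Derivation.smul_apply, MvPolynomial.smul_eq_C_mul]

lemma alphaDer_X (μ : Fin l → ℝ) (i : Fin l) :
    alphaDer μ (MvPolynomial.X (some i)) = MvPolynomial.C (μ i : ℂ) := by
  rw [alphaDer_apply, Finset.sum_eq_single i] <;>
    simp +contextual [MvPolynomial.pderiv_X]

lemma alphaDer_C (μ : Fin l → ℝ) (c : ℂ) : alphaDer μ (MvPolynomial.C c) = 0 := by
  simp

/-- The derivative of `exp(α ∧ e₁) v` in the direction `μ` is `exp(α ∧ e₁) (μ ∧ e₁) v`. -/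
lemma eval_alphaDer_twPoly (μ : Fin l → ℝ) (v : LIdx l → ℝ) (a : LIdx l)
    (X : Option (Fin l) → ℂ) : MvPolynomial.eval X (alphaDer μ (twPoly N v a)) =
      twVec N (fun i => X (some i))
        (complexify ((eichler (gramL N) (lvec 0 μ 0) vE1).mulVec v)) a := by
  rw [complexify_eichler_mulVec]
  rcases a with _ | i | _
  · simp only [twPoly, lvec, Sum.elim_inl, Sum.elim_inr, map_add, map_sum, Derivation.leibniz,
      alphaDer_C, alphaDer_X, smul_eq_mul, mul_zero, add_zero, zero_add, map_mul,
      MvPolynomial.eval_C, MvPolynomial.eval_X, twVec]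
    have h1 : ∑ i, pair N.gram (Pi.single i 1) (fun i => (v (iN i) : ℂ)) * (μ i : ℂ) =
        pair N.gram (complexify μ) (fun i => (v (iN i) : ℂ)) := by
      rw [pair_comm, pair_eq_sum_single]
      exact Finset.sum_congr rfl fun i _ => by rw [pair_comm]; rfl
    have h2 : ∑ i, ∑ j, (N.gram i j : ℂ) * (X (some i) * (μ j : ℂ) + X (some j) * (μ i : ℂ)) =
        2 * pair N.gram (fun i => X (some i)) (complexify μ) := by
      rw [two_mul, pair_eq_sum_sum]
      conv_rhs => rhs; rw [← pair_eq_sum_sum, pair_comm, pair_eq_sum_sum]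
      rw [← Finset.sum_add_distrib]
      refine Finset.sum_congr rfl fun i _ => ?_
      rw [← Finset.sum_add_distrib]
      exact Finset.sum_congr rfl fun j _ => by simp only [complexify]; ring
    have h3 : (fun i => (v iF1 : ℂ) * (μ i : ℂ)) = (v iF1 : ℂ) • complexify μ := rfl
    rw [h1, h2, h3, pair_smul_right]
    ring
  · simp only [twPoly, lvec, Sum.elim_inl, Sum.elim_inr, map_add, Derivation.leibniz,
      alphaDer_C, alphaDer_X, smul_eq_mul, mul_zero, add_zero, zero_add, map_mul,
      MvPolynomial.eval_C, twVec, zero_mul]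
  · simp only [twPoly, lvec, Sum.elim_inr, alphaDer_C, map_zero, twVec]

/-- The substitution `ν_ω = ν_𝔷 = 0`, `ν_τ = (2i)⁻¹ (1 / Im τ)`. -/
noncomputable def limPoly (p : MvPolynomial (LIdx l) ℂ) : MvPolynomial (Option (Fin l)) ℂ :=
  MvPolynomial.bind₁ (lvec 0 0 (MvPolynomial.C (1 / (2 * Complex.I)) * MvPolynomial.X none)) p

lemma eval_limPoly (p : MvPolynomial (LIdx l) ℂ) (X : Option (Fin l) → ℂ) :
    MvPolynomial.eval X (limPoly p) =
      MvPolynomial.eval (lvec 0 0 (1 / (2 * Complex.I) * X none)) p := by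
  rw [limPoly]
  induction p using MvPolynomial.induction_on with
  | C a => simp
  | add p q hp hq => simp only [map_add, hp, hq]
  | mul_X p i hp =>
    rw [map_mul, map_mul, hp, MvPolynomial.bind₁_X_right, map_mul, MvPolynomial.eval_X]
    rcases i with _ | i | _ <;> simp [lvec]

lemma pderiv_some_limPoly (p : MvPolynomial (LIdx l) ℂ) (i : Fin l) :
    MvPolynomial.pderiv (some i) (limPoly p) = 0 := by
  rw [limPoly]
  induction p using MvPolynomial.induction_on with
  | C a => simp
  | add p q hp hq => simp only [map_add, hp, hq, add_zero]
  | mul_X p j hp =>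
    rw [map_mul, MvPolynomial.pderiv_mul, hp, MvPolynomial.bind₁_X_right]
    rcases j with _ | j | _ <;> simp [lvec, MvPolynomial.pderiv_X]

lemma pderiv_none_limPoly (p : MvPolynomial (LIdx l) ℂ) :
    MvPolynomial.pderiv none (limPoly p) =
      MvPolynomial.C (1 / (2 * Complex.I)) * limPoly (MvPolynomial.pderiv iF1 p) := by
  simp only [limPoly]
  induction p using MvPolynomial.induction_on with
  | C a => simp
  | add p q hp hq => simp only [map_add, hp, hq, mul_add]
  | mul_X p j hp =>
    rw [map_mul, MvPolynomial.pderiv_mul, hp, MvPolynomial.pderiv_mul, MvPolynomial.bind₁_X_right,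
      map_add, map_mul, map_mul, MvPolynomial.bind₁_X_right, MvPolynomial.pderiv_X]
    rcases j with _ | j | _ <;> simp [lvec, MvPolynomial.pderiv_X]
    ring

lemma HolPoly.limPoly {E : Type*} [NormedAddCommGroup E] [NormedSpace ℂ E] {D : Set E}
    {p : E → MvPolynomial (LIdx l) ℂ} (hp : HolPoly D p) :
    HolPoly D (fun q => limPoly (p q)) :=
  hp.bind₁ (R := fun i _ => (lvec 0 0 (MvPolynomial.C (1 / (2 * Complex.I)) *
    MvPolynomial.X none) : LIdx l → MvPolynomial (Option (Fin l)) ℂ) i) fun _ => HolPoly.const _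

variable {N} {r : ℕ} {F : (LIdx l → ℂ) → Tensor l s}
  {P : ℤ → (Fin l → ℂ) × ℂ → (Fin s → LIdx l) → MvPolynomial (LIdx l) ℂ}

variable (N) in
/-- The expansion of `F_m^lim(v[𝔷, τ])` in the variables `α_i` and `1 / Im τ`. -/
noncomputable def fjPoly (T : (Fin s → LIdx l) → MvPolynomial (LIdx l) ℂ)
    (v : Fin s → LIdx l → ℝ) : MvPolynomial (Option (Fin l)) ℂ :=
  ∑ I, limPoly (T I) * ∏ j, twPoly N (v j) (I j)

lemma eval_fjPoly (T : (Fin s → LIdx l) → MvPolynomial (LIdx l) ℂ) (v : Fin s → LIdx l → ℝ)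
    (X : Option (Fin l) → ℂ) : MvPolynomial.eval X (fjPoly N T v) =
      tensorEval (fun I => MvPolynomial.eval (lvec 0 0 (1 / (2 * Complex.I) * X none)) (T I))
        (fun j => twVec N (fun i => X (some i)) (complexify (v j))) := by
  simp only [fjPoly, tensorEval, map_sum, map_mul, map_prod, eval_limPoly, eval_twPoly]

lemma IsFJExpansion.isPolyExpansion_fjLim (hP : IsFJExpansion N r F P) (m : ℤ)
    (v : Fin s → LIdx l → ℝ) :
    IsPolyExpansion (jacobiDomain l) jacobiVars (fjLim N P m v) (fun q => fjPoly N (P m q) v) := by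
  refine HolPoly.isPolyExpansion (HolPoly.sum _ fun I _ => (hP.holPoly m I).limPoly.mul
    (HolPoly.prod _ fun j _ => HolPoly.const _)) fun q hq => ?_
  rw [← fjPoly, eval_fjPoly, fjLim_eq, coeffEval]
  congr 2
  funext I
  congr 2
  simp only [nuLim, jacobiVars]
  congr 1
  push_cast
  field_simp

lemma coeff_zero_eq_eval {σ : Type*} (p : MvPolynomial σ ℂ) :
    p.coeff 0 = MvPolynomial.eval 0 p := by
  rw [MvPolynomial.eval_zero, MvPolynomial.constantCoeff_eq]

/-- The constant term of `F_m^lim(v[𝔷, τ])` is the value on `v` of the constant term. -/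
lemma coeff_zero_fjPoly (T : (Fin s → LIdx l) → MvPolynomial (LIdx l) ℂ)
    (v : Fin s → LIdx l → ℝ) :
    (fjPoly N T v).coeff 0 = realEval (fun I => (T I).coeff 0) v := by
  rw [coeff_zero_eq_eval, eval_fjPoly, realEval]
  have h1 : (lvec 0 0 (1 / (2 * Complex.I) * (0 : Option (Fin l) → ℂ) none) : LIdx l → ℂ) = 0 := by
    funext a; rcases a with _ | i | _ <;> simp [lvec]
  have h2 : (fun i : Fin l => (0 : Option (Fin l) → ℂ) (some i)) = 0 := rfl
  simp only [h1, h2, twVec_zero, coeff_zero_eq_eval]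

lemma tensorEval_snoc (T : Tensor l (s + 1)) (v : Fin s → LIdx l → ℂ) (w : LIdx l → ℂ) :
    tensorEval T (Fin.snoc (α := fun _ => LIdx l → ℂ) v w) =
      ∑ a, w a * tensorEval (fun I => T (Fin.snoc (α := fun _ => LIdx l) I a)) v := by
  simp only [tensorEval]
  rw [← (Fin.snocEquiv (fun _ : Fin (s + 1) => LIdx l)).sum_comp, Fintype.sum_prod_type]
  refine Finset.sum_congr rfl fun a _ => ?_
  rw [Finset.mul_sum]
  refine Finset.sum_congr rfl fun I _ => ?_
  rw [Fin.prod_univ_castSucc]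
  simp only [Fin.snocEquiv, Equiv.coe_fn_mk, Fin.snoc_castSucc, Fin.snoc_last]
  ring

/-- The operator `-∂/∂(1 / Im τ)` on `F_m^lim` comes from `½ r ∂/∂ν_τ`, the component at `e₁` of
the lowering operator. -/
lemma eval_pderiv_none_fjPoly [NeZero r] (T : (Fin s → LIdx l) → MvPolynomial (LIdx l) ℂ)
    (v : Fin s → LIdx l → ℝ) (X : Option (Fin l) → ℂ) :
    -MvPolynomial.eval X (MvPolynomial.pderiv none (fjPoly N T v)) =
      Complex.I / r * MvPolynomial.eval X (fjPoly N (lowerPoly N r T) (tensorE1 v)) := by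
  classical
  have hr : (r : ℂ) ≠ 0 := Nat.cast_ne_zero.mpr (NeZero.ne r)
  set ν : LIdx l → ℂ := lvec 0 0 (1 / (2 * Complex.I) * X none) with hν
  have hL : MvPolynomial.eval X (MvPolynomial.pderiv none (fjPoly N T v)) =
      1 / (2 * Complex.I) * tensorEval
        (fun I => MvPolynomial.eval ν (MvPolynomial.pderiv iF1 (T I)))
        (fun j => twVec N (fun i => X (some i)) (complexify (v j))) := by
    simp only [fjPoly, map_sum, tensorEval, Finset.mul_sum]
    refine Finset.sum_congr rfl fun I _ => ?_
    rw [Derivation.leibniz, derivation_prod]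
    simp only [pderiv_none_twPoly, mul_zero, Finset.sum_const_zero, zero_add,
      pderiv_none_limPoly, smul_eq_mul, map_mul, map_prod, eval_twPoly, eval_limPoly,
      MvPolynomial.eval_C, ← hν]
    ring
  have hsnoc : (fun j => twVec N (fun i => X (some i)) (complexify (tensorE1 v j))) =
      Fin.snoc (α := fun _ => LIdx l → ℂ)
        (fun j => twVec N (fun i => X (some i)) (complexify (v j)))
        (twVec N (fun i => X (some i)) (complexify vE1)) := by
    funext j
    refine Fin.lastCases ?_ (fun j => ?_) j <;> simp [tensorE1]
  have hE : twVec N (fun i => X (some i)) (complexify vE1) = Pi.single iE1 1 := by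
    funext a
    rcases a with _ | i | _ <;> simp [twVec, complexify, vE1, lvec, ← Pi.zero_def, pair_zero_right]
  have hlow : ∀ I, MvPolynomial.eval ν (lowerPoly N r T (Fin.snoc (α := fun _ => LIdx l) I iE1)) =
      (r / 2 : ℂ) * MvPolynomial.eval ν (MvPolynomial.pderiv iF1 (T I)) := fun I => by
    simp only [lowerPoly, Fin.snoc_last, Fin.snoc_castSucc, map_sum, map_mul, MvPolynomial.eval_C]
    rw [sum_LIdx]
    simp [gramLr, gramL, lvec]
  rw [hL, eval_fjPoly, hsnoc, tensorEval_snoc, hE, Finset.sum_eq_single iE1]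
  · simp only [← hν, hlow, Pi.single_eq_same, one_mul]
    rw [tensorEval_mul_left]
    have := Complex.I_ne_zero
    field_simp
    rw [Complex.I_sq]
    ring
  · intro a _ ha; simp [ha]
  · simp

/-- The product rule for the derivation `∑ μ_i ∂/∂α_i`, which acts on `exp(α ∧ e₁) v` as
`μ ∧ e₁` acts on `v`. -/
lemma eval_alphaDer_fjPoly (T : (Fin s → LIdx l) → MvPolynomial (LIdx l) ℂ)
    (v : Fin s → LIdx l → ℝ) (X : Option (Fin l) → ℂ) (μ : Fin l → ℝ) :
    MvPolynomial.eval X (alphaDer μ (fjPoly N T v)) =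
      ∑ j, MvPolynomial.eval X (fjPoly N T (transvectAt N μ v j)) := by
  have hterm : ∀ (I : Fin s → LIdx l) j,
      (∏ i ∈ Finset.univ.erase j, MvPolynomial.eval X (twPoly N (v i) (I i))) *
      MvPolynomial.eval X (alphaDer μ (twPoly N (v j) (I j))) =
      ∏ i, MvPolynomial.eval X (twPoly N (transvectAt N μ v j i) (I i)) := fun I j => by
    rw [← Finset.mul_prod_erase Finset.univ _ (Finset.mem_univ j), mul_comm,
      eval_alphaDer_twPoly, eval_twPoly]
    have h1 : transvectAt N μ v j j = (eichler (gramL N) (lvec 0 μ 0) vE1).mulVec (v j) :=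
      Function.update_self ..
    rw [h1]
    refine congrArg _ (Finset.prod_congr rfl fun i hi => ?_)
    have h2 : transvectAt N μ v j i = v i := Function.update_of_ne (Finset.ne_of_mem_erase hi) ..
    rw [h2]
  have hI : ∀ I, MvPolynomial.eval X (alphaDer μ (limPoly (T I) * ∏ j, twPoly N (v j) (I j))) =
      ∑ j, MvPolynomial.eval X (limPoly (T I)) *
        ∏ i, MvPolynomial.eval X (twPoly N (transvectAt N μ v j i) (I i)) := fun I => by
    have h0 : alphaDer μ (limPoly (T I)) = 0 := by
      rw [alphaDer_apply]
      exact Finset.sum_eq_zero fun i _ => by rw [pderiv_some_limPoly, mul_zero]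
    rw [Derivation.leibniz, h0, smul_zero, add_zero, derivation_prod, smul_eq_mul, map_mul,
      map_sum, Finset.mul_sum]
    refine Finset.sum_congr rfl fun j _ => ?_
    rw [map_mul, map_prod, hterm]
  simp only [fjPoly]
  rw [map_sum (alphaDer μ), map_sum (MvPolynomial.eval X), Finset.sum_congr rfl fun I _ => hI I,
    Finset.sum_comm]
  refine Finset.sum_congr rfl fun j _ => ?_
  rw [map_sum]
  refine Finset.sum_congr rfl fun I _ => ?_
  rw [map_mul, map_prod]

end FJLimit

/-! ### Unipotent elements of the Jacobi group -/

section Elements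

variable {l : ℕ} {N : EvenLattice l} {r : ℕ} [NeZero r]

open JacobiGroup

lemma eval_bind₁ {σ τ : Type*} (X : τ → ℂ) (R : σ → MvPolynomial τ ℂ) (p : MvPolynomial σ ℂ) :
    MvPolynomial.eval X (MvPolynomial.bind₁ R p) =
      MvPolynomial.eval (fun i => MvPolynomial.eval X (R i)) p :=
  MvPolynomial.eval₂Hom_bind₁ (RingHom.id ℂ) X R p

lemma differentiable_factor (γ : JacobiGroup N) : Differentiable ℂ γ.factor := by
  unfold factor; fun_prop

lemma differentiable_shift (γ : JacobiGroup N) : Differentiable ℂ γ.shift := by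
  unfold JacobiGroup.shift; fun_prop

lemma differentiableOn_actPt (γ : JacobiGroup N) :
    DifferentiableOn ℂ γ.actPt (jacobiDomain l) := fun q hq => by
  have hJ := factor_ne_zero γ hq
  have h1 := differentiable_factor γ q
  have h2 := differentiable_shift γ q
  refine DifferentiableAt.differentiableWithinAt ?_
  unfold actPt
  simp only [div_eq_mul_inv]
  exact ((h1.fun_inv hJ).fun_smul h2).prodMk
    (DifferentiableAt.fun_mul (by fun_prop) (h1.fun_inv hJ))

lemma differentiableOn_expo (γ : JacobiGroup N) :
    DifferentiableOn ℂ γ.expo (jacobiDomain l) := fun q hq => by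
  have hJ := factor_ne_zero γ hq
  refine DifferentiableAt.differentiableWithinAt ?_
  simp only [factor] at hJ
  unfold expo
  simp only [factor, JacobiGroup.shift, pair, dotProduct, Matrix.mulVec, Pi.add_apply,
    Pi.smul_apply, smul_eq_mul]
  fun_prop (disch := assumption)

/-- Some multiple of every element of `SL₂(ℤ) ⋉ H(N)` lies in the Jacobi part of a subgroup of
finite index. -/
lemma exists_pow_mem {G : Subgroup (JacobiGroup N)}
    (hG : G.relIndex (gammaZeroHeis N 1) ≠ 0) :
    ∃ K : ℕ, 0 < K ∧ ∀ γ ∈ gammaZeroHeis N 1, γ ^ K ∈ G := by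
  refine ⟨(G.relIndex (gammaZeroHeis N 1)).factorial, Nat.factorial_pos _, fun γ hγ => ?_⟩
  obtain ⟨n, hn, hle, hmem⟩ := Subgroup.exists_pow_mem_of_relIndex_ne_zero hG hγ
  obtain ⟨j, hj⟩ := Nat.dvd_factorial hn hle
  rw [hj, pow_mul]
  exact pow_mem hmem.1 j

/-- The element `[x, 0; 0]`. -/
def heisX (x : Fin l → ℝ) : JacobiGroup N := ⟨1, x, 0, 0⟩

/-- The element `[0, y; 0]`. -/
def heisY (y : Fin l → ℝ) : JacobiGroup N := ⟨1, 0, y, 0⟩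

/-- The lower triangular unipotent matrix with entry `c`. -/
def lowSL {R : Type*} [CommRing R] (c : R) : SL(2, R) :=
  ⟨!![1, 0; c, 1], by simp [Matrix.det_fin_two_of]⟩

lemma lowSL_apply {R : Type*} [CommRing R] (c : R) :
    lowSL c 0 0 = 1 ∧ lowSL c 0 1 = 0 ∧ lowSL c 1 0 = c ∧ lowSL c 1 1 = 1 :=
  ⟨rfl, rfl, rfl, rfl⟩

/-- The element of the Jacobi group given by a lower triangular unipotent matrix. -/
def lowUni (c : ℝ) : JacobiGroup N := ⟨lowSL c, 0, 0, 0⟩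

lemma heisX_add (x x' : Fin l → ℝ) : (heisX (x + x') : JacobiGroup N) = heisX x * heisX x' := by
  ext <;> simp [heisX, pair_zero_left, pair_zero_right]

lemma heisY_add (y y' : Fin l → ℝ) : (heisY (y + y') : JacobiGroup N) = heisY y * heisY y' := by
  ext <;> simp [heisY, pair_zero_left, pair_zero_right]

lemma heisX_zero : (heisX 0 : JacobiGroup N) = 1 := rfl

lemma heisY_zero : (heisY 0 : JacobiGroup N) = 1 := rfl

lemma lowUni_add (c c' : ℝ) : (lowUni (c + c') : JacobiGroup N) = lowUni c * lowUni c' := by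
  refine JacobiGroup.ext ?_ ?_ ?_ ?_
  · ext i j
    rw [mul_A, sl_mul_apply]
    fin_cases i <;> fin_cases j <;> simp [lowUni, lowSL_apply]
  · simp [lowUni]
  · simp [lowUni]
  · simp [lowUni, pair_zero_right]

lemma heisX_mem (x : Fin l → ℤ) : (heisX (fun i => (x i : ℝ)) : JacobiGroup N) ∈
    gammaZeroHeis N 1 :=
  ⟨⟨1, one_mem _, by simp [heisX]⟩, x, 0, 0, rfl, by ext i; simp [heisX],
    by simp [heisX, pair_zero_right]⟩

lemma heisY_mem (y : Fin l → ℤ) : (heisY (fun i => (y i : ℝ)) : JacobiGroup N) ∈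
    gammaZeroHeis N 1 :=
  ⟨⟨1, one_mem _, by simp [heisY]⟩, 0, y, 0, by ext i; simp [heisY], rfl,
    by simp [heisY, pair_zero_left]⟩

lemma lowUni_mem (c : ℤ) : (lowUni c : JacobiGroup N) ∈ gammaZeroHeis N 1 := by
  refine ⟨⟨lowSL c, ?_, ?_⟩, 0, 0, 0,
    by ext i; simp [lowUni], by ext i; simp [lowUni], by simp [lowUni, pair_zero_left]⟩
  · rw [CongruenceSubgroup.Gamma0_mem]; exact Subsingleton.elim _ _
  · ext i j
    fin_cases i <;> fin_cases j
    exacts [Int.cast_one.symm, Int.cast_zero.symm, rfl, Int.cast_one.symm]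

lemma heisX_pow (x : Fin l → ℝ) (n : ℕ) :
    (heisX x : JacobiGroup N) ^ n = heisX ((n : ℝ) • x) := by
  induction n with
  | zero => simp [heisX_zero]
  | succ n ih => rw [pow_succ, ih, ← heisX_add]; congr 1; push_cast; rw [add_smul, one_smul]

lemma heisY_pow (x : Fin l → ℝ) (n : ℕ) :
    (heisY x : JacobiGroup N) ^ n = heisY ((n : ℝ) • x) := by
  induction n with
  | zero => simp [heisY_zero]
  | succ n ih => rw [pow_succ, ih, ← heisY_add]; congr 1; push_cast; rw [add_smul, one_smul]

lemma lowUni_pow (c : ℝ) (n : ℕ) : (lowUni c : JacobiGroup N) ^ n = lowUni (n * c) := by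
  induction n with
  | zero =>
    refine JacobiGroup.ext ?_ ?_ ?_ ?_ <;> simp [lowUni]
    ext i j; fin_cases i <;> fin_cases j <;> simp [lowSL_apply]
  | succ n ih => rw [pow_succ, ih, ← lowUni_add]; congr 1; push_cast; ring

end Elements

/-! ### Injectivity of the constant term map on Jacobi forms -/

section Injectivity

variable {l : ℕ} {N : EvenLattice l}

open JacobiGroup

/-- The substitution which expresses `α` and `1 / Im τ` at `γ q` in terms of their values
at `q`. -/
noncomputable def jacSubst (γ : JacobiGroup N) (q : (Fin l → ℂ) × ℂ) :
    Option (Fin l) → MvPolynomial (Option (Fin l)) ℂ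
  | some i => MvPolynomial.C (γ.factor q) * (MvPolynomial.X (some i) + MvPolynomial.C (γ.x i : ℂ))
      - MvPolynomial.C (γ.A 1 0 * γ.shift q i)
  | none => MvPolynomial.C (γ.factor q ^ 2) * MvPolynomial.X none
      - MvPolynomial.C (2 * Complex.I * γ.A 1 0 * γ.factor q)

lemma eval_jacSubst (γ : JacobiGroup N) {q : (Fin l → ℂ) × ℂ} (hq : q ∈ jacobiDomain l)
    (j : Option (Fin l)) : MvPolynomial.eval (jacobiVars q) (jacSubst γ q j) =
      jacobiVars (γ.actPt q) j := by
  rcases j with _ | i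
  · simp [jacSubst, jacobiVars_actPt_none γ hq]
  · simp [jacSubst, jacobiVars_actPt_some γ hq]

lemma holPoly_jacSubst (γ : JacobiGroup N) (j : Option (Fin l)) :
    HolPoly (jacobiDomain l) (fun q => jacSubst γ q j) := by
  have h1 := (differentiable_factor γ).differentiableOn (s := jacobiDomain l)
  have h2 : ∀ i, DifferentiableOn ℂ (fun q => γ.shift q i) (jacobiDomain l) := fun i =>
    (differentiable_pi.mp (differentiable_shift γ) i).differentiableOn
  rcases j with _ | i
  · exact ((HolPoly.coeffC (h1.fun_pow 2)).mul (HolPoly.const _)).sub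
      (HolPoly.coeffC (h1.const_mul _))
  · exact ((HolPoly.coeffC h1).mul ((HolPoly.const _).add (HolPoly.const _))).sub
      (HolPoly.coeffC ((h2 i).const_mul _))

variable {G : Subgroup (JacobiGroup N)} {k m : ℤ} {Φ : (Fin l → ℂ) × ℂ → ℂ}
  {Q : (Fin l → ℂ) × ℂ → MvPolynomial (Option (Fin l)) ℂ}

/-- The invariance of an almost-holomorphic Jacobi form, as an identity of polynomials. -/
lemma poly_slash {γ : JacobiGroup N} (hQ : IsPolyExpansion (jacobiDomain l) jacobiVars Φ Q)
    (hΦ : ∀ q ∈ jacobiDomain l, jacobiSlash k m γ Φ q = Φ q) :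
    ∀ q ∈ jacobiDomain l, Q q = MvPolynomial.C (γ.factor q ^ (-k) * qexp (m * γ.expo q)) *
      MvPolynomial.bind₁ (jacSubst γ q) (Q (γ.actPt q)) := by
  have hhol : DifferentiableOn ℂ (fun q => γ.factor q ^ (-k) * qexp (m * γ.expo q))
      (jacobiDomain l) :=
    ((differentiable_factor γ).differentiableOn.zpow (Or.inl fun q hq => factor_ne_zero γ hq)).mul
      (differentiable_qexp.comp_differentiableOn ((differentiableOn_expo γ).const_mul _))
  refine jacobi_expansion_unique hQ.holPoly ((HolPoly.coeffC hhol).mul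
    ((hQ.holPoly.comp (differentiableOn_actPt γ) fun q hq => actPt_mem γ hq).bind₁
      (R := fun j q => jacSubst γ q j) (holPoly_jacSubst γ))) fun q hq => ?_
  rw [← hQ.eq q hq, map_mul, MvPolynomial.eval_C, eval_bind₁]
  simp only [eval_jacSubst γ hq]
  have h := hQ.eq (γ.actPt q) (actPt_mem γ hq)
  have h2 : (fun i => jacobiVars (γ.actPt q) i) = jacobiVars (γ.actPt q) := rfl
  rw [h2, ← h, ← hΦ q hq, jacobiSlash_apply]
  ring

/-- An almost-holomorphic Jacobi form with vanishing constant term vanishes: the polynomial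
vanishes at the translates of the origin by lower triangular elements of the Jacobi group, and
these are Zariski dense. -/
theorem IsPolyExpansion.eq_zero_of_coeff_zero (hG : G.relIndex (gammaZeroHeis N 1) ≠ 0)
    (hQ : IsPolyExpansion (jacobiDomain l) jacobiVars Φ Q)
    (hΦ : ∀ γ ∈ G, ∀ q ∈ jacobiDomain l, jacobiSlash k m γ Φ q = Φ q)
    (h0 : ∀ q ∈ jacobiDomain l, (Q q).coeff 0 = 0) : ∀ q ∈ jacobiDomain l, Q q = 0 := by
  obtain ⟨K, hK, hmem⟩ := exists_pow_mem hG
  have hK' : (K : ℝ) ≠ 0 := Nat.cast_ne_zero.mpr hK.ne'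
  intro q' hq'
  have hτ : 0 < q'.2.im := hq'
  -- the values at the translates of the origin
  have hval : ∀ (n : ℤ) (u : Fin l → ℤ), MvPolynomial.eval (fun j => Option.elim j
      (-(2 * Complex.I * (K * n)) / (1 - K * n * q'.2))
      (fun i => ((K * u i : ℂ) - K * n * q'.1 i) / (1 - K * n * q'.2))) (Q q') = 0 := by
    intro n u
    set γ : JacobiGroup N := lowUni (K * n) * heisX (fun i => K * u i) with hγ
    have hγG : γ ∈ G := by
      refine mul_mem ?_ ?_
      · rw [← lowUni_pow]; exact hmem _ (lowUni_mem n)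
      · have := hmem _ (heisX_mem (N := N) u)
        rw [heisX_pow] at this
        exact this
    have hA : γ.A 0 0 = 1 ∧ γ.A 0 1 = 0 ∧ γ.A 1 0 = K * n ∧ γ.A 1 1 = 1 := by
      simpa [hγ, lowUni, heisX] using lowSL_apply (K * n : ℝ)
    have hx : γ.x = fun i => (K * u i : ℝ) := by simp [hγ, lowUni, heisX]
    have hy : γ.y = 0 := by simp [hγ, lowUni, heisX]
    obtain ⟨hA0, hA1, hA2, hA3⟩ := hA
    have hD : (1 - K * n * q'.2 : ℂ) ≠ 0 := by
      intro h
      have h1 := congrArg Complex.im h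
      have h2 := congrArg Complex.re h
      simp [hK.ne', hτ.ne'] at h1 h2
      simp [h1] at h2
    -- the preimage of `q'` under `γ`
    set τ : ℂ := q'.2 / (1 - K * n * q'.2) with hτdef
    set q : (Fin l → ℂ) × ℂ := (fun i => q'.1 i / (1 - K * n * q'.2) - K * u i * τ, τ) with hqdef
    have hq : q ∈ jacobiDomain l := by
      have h1 := actPt_mem (lowUni (-(K * n)) : JacobiGroup N) hq'
      have h2 : ((lowUni (-(K * n)) : JacobiGroup N).actPt q').2 = τ := by
        simp [actPt, lowUni, factor, hτdef, lowSL_apply]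
        congr 1
        ring
      change 0 < τ.im
      rw [← h2]
      exact h1
    have hJ : γ.factor q = 1 / (1 - K * n * q'.2) := by
      simp only [factor, hA2, hA3, hqdef, hτdef]
      push_cast
      field_simp
      ring
    have hw : γ.shift q = fun i => q'.1 i / (1 - K * n * q'.2) := by
      funext i
      simp [JacobiGroup.shift, hx, hy, hqdef, complexify]
      ring
    have hact : γ.actPt q = q' := by
      refine Prod.ext ?_ ?_
      · funext i
        simp only [actPt, Pi.smul_apply, smul_eq_mul, hw, hJ]
        field_simp
      · simp only [actPt, hA0, hA1, hJ]
        simp only [hqdef, hτdef]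
        have hD' : (1 : ℂ) - q'.2 * K * n ≠ 0 := by convert hD using 2; ring
        push_cast
        field_simp
        ring
    have h1 := poly_slash hQ (hΦ γ hγG) q hq
    have h2 := congrArg (MvPolynomial.eval 0) h1
    have h3 : MvPolynomial.eval 0 (Q q) = 0 := by
      rw [MvPolynomial.eval_zero, MvPolynomial.constantCoeff_eq, h0 q hq]
    rw [h3, map_mul (MvPolynomial.eval 0), MvPolynomial.eval_C, eval_bind₁, hact] at h2
    have hne : γ.factor q ^ (-k) * qexp (m * γ.expo q) ≠ 0 :=
      mul_ne_zero (zpow_ne_zero _ (factor_ne_zero γ hq)) (qexp_ne_zero _)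
    convert! (mul_eq_zero.mp h2.symm).resolve_left hne using 2
    congr 1
    funext j
    rcases j with _ | i
    · simp only [jacSubst, hJ, hA2, Option.elim]
      simp
      ring
    · simp only [jacSubst, hJ, hA2, hx, hw, Option.elim]
      simp
      ring
  have hD : ∀ n : ℤ, (1 - K * n * q'.2 : ℂ) ≠ 0 := fun n h => by
    have h1 := congrArg Complex.im h
    have h2 := congrArg Complex.re h
    simp [hK.ne', hτ.ne'] at h1 h2
    simp [h1] at h2
  have hKc : (K : ℂ) ≠ 0 := Nat.cast_ne_zero.mpr hK.ne'
  have hα : ∀ (n : ℤ) (α : Fin l → ℂ), MvPolynomial.eval (fun j => Option.elim j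
      (-(2 * Complex.I * (K * n)) / (1 - K * n * q'.2)) α) (Q q') = 0 := by
    intro n α
    set p : MvPolynomial (Fin l) ℂ := MvPolynomial.bind₁ (fun j => Option.elim j
      (MvPolynomial.C (-(2 * Complex.I * (K * n)) / (1 - K * n * q'.2))) MvPolynomial.X) (Q q')
      with hp
    have hev : ∀ α : Fin l → ℂ, MvPolynomial.eval α p = MvPolynomial.eval (fun j => Option.elim j
        (-(2 * Complex.I * (K * n)) / (1 - K * n * q'.2)) α) (Q q') := fun α => by
      rw [hp, eval_bind₁]
      congr 2
      funext j
      rcases j with _ | i <;> simp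
    rw [← hev, show p = 0 from MvPolynomial.funext_set
      (fun i => Set.range fun u : ℤ => ((K * u : ℂ) - K * n * q'.1 i) / (1 - K * n * q'.2))
      (fun i => Set.infinite_range_of_injective fun u u' h => ?_) fun x hx => ?_, map_zero]
    · simp only [div_left_inj' (hD n), sub_left_inj, mul_right_inj' hKc] at h
      exact_mod_cast h
    · choose u hu using fun i => hx i (Set.mem_univ i)
      rw [hev, map_zero, ← hval n u]
      congr 2
      funext j
      rcases j with _ | i
      · rfl
      · exact (hu i).symm
  refine MvPolynomial.funext_set (fun j => Option.elim j
    (Set.range fun n : ℤ => (-(2 * Complex.I * (K * n)) / (1 - K * n * q'.2) : ℂ))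
    fun _ => Set.univ) (fun j => ?_) fun X hX => ?_
  · rcases j with _ | i
    · refine Set.infinite_range_of_injective fun n n' h => ?_
      have h1 := hD n
      have h2 := hD n'
      change _ / _ = _ / _ at h
      rw [div_eq_div_iff h1 h2] at h
      have h3 : (2 * Complex.I * K : ℂ) * n = (2 * Complex.I * K) * n' := by linear_combination -h
      exact_mod_cast mul_left_cancel₀ (by simp [hKc]) h3
    · exact Set.infinite_univ
  · obtain ⟨n, hn⟩ := hX none (Set.mem_univ none)
    rw [map_zero, ← hα n fun i => X (some i)]
    congr 2
    funext j
    rcases j with _ | i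
    · exact hn.symm
    · rfl

end Injectivity

/-! ### The action of the Heisenberg group on the Fourier–Jacobi coefficients -/

section Heisenberg

variable {l s : ℕ} {N : EvenLattice l} {r : ℕ} [NeZero r]
  {F : (LIdx l → ℂ) → Tensor l s}
  {P : ℤ → (Fin l → ℂ) × ℂ → (Fin s → LIdx l) → MvPolynomial (LIdx l) ℂ}

open JacobiGroup

/-- The transvections `exp(α ∧ e₁)` are isometries. -/
lemma pair_twVec (α : Fin l → ℂ) (u v : LIdx l → ℂ) :
    pair (gramL N) (twVec N α u) (twVec N α v) = pair (gramL N) u v := by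
  have h : ∀ v : LIdx l → ℂ, (fun i => twVec N α v (iN i)) =
      (fun i => v (iN i)) + v iF1 • α := fun v => rfl
  rw [pair_gramL, pair_gramL, h, h]
  simp only [twVec, lvec, Sum.elim_inl, Sum.elim_inr, pair_add_left, pair_add_right,
    pair_smul_left, pair_smul_right, pair_comm N _ α]
  ring

lemma nu_eq_pair (z : LIdx l → ℂ) (b : LIdx l) :
    nu N r z b = pair (gramL N) (complexify (imVec z)) (Pi.single b 1) /
      (Complex.I * pair (gramL N) (complexify (imVec z)) (complexify (imVec z))) := by
  have hr : (r : ℂ) ≠ 0 := Nat.cast_ne_zero.mpr (NeZero.ne r)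
  have h : (∑ a, (imVec z a : ℂ) * ((r : ℂ) * (gramL N a b : ℂ))) =
      r * pair (gramL N) (complexify (imVec z)) (Pi.single b 1) := by
    rw [pair, Matrix.mulVec_single_one, dotProduct, Finset.mul_sum]
    refine Finset.sum_congr rfl fun a _ => ?_
    simp [Matrix.col, complexify]
    ring
  rw [nu, h, imSq, Complex.ofReal_mul, Complex.ofReal_natCast, ofReal_pair, mul_left_comm,
    mul_div_mul_left _ _ hr]

variable {γ : JacobiGroup N}

lemma factor_of_A_eq_one (hA : γ.A = 1) (q : (Fin l → ℂ) × ℂ) : γ.factor q = 1 := by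
  simp [factor, hA]

lemma actPt_of_A_eq_one (hA : γ.A = 1) (q : (Fin l → ℂ) × ℂ) :
    γ.actPt q = (q.1 + q.2 • complexify γ.x + complexify γ.y, q.2) := by
  simp [actPt, factor_of_A_eq_one hA, hA, JacobiGroup.shift]

lemma deriv_of_A_eq_one (hA : γ.A = 1) (q : (Fin l → ℂ) × ℂ) (V : LIdx l → ℂ) :
    γ.deriv q V = twVec N (complexify γ.x) V := by
  rw [JacobiGroup.deriv, factor_of_A_eq_one hA, hA]
  funext a
  rcases a with _ | i | _ <;> simp [scaleVec, lvec]

lemma expo_of_A_eq_one (hA : γ.A = 1) (q : (Fin l → ℂ) × ℂ) :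
    γ.expo q = 1 / 2 * pair N.gram (complexify γ.x) (complexify γ.x) * q.2
      + pair N.gram (complexify γ.x) q.1
      + 1 / 2 * pair N.gram (complexify γ.x) (complexify γ.y) + γ.κ := by
  simp [expo, hA]

lemma im_pair_complexify (x : Fin l → ℝ) (w : Fin l → ℂ) :
    (pair N.gram (complexify x) w).im = pair N.gram x (fun i => (w i).im) := by
  simp [pair, dotProduct, Matrix.mulVec, complexify, Complex.im_sum]

lemma im_expo_of_A_eq_one (hA : γ.A = 1) (q : (Fin l → ℂ) × ℂ) :
    (γ.expo q).im = 1 / 2 * pair N.gram γ.x γ.x * q.2.im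
      + pair N.gram γ.x (fun i => (q.1 i).im) := by
  rw [expo_of_A_eq_one hA]
  have h1 := ofReal_pair N.gram γ.x γ.x
  have h2 := ofReal_pair N.gram γ.x γ.y
  rw [← h1, ← h2]
  simp [im_pair_complexify]

/-- The Heisenberg group acts on imaginary parts by transvections. -/
lemma imVec_heis (hA : γ.A = 1) (u : ℂ) (q : (Fin l → ℂ) × ℂ) :
    complexify (imVec (slicePt (u + γ.expo q) (γ.actPt q))) =
      twVec N (complexify γ.x) (complexify (imVec (slicePt u q))) := by
  rw [actPt_of_A_eq_one hA]
  funext a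
  rcases a with _ | i | _ <;>
    simp only [complexify, imVec, slicePt, lvec, twVec, Sum.elim_inl, Sum.elim_inr]
  · rw [Complex.add_im, im_expo_of_A_eq_one hA]
    have h1 := ofReal_pair N.gram γ.x γ.x
    have h2 := ofReal_pair N.gram γ.x (fun i => (q.1 i).im)
    push_cast
    rw [h1, h2]
    have h3 : (fun i => ((q.1 i).im : ℂ)) = complexify fun i => (q.1 i).im := rfl
    rw [h3]
    ring
  · simp [complexify]

/-- The action on `ν` of an element of the Heisenberg group with `x = α`. It is contragredient to
the action on `L_ℂ`. -/
noncomputable def nuTwist (N : EvenLattice l) (α : Fin l → ℂ) (ν : LIdx l → ℂ) : LIdx l → ℂ :=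
  fun b => ∑ a, ν a * twVec N (-α) (Pi.single b 1) a

lemma nu_heis (hA : γ.A = 1) (u : ℂ) (q : (Fin l → ℂ) × ℂ) :
    nu N r (slicePt (u + γ.expo q) (γ.actPt q)) =
      nuTwist N (complexify γ.x) (nu N r (slicePt u q)) := by
  funext b
  simp only [nuTwist, nu_eq_pair, imVec_heis hA, pair_twVec]
  have h : twVec N (complexify γ.x) (twVec N (-complexify γ.x) (Pi.single b 1)) =
      Pi.single b 1 := by
    rw [← twVec_add, add_neg_cancel, twVec_zero]
  conv_lhs => rw [← h, pair_twVec, pair_eq_sum_single]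
  rw [Finset.sum_div]
  exact Finset.sum_congr rfl fun a _ => by ring

/-- The transformation of the Fourier–Jacobi coefficients under the Heisenberg group holds
identically in `ν`, by the uniqueness of expansions in `ν`. -/
lemma coeffEval_heis {g : GL (MIdx l) ℤ}
    (hg : Matrix.GeneralLinearGroup.map (Int.castRingHom ℝ) g = toGL N r γ) (hA : γ.A = 1) {k : ℤ}
    (hF : ∀ z ∈ tube N, slash N r k g F z = F z) (hP : IsFJExpansion N r F P) (m : ℤ)
    {q : (Fin l → ℂ) × ℂ} (hq : q ∈ jacobiDomain l) (ν : LIdx l → ℂ)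
    (v : Fin s → LIdx l → ℂ) :
    coeffEval P m q ν v = qexp (m * γ.expo q) *
      coeffEval P m (γ.actPt q) (nuTwist N (complexify γ.x) ν)
        (fun j => twVec N (complexify γ.x) (v j)) := by
  set R : LIdx l → MvPolynomial (LIdx l) ℂ := fun b =>
    ∑ a, MvPolynomial.X a * MvPolynomial.C (twVec N (-complexify γ.x) (Pi.single b 1) a) with hR
  have hRν : ∀ ν, (fun b => MvPolynomial.eval ν (R b)) = nuTwist N (complexify γ.x) ν := fun ν => by
    funext b; simp [hR, nuTwist]
  set P1 : (LIdx l → ℂ) → MvPolynomial (LIdx l) ℂ := fun z =>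
    ∑ I, P m (zTau z) I * MvPolynomial.C (∏ j, v j (I j)) with hP1
  set P2 : (LIdx l → ℂ) → MvPolynomial (LIdx l) ℂ := fun z =>
    MvPolynomial.C (qexp (m * γ.expo (zTau z))) *
      ∑ I, MvPolynomial.bind₁ R (P m (γ.actPt (zTau z)) I) *
        MvPolynomial.C (∏ j, twVec N (complexify γ.x) (v j) (I j)) with hP2
  have e1 : ∀ z ν, MvPolynomial.eval ν (P1 z) = coeffEval P m (zTau z) ν v := fun z ν => by
    simp [hP1, coeffEval, tensorEval]
  have e2 : ∀ z ν, MvPolynomial.eval ν (P2 z) = qexp (m * γ.expo (zTau z)) *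
      coeffEval P m (γ.actPt (zTau z)) (nuTwist N (complexify γ.x) ν)
        (fun j => twVec N (complexify γ.x) (v j)) := fun z ν => by
    simp [hP2, coeffEval, tensorEval, eval_bind₁, hRν]
  have hz : Differentiable ℂ (zTau (l := l)) := by unfold zTau; fun_prop
  have hm : Set.MapsTo (zTau (l := l)) (tube N) (jacobiDomain l) := fun z hz =>
    (mem_tube_iff.mp hz).1
  have hact : DifferentiableOn ℂ (fun z => γ.actPt (zTau z)) (tube N) :=
    (differentiableOn_actPt γ).comp hz.differentiableOn hm
  have hS : DifferentiableOn ℂ (fun z => qexp (m * γ.expo (zTau z))) (tube N) :=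
    differentiable_qexp.comp_differentiableOn
      (((differentiableOn_expo γ).comp hz.differentiableOn hm).const_mul _)
  have h1 : HolPoly (tube N) P1 := HolPoly.sum _ fun I _ =>
    ((hP.holPoly m I).comp hz.differentiableOn hm).mul (HolPoly.const _)
  have h2 : HolPoly (tube N) P2 := (HolPoly.coeffC hS).mul (HolPoly.sum _ fun I _ =>
    (((hP.holPoly m I).comp hact fun z hz => actPt_mem γ (hm hz)).bind₁
      (R := fun b _ => R b) (fun b => HolPoly.const _)).mul (HolPoly.const _))
  have h := nu_expansion_unique N r h1 h2 (fun z hz => by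
    have hq := mem_tube_iff.mp hz
    have h3 : nu N r z = nu N r (slicePt ((z iE1).im * Complex.I) (zTau z)) := nu_congr (by
      funext a; rcases a with _ | i | _ <;> simp [imVec, slicePt, lvec, zTau])
    rw [e1, e2, h3, coeffEval_slash hg hF hP hq.1 hq.2 m v, factor_of_A_eq_one hA, nu_heis hA]
    simp only [deriv_of_A_eq_one hA]
    simp) _ (exists_mem_tube (N := N) hq)
  have h4 := congrArg (MvPolynomial.eval ν) h
  rwa [e1, e2, zTau_slicePt] at h4

end Heisenberg

/-! ### Functions of Gaussian decay -/

section Growth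

variable {T : Type*} {n : T → ℤ} {f g : T → ℂ}

/-- `f` grows at most exponentially in `|n|`. -/
def ExpGrowth (n : T → ℤ) (f : T → ℂ) : Prop :=
  ∃ (C : ℝ) (D : ℕ), ∀ t, ‖f t‖ ≤ C * Real.exp (D * |(n t : ℝ)|)

namespace ExpGrowth

lemma of_bounded {C : ℝ} (h : ∀ t, ‖f t‖ ≤ C) : ExpGrowth n f := ⟨C, 0, fun t => by simpa using h t⟩

lemma const (c : ℂ) : ExpGrowth n (fun _ => c) := of_bounded fun _ => le_rfl

lemma add (hf : ExpGrowth n f) (hg : ExpGrowth n g) : ExpGrowth n (fun t => f t + g t) := by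
  obtain ⟨C, D, h⟩ := hf
  obtain ⟨C', D', h'⟩ := hg
  refine ⟨|C| + |C'|, D + D', fun t => ?_⟩
  have hn := abs_nonneg (n t : ℝ)
  have h1 : Real.exp (D * |(n t : ℝ)|) ≤ Real.exp ((D + D' : ℕ) * |(n t : ℝ)|) := by
    gcongr; simp
  have h2 : Real.exp (D' * |(n t : ℝ)|) ≤ Real.exp ((D + D' : ℕ) * |(n t : ℝ)|) := by
    gcongr; simp
  calc ‖f t + g t‖ ≤ ‖f t‖ + ‖g t‖ := norm_add_le _ _
    _ ≤ |C| * Real.exp (D * |(n t : ℝ)|) + |C'| * Real.exp (D' * |(n t : ℝ)|) :=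
      add_le_add ((h t).trans (by gcongr; exact le_abs_self C))
        ((h' t).trans (by gcongr; exact le_abs_self C'))
    _ ≤ _ := by rw [add_mul]; gcongr

lemma mul (hf : ExpGrowth n f) (hg : ExpGrowth n g) : ExpGrowth n (fun t => f t * g t) := by
  obtain ⟨C, D, h⟩ := hf
  obtain ⟨C', D', h'⟩ := hg
  refine ⟨C * C', D + D', fun t => ?_⟩
  rw [norm_mul]
  refine (mul_le_mul (h t) (h' t) (norm_nonneg _) ((norm_nonneg _).trans (h t))).trans_eq ?_
  push_cast
  rw [add_mul, Real.exp_add]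
  ring

lemma sum {ι : Type*} (s : Finset ι) {f : ι → T → ℂ} (h : ∀ i ∈ s, ExpGrowth n (f i)) :
    ExpGrowth n (fun t => ∑ i ∈ s, f i t) := by
  classical
  induction s using Finset.induction_on with
  | empty => simpa using const (n := n) 0
  | insert a s ha ih =>
    simp only [Finset.sum_insert ha]
    exact (h a (Finset.mem_insert_self _ _)).add
      (ih fun i hi => h i (Finset.mem_insert_of_mem hi))

lemma prod {ι : Type*} (s : Finset ι) {f : ι → T → ℂ} (h : ∀ i ∈ s, ExpGrowth n (f i)) :
    ExpGrowth n (fun t => ∏ i ∈ s, f i t) := by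
  classical
  induction s using Finset.induction_on with
  | empty => simpa using const (n := n) 1
  | insert a s ha ih =>
    simp only [Finset.prod_insert ha]
    exact (h a (Finset.mem_insert_self _ _)).mul
      (ih fun i hi => h i (Finset.mem_insert_of_mem hi))

lemma pow (hf : ExpGrowth n f) (k : ℕ) : ExpGrowth n (fun t => f t ^ k) := by
  have := prod (n := n) (Finset.range k) (f := fun _ => f) (fun _ _ => hf)
  simpa using this

lemma intCast : ExpGrowth n (fun t => (n t : ℂ)) := ⟨1, 1, fun t => by
  have h : ‖((n t : ℤ) : ℂ)‖ = |(n t : ℝ)| := by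
    rw [← Complex.ofReal_intCast, Complex.norm_real, Real.norm_eq_abs]
  rw [h]
  have := Real.add_one_le_exp |(n t : ℝ)|
  simp only [Nat.cast_one, one_mul]
  linarith⟩

lemma pair {ι : Type*} [Fintype ι] (G : Matrix ι ι ℤ) {x y : T → ι → ℂ}
    (hx : ∀ i, ExpGrowth n fun t => x t i) (hy : ∀ i, ExpGrowth n fun t => y t i) :
    ExpGrowth n fun t => pair G (x t) (y t) := by
  simp only [OrthogonalFJ.pair, dotProduct, Matrix.mulVec]
  exact sum _ fun i _ => (hx i).mul (sum _ fun j _ => (const _).mul (hy j))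

lemma twVec {l : ℕ} (N : EvenLattice l) {α : T → Fin l → ℂ} (hα : ∀ i, ExpGrowth n fun t => α t i)
    (v : LIdx l → ℂ) (a : LIdx l) : ExpGrowth n fun t => twVec N (α t) v a := by
  rcases a with _ | i | _ <;> simp only [OrthogonalFJ.twVec, lvec, Sum.elim_inl, Sum.elim_inr]
  · have h1 := pair N.gram (y := fun _ i => v (iN i)) hα fun i => const _
    have h2 := ((const (n := n) (1 / 2)).mul (pair N.gram hα hα)).mul (const (v iF1))
    exact ((const (v iE1)).add h1).add h2
  · exact (const _).add ((const _).mul (hα i))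
  · exact const _

lemma eval {σ : Type*} [Finite σ] {p : T → MvPolynomial σ ℂ} {X : T → σ → ℂ} {d : ℕ}
    (hd : ∀ t, (p t).totalDegree ≤ d) (hc : ∀ u, ExpGrowth n fun t => (p t).coeff u)
    (hX : ∀ i, ExpGrowth n fun t => X t i) :
    ExpGrowth n fun t => MvPolynomial.eval (X t) (p t) := by
  have h : (fun t => MvPolynomial.eval (X t) (p t)) = fun t =>
      ∑ u ∈ (Finsupp.finite_of_degree_le (σ := σ) d).toFinset,
        (p t).coeff u * ∏ i ∈ u.support, X t i ^ u i := by
    funext t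
    conv_lhs => rw [eq_sum_of_totalDegree_le d (p t) (hd t)]
    simp only [map_sum, MvPolynomial.eval_monomial]
    rfl
  rw [h]
  exact sum _ fun u _ => (hc u).mul (prod _ fun i _ => (hX i).pow _)

end ExpGrowth

/-- An entire function which decays like a Gaussian in an integer valued function vanishes. -/
lemma eq_zero_of_gaussian_bound {h : ℂ → ℂ} (hd : Differentiable ℂ h) {n : ℂ → ℤ}
    (hn : Function.Surjective n) {a C D : ℝ} (ha : 0 < a)
    (hb : ∀ t, ‖h t‖ ≤ C * Real.exp (D * |(n t : ℝ)| - a * (n t : ℝ) ^ 2)) (t : ℂ) : h t = 0 := by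
  have hbound : Bornology.IsBounded (Set.range h) := by
    rw [isBounded_iff_forall_norm_le]
    refine ⟨|C| * Real.exp (D ^ 2 / (4 * a)), ?_⟩
    rintro _ ⟨t, rfl⟩
    refine (hb t).trans ?_
    gcongr
    · exact le_abs_self C
    · rw [le_div_iff₀ (by positivity), ← sq_abs (n t : ℝ)]
      nlinarith [sq_nonneg (D - 2 * a * |(n t : ℝ)|)]
  have hlim : Filter.Tendsto (fun j : ℕ => C * Real.exp (D * (j : ℝ) - a * (j : ℝ) ^ 2))
      Filter.atTop (nhds 0) := by
    have h1 : Filter.Tendsto (fun j : ℕ => (j : ℝ) * (a * (j : ℝ) - D)) Filter.atTop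
        Filter.atTop := by
      have h0 := tendsto_natCast_atTop_atTop (R := ℝ)
      exact h0.atTop_mul_atTop₀ (Filter.tendsto_atTop_add_const_right _ (-D)
        (h0.const_mul_atTop ha))
    have h2 := (Real.tendsto_exp_neg_atTop_nhds_zero.comp h1).const_mul C
    rw [mul_zero] at h2
    refine h2.congr fun j => ?_
    simp only [Function.comp]
    congr 2
    ring
  have h3 : ‖h t‖ ≤ 0 := ge_of_tendsto' hlim fun j => by
    obtain ⟨t', ht'⟩ := hn j
    -- Liouville's theorem
    rw [hd.apply_eq_apply_of_bounded hbound t t']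
    have := hb t'
    rw [ht'] at this
    simpa using this
  exact norm_le_zero_iff.mp h3

end Growth

/-! ### Fourier–Jacobi coefficients of negative index -/

section Vanishing

variable {l s : ℕ} {N : EvenLattice l} {r : ℕ} [NeZero r]
  {F : (LIdx l → ℂ) → Tensor l s}
  {P : ℤ → (Fin l → ℂ) × ℂ → (Fin s → LIdx l) → MvPolynomial (LIdx l) ℂ}

open JacobiGroup

lemma HolPoly.differentiableOn_eval {E σ : Type*} [NormedAddCommGroup E] [NormedSpace ℂ E]
    [Finite σ] {D : Set E} {Q : E → MvPolynomial σ ℂ} (h : HolPoly D Q) (X : σ → ℂ) :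
    DifferentiableOn ℂ (fun p => MvPolynomial.eval X (Q p)) D := by
  obtain ⟨d, hd⟩ := h.degree_le
  refine DifferentiableOn.congr
    (f := fun p => ∑ t ∈ (Finsupp.finite_of_degree_le (σ := σ) d).toFinset,
      (Q p).coeff t * ∏ i ∈ t.support, X i ^ t i)
    (DifferentiableOn.fun_sum fun t _ => (h.hol t).mul_const _) fun p hp => ?_
  conv_lhs => rw [eq_sum_of_totalDegree_le d (Q p) (hd p hp)]
  simp only [map_sum, MvPolynomial.eval_monomial]
  rfl

/-- Fourier–Jacobi coefficients of negative index vanish if `N ≠ 0`: on a complex line in the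
direction of a basis vector of `N`, the invariance under translations by lattice vectors bounds
them by a Gaussian. -/
theorem IsFJExpansion.eq_zero_of_neg {Γ : Subgroup (GL (MIdx l) ℤ)} {k : ℤ}
    (hfin : (jacobiPart N r Γ).relIndex (gammaZeroHeis N 1) ≠ 0)
    (hF : ∀ g ∈ Γ, ∀ z ∈ tube N, slash N r k g F z = F z) (hP : IsFJExpansion N r F P)
    (hl : 0 < l) {m : ℤ} (hm : m < 0) {q : (Fin l → ℂ) × ℂ} (hq : q ∈ jacobiDomain l)
    (I : Fin s → LIdx l) : P m q I = 0 := by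
  obtain ⟨K, hK, hmem⟩ := exists_pow_mem hfin
  have hK' : (0 : ℝ) < K := Nat.cast_pos.mpr hK
  have hτ : 0 < q.2.im := hq
  set bZ : Fin l → ℤ := Pi.single ⟨0, hl⟩ 1 with hbZ
  set b : Fin l → ℝ := fun i => (bZ i : ℝ) with hb
  have hb0 : b ≠ 0 := fun h => by simpa [hb, hbZ] using congrFun h ⟨0, hl⟩
  have hB : 0 < pair N.gram b b := pair_pos N hb0
  set B := pair N.gram b b with hBdef
  set β := pair N.gram b (fun i => (q.1 i).im) with hβ
  refine MvPolynomial.funext fun ν => ?_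
  rw [map_zero]
  set v : Fin s → LIdx l → ℂ := fun j => Pi.single (I j) 1 with hv
  set Q : ℂ → (Fin l → ℂ) × ℂ := fun t => (q.1 + t • complexify b, q.2) with hQ
  have hQd : Differentiable ℂ Q := by simp only [hQ]; fun_prop
  have hQm : ∀ t, Q t ∈ jacobiDomain l := fun t => hq
  -- the reduction of `t` modulo the lattice `K (ℤ τ + ℤ)`
  set n : ℂ → ℤ := fun t => ⌊t.im / (K * q.2.im)⌋ with hn
  set n' : ℂ → ℤ := fun t => ⌊(t.re - n t * K * q.2.re) / K⌋ with hn'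
  set red : ℂ → ℂ := fun t => t - n t * K * q.2 - n' t * K with hred
  have him : ∀ t, t.im = n t * (K * q.2.im) + (red t).im := fun t => by simp [hred]; ring
  have hred1 : ∀ t, 0 ≤ (red t).im ∧ (red t).im ≤ K * q.2.im := fun t => by
    have h1 := Int.floor_le (t.im / (K * q.2.im))
    have h2 := (Int.lt_floor_add_one (t.im / (K * q.2.im))).le
    rw [le_div_iff₀ (by positivity)] at h1
    rw [div_le_iff₀ (by positivity)] at h2
    have h3 := him t
    change (n t : ℝ) * _ ≤ _ at h1
    change _ ≤ ((n t : ℝ) + 1) * _ at h2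
    constructor <;> linarith
  have hred2 : ∀ t, 0 ≤ (red t).re ∧ (red t).re ≤ K := fun t => by
    have h1 := Int.floor_le ((t.re - n t * K * q.2.re) / K)
    have h2 := (Int.lt_floor_add_one ((t.re - n t * K * q.2.re) / K)).le
    rw [le_div_iff₀ (by positivity)] at h1
    rw [div_le_iff₀ (by positivity)] at h2
    have h3 : (red t).re = t.re - n t * K * q.2.re - n' t * K := by simp [hred]
    change (n' t : ℝ) * _ ≤ _ at h1
    change _ ≤ ((n' t : ℝ) + 1) * _ at h2
    constructor <;> linarith
  have hcompact : IsCompact (Metric.closedBall (0 : ℂ) (K + K * q.2.im)) :=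
    isCompact_closedBall _ _
  have hredmem : ∀ t, red t ∈ Metric.closedBall (0 : ℂ) (K + K * q.2.im) := fun t => by
    rw [mem_closedBall_zero_iff]
    refine (Complex.norm_le_abs_re_add_abs_im _).trans ?_
    rw [abs_of_nonneg (hred1 t).1, abs_of_nonneg (hred2 t).1]
    exact add_le_add (hred2 t).2 (hred1 t).2
  -- the translation which maps `t` to its reduction
  set γ : ℂ → JacobiGroup N := fun t =>
    heisX ((K : ℝ) • fun i => ((-n t * bZ i : ℤ) : ℝ)) *
      heisY ((K : ℝ) • fun i => ((-n' t * bZ i : ℤ) : ℝ)) with hγ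
  have hγG : ∀ t, γ t ∈ jacobiPart N r Γ := fun t => by
    refine mul_mem ?_ ?_
    · rw [← heisX_pow]; exact hmem _ (heisX_mem _)
    · rw [← heisY_pow]; exact hmem _ (heisY_mem _)
  have hA : ∀ t, (γ t).A = 1 := fun t => by simp [hγ, heisX, heisY]
  have hx : ∀ t, (γ t).x = (-(n t * K) : ℝ) • b := fun t => by
    funext i; simp [hγ, heisX, heisY, hb]; ring
  have hy : ∀ t, (γ t).y = (-(n' t * K) : ℝ) • b := fun t => by
    funext i; simp [hγ, heisX, heisY, hb]; ring
  have hxc : ∀ t, complexify (γ t).x = fun i => (n t : ℂ) * (-(K * b i)) := fun t => by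
    funext i; simp [hx, complexify]; ring
  have hact : ∀ t, (γ t).actPt (Q t) = Q (red t) := fun t => by
    rw [actPt_of_A_eq_one (hA t)]
    refine Prod.ext ?_ rfl
    funext i
    simp [hQ, hx, hy, complexify, hred]
    ring
  -- for `m < 0`, the leading term makes `e(m S)` decay like a Gaussian in `n`
  have hS : ∀ t, ((γ t).expo (Q t)).im =
      -(1 / 2 * K ^ 2 * B * q.2.im) * (n t : ℝ) ^ 2 - n t * K * (β + B * (red t).im) := fun t => by
    have h1 : (fun i => ((Q t).1 i).im) = (fun i => (q.1 i).im) + t.im • b := by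
      funext i; simp [hQ, complexify]
    rw [im_expo_of_A_eq_one (hA t), hx, h1]
    simp only [pair_smul_left, pair_smul_right, pair_add_right, ← hBdef, ← hβ]
    rw [him t]
    simp only [hQ]
    ring
  set h : ℂ → ℂ := fun t => coeffEval P m (Q t) ν v with hh
  have hd : Differentiable ℂ h := by
    simp only [hh, coeffEval, tensorEval]
    refine Differentiable.fun_sum fun J _ => Differentiable.mul_const ?_ _
    rw [← differentiableOn_univ]
    exact ((hP.holPoly m J).differentiableOn_eval ν).comp hQd.differentiableOn fun t _ => hQm t
  have htr : ∀ t, h t = qexp (m * (γ t).expo (Q t)) * coeffEval P m (Q (red t))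
      (nuTwist N (complexify (γ t).x) ν) (fun j => twVec N (complexify (γ t).x) (v j)) := fun t => by
    obtain ⟨g, hg, hgγ⟩ := (mem_jacobiPart N r).mp (hγG t)
    rw [← hact t]
    exact coeffEval_heis hgγ (hA t) (hF g hg) hP m (hQm t) ν v
  have hα : ∀ i, ExpGrowth n fun t => complexify (γ t).x i := fun i => by
    simp only [hxc]
    exact ExpGrowth.intCast.mul (ExpGrowth.const _)
  have hα' : ∀ i, ExpGrowth n fun t => (-complexify (γ t).x) i := fun i => by
    simpa using (ExpGrowth.const (-1)).mul (hα i)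
  have hgrow : ExpGrowth n fun t => coeffEval P m (Q (red t))
      (nuTwist N (complexify (γ t).x) ν) (fun j => twVec N (complexify (γ t).x) (v j)) := by
    simp only [coeffEval, tensorEval]
    refine ExpGrowth.sum _ fun J _ => ExpGrowth.mul ?_
      (ExpGrowth.prod _ fun j _ => ExpGrowth.twVec N hα _ _)
    obtain ⟨d, hd⟩ := (hP.holPoly m J).degree_le
    refine ExpGrowth.eval (fun t => hd _ (hQm _)) (fun u => ?_) fun a =>
      ExpGrowth.sum _ fun c _ => (ExpGrowth.const _).mul (ExpGrowth.twVec N hα' _ _)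
    have hc : Continuous fun t => (P m (Q t) J).coeff u := by
      rw [← continuousOn_univ]
      exact (((hP.holPoly m J).hol u).comp hQd.differentiableOn fun t _ => hQm t).continuousOn
    obtain ⟨C, hC⟩ := hcompact.exists_bound_of_continuousOn hc.continuousOn
    exact ExpGrowth.of_bounded fun t => hC _ (hredmem t)
  obtain ⟨C, D, hCD⟩ := hgrow
  have hm' : (0 : ℝ) < -m := by exact_mod_cast neg_pos.mpr hm
  have hπ := Real.pi_pos
  have key := eq_zero_of_gaussian_bound hd (n := n) (a := Real.pi * (-m) * K ^ 2 * B * q.2.im)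
    (C := C) (D := D + 2 * Real.pi * (-m) * K * (|β| + B * (K * q.2.im))) ?_ (by positivity) ?_ 0
  · have h0 : Q 0 = q := by simp [hQ]
    simp only [hh, h0, coeffEval, hv] at key
    rwa [tensorEval_single (fun J => MvPolynomial.eval ν (P m q J))] at key
  · intro j
    refine ⟨(j * (K * q.2.im) : ℝ) * Complex.I, ?_⟩
    have : (K * q.2.im : ℝ) ≠ 0 := by positivity
    simp only [hn, Complex.im_ofReal_mul, Complex.I_im, mul_one]
    rw [mul_div_cancel_right₀ _ this, Int.floor_intCast]
  · intro t
    rw [htr, norm_mul, norm_qexp]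
    have h1 : ((m : ℂ) * (γ t).expo (Q t)).im = m * ((γ t).expo (Q t)).im := by simp
    have h2 : -(2 * Real.pi * (m * ((γ t).expo (Q t)).im)) ≤
        2 * Real.pi * (-m) * K * (|β| + B * (K * q.2.im)) * |(n t : ℝ)| -
        Real.pi * (-m) * K ^ 2 * B * q.2.im * (n t : ℝ) ^ 2 := by
      have h3 : -(n t * (β + B * (red t).im)) ≤ |(n t : ℝ)| * (|β| + B * (K * q.2.im)) := by
        refine (neg_le_abs _).trans ?_
        rw [abs_mul]
        gcongr
        refine (abs_add_le _ _).trans ?_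
        rw [abs_of_nonneg (mul_nonneg hB.le (hred1 t).1)]
        gcongr
        exact (hred1 t).2
      have h4 : 0 ≤ 2 * Real.pi * (-m) * K := by positivity
      have h5 := mul_le_mul_of_nonneg_left h3 h4
      rw [hS]
      linarith
    rw [h1]
    calc _ ≤ Real.exp (2 * Real.pi * (-m) * K * (|β| + B * (K * q.2.im)) * |(n t : ℝ)| -
        Real.pi * (-m) * K ^ 2 * B * q.2.im * (n t : ℝ) ^ 2) *
          (C * Real.exp (D * |(n t : ℝ)|)) := by
            gcongr
            exact hCD t
      _ = _ := by
        rw [mul_left_comm, ← Real.exp_add]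
        congr 2
        ring

end Vanishing

/-! ### Jacobi forms from Fourier–Jacobi coefficients -/

section JacobiForms

variable {l s : ℕ} {N : EvenLattice l} {r : ℕ} [NeZero r]
  {F : (LIdx l → ℂ) → Tensor l s}
  {P : ℤ → (Fin l → ℂ) × ℂ → (Fin s → LIdx l) → MvPolynomial (LIdx l) ℂ}
  {P' : ℤ → (Fin l → ℂ) × ℂ → (Fin (s + 1) → LIdx l) → MvPolynomial (LIdx l) ℂ}
  {Γ : Subgroup (GL (MIdx l) ℤ)} {k : ℤ}

lemma isAHJac_fjLim (hF : ∀ g ∈ Γ, ∀ z ∈ tube N, slash N r k g F z = F z)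
    (hP : IsFJExpansion N r F P) (m : ℤ) {v : Fin s → LIdx l → ℝ} (hv : IsHomogeneous v) :
    IsAHJac (jacobiPart N r Γ) (k + wt v) m (fjLim N P m v) where
  almostHol := ⟨_, hP.isPolyExpansion_fjLim m v⟩
  slash_eq γ hγ q hq := by
    obtain ⟨g, hg, hgγ⟩ := (mem_jacobiPart N r).mp hγ
    exact jacobiSlash_fjLim hgγ (hF g hg) hP hv m hq

lemma lowerJac_fjLim (hP : IsFJExpansion N r F P) (hP' : IsFJExpansion N r (lowering N r F) P')
    (m : ℤ) (v : Fin s → LIdx l → ℝ) {q : (Fin l → ℂ) × ℂ} (hq : q ∈ jacobiDomain l) :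
    lowerJac (fjLim N P m v) q = Complex.I / r * fjLim N P' m (tensorE1 v) q := by
  rw [((hP.isPolyExpansion_fjLim m v).lowerJac).eq q hq,
    (hP'.isPolyExpansion_fjLim m (tensorE1 v)).eq q hq, hP'.unique hP.lowering m hq, map_neg,
    eval_pderiv_none_fjPoly (r := r)]

lemma xiJac_fjLim (hP : IsFJExpansion N r F P) (m : ℤ) (v : Fin s → LIdx l → ℝ)
    (μ : Fin l → ℝ) {q : (Fin l → ℂ) × ℂ} (hq : q ∈ jacobiDomain l) :
    xiJac μ (fjLim N P m v) q = ∑ j, fjLim N P m (transvectAt N μ v j) q := by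
  rw [((hP.isPolyExpansion_fjLim m v).xiJac μ).eq q hq, ← alphaDer_apply,
    eval_alphaDer_fjPoly]
  exact Finset.sum_congr rfl fun j _ => ((hP.isPolyExpansion_fjLim m _).eq q hq).symm

variable {fm : ℤ → (Fin l → ℂ) × ℂ → Tensor l s}

lemma isJacCt_fjLim (hP : IsFJExpansion N r F P)
    (hfm : ∀ m, ∀ q ∈ jacobiDomain l, fm m q = fun I => (P m q I).coeff 0) (m : ℤ)
    (v : Fin s → LIdx l → ℝ) : IsJacCt (fjLim N P m v) (fun q => realEval (fm m q) v) :=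
  ⟨_, hP.isPolyExpansion_fjLim m v, fun q hq => by
    change realEval (fm m q) v = _
    rw [coeff_zero_fjPoly, hfm m q hq]⟩

/-- The function `F_m^lim(v[𝔷, τ])` is the only completion of its constant term: the constant term
map is injective on almost-holomorphic Jacobi forms. -/
lemma isPolyExpansion_of_isJacCt (hfin : (jacobiPart N r Γ).relIndex (gammaZeroHeis N 1) ≠ 0)
    (hF : ∀ g ∈ Γ, ∀ z ∈ tube N, slash N r k g F z = F z) (hP : IsFJExpansion N r F P)
    (hfm : ∀ m, ∀ q ∈ jacobiDomain l, fm m q = fun I => (P m q I).coeff 0) {m : ℤ}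
    {v : Fin s → LIdx l → ℝ} (hv : IsHomogeneous v) {Φ : (Fin l → ℂ) × ℂ → ℂ}
    (hΦ : IsAHJac (jacobiPart N r Γ) (k + wt v) m Φ)
    (hct : IsJacCt Φ (fun q => realEval (fm m q) v)) :
    IsPolyExpansion (jacobiDomain l) jacobiVars Φ (fun q => fjPoly N (P m q) v) := by
  obtain ⟨Q, hQ, hQ0⟩ := hct
  have h1 := hP.isPolyExpansion_fjLim m v
  have h2 := isAHJac_fjLim hF hP m hv
  have hsub : IsPolyExpansion (jacobiDomain l) jacobiVars (fun q => Φ q - fjLim N P m v q)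
      (fun q => Q q - fjPoly N (P m q) v) :=
    (hQ.holPoly.sub h1.holPoly).isPolyExpansion fun q hq => by
      rw [hQ.eq q hq, h1.eq q hq, map_sub]
  have hzero := hsub.eq_zero_of_coeff_zero (k := k + wt v) (m := m) hfin (fun γ hγ q hq => by
    have h3 := hΦ.slash_eq γ hγ q hq
    have h4 := h2.slash_eq γ hγ q hq
    rw [jacobiSlash_apply] at h3 h4 ⊢
    linear_combination h3 - h4) fun q hq => by
      rw [MvPolynomial.coeff_sub, coeff_zero_fjPoly, ← hfm m q hq, sub_eq_zero]
      exact (hQ0 q hq).symm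
  exact h1.holPoly.isPolyExpansion fun q hq => by
    rw [hQ.eq q hq, sub_eq_zero.mp (hzero q hq)]

lemma isQJacImage_lowerJac (hfin : (jacobiPart N r Γ).relIndex (gammaZeroHeis N 1) ≠ 0)
    (hF : ∀ g ∈ Γ, ∀ z ∈ tube N, slash N r k g F z = F z) (hP : IsFJExpansion N r F P)
    (hfm : ∀ m, ∀ q ∈ jacobiDomain l, fm m q = fun I => (P m q I).coeff 0)
    {gm : ℤ → (Fin l → ℂ) × ℂ → Tensor l (s + 1)}
    (hgm : ∀ m, ∀ q ∈ jacobiDomain l, gm m q = fun I => (lowerPoly N r (P m q) I).coeff 0)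
    (m : ℤ) {v : Fin s → LIdx l → ℝ} (hv : IsHomogeneous v) :
    IsQJacImage (jacobiPart N r Γ) (k + wt v) m lowerJac (fun q => realEval (fm m q) v)
      (fun q => Complex.I / r * realEval (gm m q) (tensorE1 v)) := by
  refine ⟨⟨_, isAHJac_fjLim hF hP m hv, isJacCt_fjLim hP hfm m v⟩, fun Φ hΦ hct =>
    ⟨_, (isPolyExpansion_of_isJacCt hfin hF hP hfm hv hΦ hct).lowerJac, fun q hq => ?_⟩⟩
  change Complex.I / r * realEval (gm m q) (tensorE1 v) = _
  rw [hgm m q hq, ← coeff_zero_fjPoly, coeff_zero_eq_eval, coeff_zero_eq_eval, map_neg,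
    eval_pderiv_none_fjPoly (r := r)]

lemma isQJacImage_xiJac (hfin : (jacobiPart N r Γ).relIndex (gammaZeroHeis N 1) ≠ 0)
    (hF : ∀ g ∈ Γ, ∀ z ∈ tube N, slash N r k g F z = F z) (hP : IsFJExpansion N r F P)
    (hfm : ∀ m, ∀ q ∈ jacobiDomain l, fm m q = fun I => (P m q I).coeff 0)
    (m : ℤ) {v : Fin s → LIdx l → ℝ} (hv : IsHomogeneous v) (μ : Fin l → ℝ) :
    IsQJacImage (jacobiPart N r Γ) (k + wt v) m (xiJac μ) (fun q => realEval (fm m q) v)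
      (fun q => ∑ j, realEval (fm m q) (transvectAt N μ v j)) := by
  refine ⟨⟨_, isAHJac_fjLim hF hP m hv, isJacCt_fjLim hP hfm m v⟩, fun Φ hΦ hct =>
    ⟨_, (isPolyExpansion_of_isJacCt hfin hF hP hfm hv hΦ hct).xiJac μ, fun q hq => ?_⟩⟩
  change ∑ j, realEval (fm m q) (transvectAt N μ v j) = _
  rw [coeff_zero_eq_eval, ← alphaDer_apply, eval_alphaDer_fjPoly]
  refine Finset.sum_congr rfl fun j _ => ?_
  rw [hfm m q hq, ← coeff_zero_fjPoly, coeff_zero_eq_eval]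

lemma IsAHMod.exists_isFJExpansion (hF : IsAHMod N r Γ k F)
    (hexp : ∃ γ ∈ Γ, (γ : Matrix (MIdx l) (MIdx l) ℤ).map (Int.cast : ℤ → ℝ) =
      NormedSpace.exp (eichler (gramM N r) (mvec 0 vE1 0) (mvec 1 0 0))) :
    ∃ P, IsFJExpansion N r F P := by
  obtain ⟨p, hp⟩ := IsAHMod.exists_isNuExpansion N r hF
  exact OrthogonalFJ.exists_isFJExpansion hp fun z hz => hF.add_vE1 hexp hz

/-- Fourier–Jacobi coefficients of a constant term are constant terms. -/
lemma IsTensorExpansion.eq_coeff_zero {f : (LIdx l → ℂ) → Tensor l s}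
    (hf : IsTensorExpansion N f fm) (hP : IsFJExpansion N r F P) (hct : IsCt N r F f) (m : ℤ)
    {q : (Fin l → ℂ) × ℂ} (hq : q ∈ jacobiDomain l) : fm m q = fun I => (P m q I).coeff 0 :=
  funext fun I => IsFourierExpansion.unique (hf I) (hP.tensorExpansion hct I) hq m

end JacobiForms

end OrthogonalFJ

theorem mainTheorem6 {l : ℕ} (N : EvenLattice l) (r : ℕ) [NeZero r]
    (Γ : Subgroup (GL (MIdx l) ℤ)) (hΓ : Γ ≤ OPlus N r) (hfin : Γ.relIndex (OPlus N r) ≠ 0)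
    (hexp : ∃ γ ∈ Γ, (γ : Matrix (MIdx l) (MIdx l) ℤ).map (Int.cast : ℤ → ℝ) =
      NormedSpace.exp (eichler (gramM N r) (mvec 0 vE1 0) (mvec 1 0 0)))
    (k : ℤ) (s : ℕ) :
    -- the group `Γ ∩ Γ^J(N, ℝ)` is a finite index subgroup of `SL₂(ℤ) ⋉ H(N)`
    (jacobiPart N r Γ ≤ gammaZeroHeis N 1 ∧
      (jacobiPart N r Γ).relIndex (gammaZeroHeis N 1) ≠ 0 ∧
      (Γ = OPlus N r → jacobiPart N r Γ = gammaZeroHeis N r)) ∧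
    -- Fourier–Jacobi coefficients of almost-holomorphic modular forms
    (∀ F : (LIdx l → ℂ) → Tensor l s, IsAHMod N r Γ k F →
      (∃ P, IsFJExpansion N r F P) ∧
      (∃ P', IsFJExpansion N r (lowering N r F) P') ∧
      ∀ P, IsFJExpansion N r F P →
        (0 < l → ∀ m < 0, ∀ q ∈ jacobiDomain l, ∀ I, P m q I = 0) ∧
        ∀ (m : ℤ) (v : Fin s → LIdx l → ℝ), IsHomogeneous v →
          IsAHJac (jacobiPart N r Γ) (k + wt v) m (fjLim N P m v) ∧
          (Γ = OPlus N r → IsAHJac (gammaZeroHeis N r) (k + wt v) m (fjLim N P m v)) ∧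
          (∀ P', IsFJExpansion N r (lowering N r F) P' → ∀ q ∈ jacobiDomain l,
            lowerJac (fjLim N P m v) q = Complex.I / r * fjLim N P' m (tensorE1 v) q) ∧
          (∀ μ : Fin l → ℝ, ∀ q ∈ jacobiDomain l,
            xiJac μ (fjLim N P m v) q = ∑ j, fjLim N P m (transvectAt N μ v j) q)) ∧
    -- Fourier–Jacobi coefficients of quasimodular forms
    (∀ f : (LIdx l → ℂ) → Tensor l s, IsQMod N r Γ k f →
      (∃ fm, IsTensorExpansion N f fm) ∧
      (∃ g gm, IsQLowering N r Γ k f g ∧ IsTensorExpansion N g gm) ∧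
      ∀ fm, IsTensorExpansion N f fm →
        (0 < l → ∀ m < 0, ∀ q ∈ jacobiDomain l, fm m q = 0) ∧
        ∀ (m : ℤ) (v : Fin s → LIdx l → ℝ), IsHomogeneous v →
          IsQJac (jacobiPart N r Γ) (k + wt v) m (fun q => realEval (fm m q) v) ∧
          (∀ g gm, IsQLowering N r Γ k f g → IsTensorExpansion N g gm →
            IsQJacImage (jacobiPart N r Γ) (k + wt v) m lowerJac
              (fun q => realEval (fm m q) v)
              (fun q => Complex.I / r * realEval (gm m q) (tensorE1 v))) ∧
          (∀ μ : Fin l → ℝ,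
            IsQJacImage (jacobiPart N r Γ) (k + wt v) m (xiJac μ)
              (fun q => realEval (fm m q) v)
              (fun q => ∑ j, realEval (fm m q) (transvectAt N μ v j)))) := by
  have hfinJ := relIndex_jacobiPart_ne_zero N r hfin
  refine ⟨⟨?_, hfinJ, fun h => h ▸ jacobiPart_OPlus N r⟩, fun F hF => ?_, fun f hf => ?_⟩
  · exact (jacobiPart_mono N r hΓ).trans ((jacobiPart_OPlus N r).trans_le (gammaZeroHeis_le N r))
  · obtain ⟨P₀, hP₀⟩ := hF.exists_isFJExpansion hexp
    refine ⟨⟨P₀, hP₀⟩, ⟨_, hP₀.lowering⟩, fun P hP => ⟨fun hl m hm q hq I =>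
      hP.eq_zero_of_neg hfinJ hF.slash_eq hl hm hq I, fun m v hv => ⟨?_, fun h => ?_, ?_, ?_⟩⟩⟩
    · exact isAHJac_fjLim hF.slash_eq hP m hv
    · rw [← jacobiPart_OPlus, ← h]
      exact isAHJac_fjLim hF.slash_eq hP m hv
    · exact fun P' hP' q hq => lowerJac_fjLim hP hP' m v hq
    · exact fun μ q hq => xiJac_fjLim hP m v μ hq
  · obtain ⟨F, hF, hct⟩ := hf
    obtain ⟨P, hP⟩ := hF.exists_isFJExpansion hexp
    have hct' : ∃ g, IsCt N r (lowering N r F) g := by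
      obtain ⟨p, hp, -⟩ := hP.lowering
      exact ⟨fun z I => (p z I).coeff 0, p, hp, fun _ _ _ => rfl⟩
    obtain ⟨g₀, hg₀⟩ := hct'
    refine ⟨⟨_, hP.tensorExpansion hct⟩,
      ⟨g₀, _, ⟨F, hF, hct, hg₀⟩, hP.lowering.tensorExpansion hg₀⟩, fun fm hfm => ⟨?_, ?_⟩⟩
    · intro hl m hm q hq
      rw [hfm.eq_coeff_zero hP hct m hq]
      funext I
      rw [hP.eq_zero_of_neg hfinJ hF.slash_eq hl hm hq I]
      simp
    · intro m v hv
      have hfm0 : ∀ m, ∀ q ∈ jacobiDomain l, fm m q = fun I => (P m q I).coeff 0 :=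
        fun m q hq => hfm.eq_coeff_zero hP hct m hq
      refine ⟨⟨_, isAHJac_fjLim hF.slash_eq hP m hv, isJacCt_fjLim hP hfm0 m v⟩, ?_, fun μ =>
        isQJacImage_xiJac hfinJ hF.slash_eq hP hfm0 m hv μ⟩
      -- `𝖫(f)` may have been formed with another completion of `f`
      rintro g gm ⟨F', hF', hctF', hctg⟩ hgm
      obtain ⟨P', hP'⟩ := hF'.exists_isFJExpansion hexp
      exact isQJacImage_lowerJac hfinJ hF'.slash_eq hP'
        (fun m q hq => hfm.eq_coeff_zero hP' hctF' m hq)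
        (fun m q hq => hgm.eq_coeff_zero hP'.lowering hctg m hq) m hv
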